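/- **Setting.** Let $A\in\mathbb R^{m\times n}$ ($m\ge 1$), $f(x)=\sum_{i=1}^n f_i(x^i)$ and $g(v)=\sum_{j=1}^m g_j(v^j)$ with $f_i,g_j$ proper convex lower semicontinuous on $\mathbb R$, and let $f_2:\mathbb R^n\to\mathbb R$ be convex and differentiable with coordinatewise Lipschitz constants $L_i$ of $\nabla f_2$. Put $F=f+f_2$ and $L(x,y)=F(x)+\langle Ax,y\rangle-g^*(y)$. The probabilities $p_i>0$ sum to $1$; $\underline p=\min_ip_i$, $\pi_j=\sum_{i:A_{j,i}\ne0}p_i$, $\theta_j=\pi_j/\underline p$. Every row of $A$ is nonzero, and $L_i>0$ or the column $A_i\neq0$ for every $i$. For $\gamma\in(0,1)$ and $s>0$ the step sizes are $$\sigma^j(s)=\frac{s}{\theta_j\max_{i'}\|A_{i'}\|},\qquad \tau^i(s)=\frac{\gamma(2-\underline p/p_i)}{L_i+s\|A_i\|^2/\max_{i'}\|A_{i'}\|}.$$ The smoothed gap is $$G_{\beta_x,\beta_y}(z,\dot z)=\sup_{x',y'}\ L(x,y')-L(x',y)-\tfrac{\beta_x}2\|x'-\dot x\|^2-\tfrac{\beta_y}2\|y'-\dot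 y\|^2 .$$ *PURE-CD.* From $z_0=(x_0,y_0)$ and $\check y_0=y_0$, iterate: $\bar y_{k+1}=\mathrm{prox}_{\sigma,g^*}(y_k+\sigma Ax_k)$; $\bar x_{k+1}=\mathrm{prox}_{\tau,f}(x_k-\tau(\nabla f_2(x_k)+A^\top\bar y_{k+1}))$; draw $i$ with probability $p_i$, independently of the past; replace the coordinate $x^i$ by $\bar x_{k+1}^i$; for $j$ with $A_{j,i}\neq0$ set $y^j_{k+1}=\bar y^j_{k+1}+\sigma^j\theta_j(A(x_{k+1}-x_k))_j$ and $\check y_{k+1}^j=\bar y_{k+1}^j$; leave all other coordinates unchanged. For $k\ge1$, $z^{\rm av}_k=\frac1k\sum_{k'=1}^k(x_{k'},\check y_{k'})$. *Restarted algorithm.* Let $c_1,c_2,s_0>0$, $0<\delta<1$, $r\ge1$, let $\tilde z_0=z_0$ be given and $\varepsilon_0=G_{c_1s_0,c_2/s_0}(z_0,z_0)$, assumed positive and finite. The $l$-th inner loop runs PURE-CD from $\tilde z_l$ with step sizes $\tau(s_l),\sigma(s_l)$ until the first $k=k_l\ge1$ at which the gap $G_{c_1s_l/k,\,c_2/(ks_l)}(z_k^{\rm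 av},z_k^{\rm av})$ is at most $\varepsilon_l$. Then $\tilde z_{l+1}=z_{k_l}$; the new threshold is $\varepsilon_{l+1}=\delta\,G_{c_1s_l/k_l,\,c_2/(k_ls_l)}(z^{\rm av}_{k_l},z^{\rm av}_{k_l})$ or, more generally, any number between this value and $\delta\varepsilon_l$; and $s_{l+1}>0$ is chosen in any way that depends only on the past and changes each $\tau^i$ and $\sigma^j$ by a factor in $[r^{-1},r]$. Assume that, almost surely, $|F(\tilde x_l)|\le M$ and $|\sum_j(\pi_j^{-1}-1)g_j^*(\tilde y_l^{j})|\le M$ for all $l$. For a saddle point $z^*=(x^*,y^*)$ of $L$ (assumed to exist) let $$\Delta_0(z_0)=(1-\underline p)\big(L(x_0,y^*)-L(x^*,y^*)\big)+\tfrac{\underline p}2\|x_0-x^*\|^2_{\tau(s_0)^{-1}p^{-1}}+\tfrac{\underline p}2\|y_0-y^*\|^2_{\sigma(s_0)^{-1}\pi^{-1}},$$ $$B_L(C_3,C_5)=\frac{LC_3}{\rho\varepsilon_0}\,\frac{\delta^{-L}-1}{\delta^{-1}-1}+\frac{LC_5\Delta_0(z_0)}{\rho\varepsilon_0}\,\frac{(r^2/\delta)^L-1}{r^2/\delta-1}+L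 .$$ **Theorem.** There are a constant $C_5$ depending only on the problem data, $\gamma,c_1,c_2,s_0$, and a constant $C_3$ depending in addition on $z_0$, $z^*$ and $M$ (neither depends on $\delta,r,\rho,L$ or on how the $s_l,\varepsilon_l$ are chosen), such that, for all $\delta\in(0,1)$ and $r\ge1$: 1. For all $\rho>0$ and $L\ge0$, with probability at least $1-\rho$ the tested smoothed gap becomes at most $\delta^L\varepsilon_0$ within a total of at most $B_{L+1}(C_3,C_5)$ inner iterations. 2. For all $\rho>0$ and $L\ge0$, if $\varepsilon_l=\delta^l\varepsilon_0$ for $l<L$, then with probability at least $1-\rho$ the first $L$ inner loops all terminate, $\sum_{l=0}^{L-1}k_l\le B_L(C_3,C_5)$, and for each $l<L$ the gap at the end of loop $l$ is at most $\delta^l\varepsilon_0$. 3. With constants $C_3',C_5'$ that may also depend on $\delta$ and $r$: for all $\rho\in(0,1)$ and $L\ge1$, with probability at least $1-\rho$ the tested gap becomes at most $\delta^L\varepsilon_0$ within at most $B_L(C_3',C_5')$ inner iterations. 4. If $r=\delta^{-\alpha/2}$ with $\alpha>0$, there is a constant $C$, independent of $\rho$ and $\varepsilon$, such that for all $\rho>0$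 and $0<\varepsilon\le\varepsilon_0$, with probability at least $1-\rho$ the tested gap becomes at most $\varepsilon$ within at most $\frac C\rho\,\varepsilon^{-\alpha-1}$ inner iterations. -/

import Mathlib

universe u

open MeasureTheory ProbabilityTheory

noncomputable section

namespace PureCD

/-- A proper, convex, lower semicontinuous function of one real variable with values in
`(-∞, +∞]`. -/
structure IsClosedConvex (φ : ℝ → EReal) : Prop where
  ne_bot : ∀ u, φ u ≠ ⊥
  proper : ∃ u, φ u ≠ ⊤
  lsc : LowerSemicontinuous φ
  convex : ∀ u v a b : ℝ, 0 ≤ a → 0 ≤ b → a + b = 1 →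
    φ (a * u + b * v) ≤ (a : EReal) * φ u + (b : EReal) * φ v

/-- Fenchel conjugate of a function of one real variable. -/
def conj (φ : ℝ → EReal) (v : ℝ) : EReal :=
  ⨆ u : ℝ, ((u * v : ℝ) : EReal) - φ u

/-- Proximal operator `prox_{tφ}(v) = argmin_u φ(u) + (u - v)² / (2t)`, for `t > 0`. -/
def prox (t : ℝ) (φ : ℝ → EReal) (v : ℝ) : ℝ :=
  Classical.epsilon fun u => ∀ w : ℝ,
    φ u + (((u - v) ^ 2 / (2 * t) : ℝ) : EReal) ≤ φ w + (((w - v) ^ 2 / (2 * t) : ℝ) : EReal)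

/-- The `i`-th partial derivative. -/
def partialDeriv {n : ℕ} (h : (Fin n → ℝ) → ℝ) (x : Fin n → ℝ) (i : Fin n) : ℝ :=
  fderiv ℝ h x (Pi.single i 1)

/-- A primal-dual pair `z = (x, y)`. -/
structure Point (n m : ℕ) where
  x : Fin n → ℝ
  y : Fin m → ℝ

/-- Data of the problem `min_x f(x) + f₂(x) + g(Ax)` with `f(x) = ∑ f_i(x_i)` and
`g(v) = ∑ g_j(v_j)`, together with the sampling probabilities `p_i` of the coordinates and
coordinatewise Lipschitz constants `Lip i` of `∇f₂`. -/
structure Problem (n m : ℕ) where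
  A : Matrix (Fin m) (Fin n) ℝ
  f : Fin n → ℝ → EReal
  f₂ : (Fin n → ℝ) → ℝ
  g : Fin m → ℝ → EReal
  Lip : Fin n → ℝ
  p : Fin n → ℝ
  m_pos : 0 < m
  f_closed : ∀ i, IsClosedConvex (f i)
  g_closed : ∀ j, IsClosedConvex (g j)
  f₂_convex : ConvexOn ℝ Set.univ f₂
  f₂_diff : Differentiable ℝ f₂
  Lip_nonneg : ∀ i, 0 ≤ Lip i
  f₂_lip : ∀ (i : Fin n) (x : Fin n → ℝ) (h : ℝ),
    |partialDeriv f₂ (x + Pi.single i h) i - partialDeriv f₂ x i| ≤ Lip i * |h|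
  p_pos : ∀ i, 0 < p i
  p_sum : ∑ i, p i = 1
  /-- Every dual coordinate can be selected, that is `π_j > 0`. -/
  row_ne : ∀ j, ∃ i, A j i ≠ 0
  /-- The primal step sizes `τ^i(s)` are well defined. -/
  col_ne : ∀ i, 0 < Lip i ∨ ∃ j, A j i ≠ 0

namespace Problem

variable {n m : ℕ} (P : Problem n m)

/-- `p̲ = min_i p_i`. -/
def pmin : ℝ := ⨅ i, P.p i

/-- `π_j`: the sum of the `p_i` over all `i` with `A_{j,i} ≠ 0`. -/
def prob (j : Fin m) : ℝ := ∑ i, if P.A j i ≠ 0 then P.p i else 0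

/-- `θ_j = π_j / p̲`. -/
def theta (j : Fin m) : ℝ := P.prob j / P.pmin

/-- `‖A_i‖`, the Euclidean norm of the `i`-th column. -/
def colNorm (i : Fin n) : ℝ := √(∑ j, P.A j i ^ 2)

/-- `max_i ‖A_i‖`. -/
def maxCol : ℝ := ⨆ i, P.colNorm i

/-- Dual step sizes `σ^j(s)`. -/
def sigma (s : ℝ) (j : Fin m) : ℝ := s / (P.theta j * P.maxCol)

/-- Primal step sizes `τ^i(s)`. -/
def tau (γ s : ℝ) (i : Fin n) : ℝ :=
  γ * (2 - P.pmin / P.p i) / (P.Lip i + s * P.colNorm i ^ 2 / P.maxCol)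

/-- `f(x) + f₂(x)`. -/
def primal (x : Fin n → ℝ) : EReal := (∑ i, P.f i (x i)) + (P.f₂ x : EReal)

/-- `g*(y) = ∑_j g_j*(y_j)`. -/
def dual (y : Fin m → ℝ) : EReal := ∑ j, conj (P.g j) (y j)

/-- `⟨Ax, y⟩`. -/
def coupling (x : Fin n → ℝ) (y : Fin m → ℝ) : ℝ := ∑ j, P.A.mulVec x j * y j

/-- The Lagrangian `f(x) + f₂(x) + ⟨Ax, y⟩ - g*(y)`. -/
def lagrangian (x : Fin n → ℝ) (y : Fin m → ℝ) : EReal :=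
  P.primal x + (P.coupling x y : EReal) - P.dual y

/-- Saddle points of the Lagrangian. -/
structure IsSaddle (z : Point n m) : Prop where
  primal_ne_top : P.primal z.x ≠ ⊤
  dual_ne_top : P.dual z.y ≠ ⊤
  le_left : ∀ y, P.lagrangian z.x y ≤ P.lagrangian z.x z.y
  le_right : ∀ x, P.lagrangian z.x z.y ≤ P.lagrangian x z.y

/-- The smoothed gap `G_{βx, βy}(z, w)`, namely the supremum over `(x', y')` of
`L(x, y') - L(x', y) - βx/2 ‖x' - w.x‖² - βy/2 ‖y' - w.y‖²`. -/
def gap (βx βy : ℝ) (z w : Point n m) : EReal :=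
  ⨆ (x' : Fin n → ℝ) (y' : Fin m → ℝ),
    (P.primal z.x + P.dual z.y)
      + ((P.coupling z.x y' - P.coupling x' z.y
          - βx / 2 * ∑ i, (x' i - w.x i) ^ 2 - βy / 2 * ∑ j, (y' j - w.y j) ^ 2 : ℝ) : EReal)
      - (P.primal x' + P.dual y')

/-- The weighted distance of `z` to the saddle point `w`, for the step sizes given by `s`:
`D_p(x, w) + p̲/2 ‖x - w.x‖²_{τ⁻¹p⁻¹} + p̲/2 ‖y - w.y‖²_{σ⁻¹π⁻¹}`, where
`D_p(x, w) = (1 - p̲) (L(x, w.y) - L(w.x, w.y))`.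
It is used only when `f + f₂` is finite at `x` and at `w.x`. -/
def Delta (γ s : ℝ) (z w : Point n m) : ℝ :=
  (1 - P.pmin) * (((P.primal z.x).toReal + P.coupling z.x w.y)
      - ((P.primal w.x).toReal + P.coupling w.x w.y))
    + P.pmin / 2 * ∑ i, (z.x i - w.x i) ^ 2 / (P.tau γ s i * P.p i)
    + P.pmin / 2 * ∑ j, (z.y j - w.y j) ^ 2 / (P.sigma s j * P.prob j)

end Problem

/-- State of PURE-CD: the iterate `(x, y)` and the auxiliary dual vector `y̌`. -/
structure State (n m : ℕ) where
  x : Fin n → ℝ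
  y : Fin m → ℝ
  yc : Fin m → ℝ

/-- What determines one realisation of the restarted algorithm: the coordinate `draw l k` drawn at
the `(k+1)`-st inner iteration of the `l`-th loop, the step size parameter `s l` and the threshold
`thr l` (that is `ε_l`) of the `l`-th loop. -/
structure Choices (n : ℕ) where
  draw : ℕ → ℕ → Fin n
  s : ℕ → ℝ
  thr : ℕ → ℝ

namespace Problem

variable {n m : ℕ} (P : Problem n m)

/-- `ȳ = prox_{σ, g*}(y + σ A x)`. -/
def ybar (s : ℝ) (q : State n m) (j : Fin m) : ℝ :=
  prox (P.sigma s j) (conj (P.g j)) (q.y j + P.sigma s j * P.A.mulVec q.x j)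

/-- `x̄ = prox_{τ, f}(x - τ (∇f₂(x) + Aᵀ ȳ))`. -/
def xbar (γ s : ℝ) (q : State n m) (i : Fin n) : ℝ :=
  prox (P.tau γ s i) (P.f i)
    (q.x i - P.tau γ s i * (partialDeriv P.f₂ q.x i + P.A.transpose.mulVec (P.ybar s q) i))

/-- One iteration of PURE-CD when the coordinate `i` is drawn. -/
def step (γ s : ℝ) (i : Fin n) (q : State n m) : State n m where
  x := Function.update q.x i (P.xbar γ s q i)
  y := fun j =>
    if P.A j i ≠ 0 then
      P.ybar s q j + P.sigma s j * P.theta j *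
        P.A.mulVec (Function.update q.x i (P.xbar γ s q i) - q.x) j
    else q.y j
  yc := fun j => if P.A j i ≠ 0 then P.ybar s q j else q.yc j

/-- The inner loop, started at `z`, with draws `d 0, d 1, …`. -/
def inner (γ s : ℝ) (z : Point n m) (d : ℕ → Fin n) : ℕ → State n m
  | 0 => ⟨z.x, z.y, z.y⟩
  | k + 1 => P.step γ s (d k) (inner γ s z d k)

/-- The averaged iterate `z_k^av` of the inner loop, for `k ≥ 1`. -/
def average (γ s : ℝ) (z : Point n m) (d : ℕ → Fin n) (k : ℕ) : Point n m where
  x := fun i => (∑ k' ∈ Finset.Icc 1 k, (P.inner γ s z d k').x i) / k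
  y := fun j => (∑ k' ∈ Finset.Icc 1 k, (P.inner γ s z d k').yc j) / k

/-- The self-centered smoothed gap tested after `k ≥ 1` iterations of an inner loop with step size
parameter `s`: `G_{c₁ s / k, c₂ / (k s)}(z_k^av, z_k^av)`. -/
def testGap (γ c₁ c₂ s : ℝ) (z : Point n m) (d : ℕ → Fin n) (k : ℕ) : EReal :=
  P.gap (c₁ * s / k) (c₂ / (k * s)) (P.average γ s z d k) (P.average γ s z d k)

/-- Number of iterations of an inner loop with threshold `ε`: the first `k ≥ 1` at which the tested
gap is at most `ε`. It is `0` if there is no such `k`. -/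
def loopLength (γ c₁ c₂ s ε : ℝ) (z : Point n m) (d : ℕ → Fin n) : ℕ :=
  sInf {k : ℕ | 1 ≤ k ∧ P.testGap γ c₁ c₂ s z d k ≤ (ε : EReal)}

variable (γ c₁ c₂ : ℝ) (z₀ : Point n m) (X : Choices n)

/-- The starting point `z̃_l` of the `l`-th inner loop. -/
def start : ℕ → Point n m
  | 0 => z₀
  | l + 1 =>
    let k := P.loopLength γ c₁ c₂ (X.s l) (X.thr l) (start l) (X.draw l)
    let q := P.inner γ (X.s l) (start l) (X.draw l) k
    ⟨q.x, q.y⟩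

/-- Number `k_l` of iterations of the `l`-th inner loop, `0` if it does not terminate. -/
def len (l : ℕ) : ℕ :=
  P.loopLength γ c₁ c₂ (X.s l) (X.thr l) (P.start γ c₁ c₂ z₀ X l) (X.draw l)

/-- The tested smoothed gap after `k` iterations of the `l`-th inner loop. -/
def gapAt (l k : ℕ) : EReal :=
  P.testGap γ c₁ c₂ (X.s l) (P.start γ c₁ c₂ z₀ X l) (X.draw l) k

/-- The `l`-th inner loop is reached: all the previous ones terminate. -/
def Reached (l : ℕ) : Prop := ∀ l' < l, 1 ≤ P.len γ c₁ c₂ z₀ X l'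

/-- The algorithm performs the `k`-th iteration (`k ≥ 1`) of the `l`-th inner loop. -/
def Performed (l k : ℕ) : Prop :=
  P.Reached γ c₁ c₂ z₀ X l ∧ 1 ≤ k ∧
    ∀ k', 1 ≤ k' → k' < k → (X.thr l : EReal) < P.gapAt γ c₁ c₂ z₀ X l k'

/-- At some moment of the run, the smoothed gap is at most `η` and at most `N` inner iterations have
been performed in total. -/
def GapWithin (η N : ℝ) : Prop :=
  ∃ l k : ℕ, P.Performed γ c₁ c₂ z₀ X l k ∧ P.gapAt γ c₁ c₂ z₀ X l k ≤ (η : EReal) ∧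
    ((∑ l' ∈ Finset.range l, P.len γ c₁ c₂ z₀ X l' + k : ℕ) : ℝ) ≤ N

/-- `X` is a random run of the restarted PURE-CD with adaptive step sizes. `𝓖 l` is the information
available when the `l`-th inner loop starts. The step size parameter may be chosen in any way that
depends on the past only and changes every step size by a factor at most `r`. The threshold
`ε_{l+1}` lies between `δ` times the last tested gap and `δ ε_l`. -/
structure IsRun (s₀ ε₀ δ r : ℝ) {Ω : Type*} [MeasurableSpace Ω] (μ : Measure Ω)
    (𝓖 : Filtration ℕ ‹MeasurableSpace Ω›) (X : Ω → Choices n) : Prop where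
  draw_past : ∀ l k, Measurable[𝓖 (l + 1)] fun ω => (X ω).draw l k
  draw_law : ∀ l k i, μ {ω | (X ω).draw l k = i} = ENNReal.ofReal (P.p i)
  draw_iid : ∀ l, iIndepFun (fun k ω => (X ω).draw l k) μ
  draw_fresh : ∀ l,
    Indep (MeasurableSpace.comap (fun ω => (X ω).draw l) MeasurableSpace.pi) (𝓖 l) μ
  s_past : ∀ l, Measurable[𝓖 l] fun ω => (X ω).s l
  thr_past : ∀ l, Measurable[𝓖 l] fun ω => (X ω).thr l
  s_zero : ∀ ω, (X ω).s 0 = s₀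
  thr_zero : ∀ ω, (X ω).thr 0 = ε₀
  s_next : ∀ᵐ ω ∂μ, ∀ l, P.Reached γ c₁ c₂ z₀ (X ω) (l + 1) →
    0 < (X ω).s (l + 1) ∧
    (∀ i, r⁻¹ ≤ P.tau γ ((X ω).s (l + 1)) i / P.tau γ ((X ω).s l) i ∧
      P.tau γ ((X ω).s (l + 1)) i / P.tau γ ((X ω).s l) i ≤ r) ∧
    (∀ j, r⁻¹ ≤ P.sigma ((X ω).s (l + 1)) j / P.sigma ((X ω).s l) j ∧
      P.sigma ((X ω).s (l + 1)) j / P.sigma ((X ω).s l) j ≤ r)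
  thr_next : ∀ᵐ ω ∂μ, ∀ l, P.Reached γ c₁ c₂ z₀ (X ω) (l + 1) →
    (δ : EReal) * P.gapAt γ c₁ c₂ z₀ (X ω) l (P.len γ c₁ c₂ z₀ (X ω) l)
        ≤ ((X ω).thr (l + 1) : EReal) ∧
      (X ω).thr (l + 1) ≤ δ * (X ω).thr l

/-- `f(x̃_l) + f₂(x̃_l)` and `∑_j (π_j⁻¹ - 1) g_j*(ỹ_l^j)` are almost surely bounded by `M` in
absolute value, uniformly in `l`. -/
def IsBoundedRun (M : ℝ) {Ω : Type*} [MeasurableSpace Ω] (μ : Measure Ω)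
    (X : Ω → Choices n) : Prop :=
  ∀ᵐ ω ∂μ, ∀ l, P.Reached γ c₁ c₂ z₀ (X ω) l →
    (((-M : ℝ) : EReal) ≤ P.primal (P.start γ c₁ c₂ z₀ (X ω) l).x ∧
      P.primal (P.start γ c₁ c₂ z₀ (X ω) l).x ≤ (M : EReal)) ∧
    (((-M : ℝ) : EReal) ≤ ∑ j, (((P.prob j)⁻¹ - 1 : ℝ) : EReal) *
        conj (P.g j) ((P.start γ c₁ c₂ z₀ (X ω) l).y j) ∧
      ∑ j, (((P.prob j)⁻¹ - 1 : ℝ) : EReal) *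
        conj (P.g j) ((P.start γ c₁ c₂ z₀ (X ω) l).y j) ≤ (M : EReal))

/-- Every run of the algorithm with the given parameters that satisfies the boundedness assumption
with the constant `M` has the property `E` with probability at least `1 - ρ`. -/
def WithProb (s₀ ε₀ δ r M ρ : ℝ) (E : Choices n → Prop) : Prop :=
  ∀ (Ω : Type u) [MeasurableSpace Ω] (μ : Measure Ω) [IsProbabilityMeasure μ]
    (𝓖 : Filtration ℕ ‹MeasurableSpace Ω›) (X : Ω → Choices n),
    P.IsRun γ c₁ c₂ z₀ s₀ ε₀ δ r μ 𝓖 X → P.IsBoundedRun γ c₁ c₂ z₀ M μ X →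
    ENNReal.ofReal (1 - ρ) ≤ μ {ω | E (X ω)}

end Problem

/-- The bound on the number of inner iterations, with `Δ₀ = Δ_0(z_0)`. -/
def iterBound (C₃ C₅ Δ₀ ε₀ δ r ρ : ℝ) (L : ℕ) : ℝ :=
  L * C₃ / (ρ * ε₀) * (((δ⁻¹) ^ L - 1) / (δ⁻¹ - 1))
    + L * C₅ * Δ₀ / (ρ * ε₀) * (((r ^ 2 / δ) ^ L - 1) / (r ^ 2 / δ - 1)) + L

end PureCD

end

/-!
# Restarted PURE-CD with random number of inner iterations

*One inner loop.* The optimality conditions of the two proximal steps, the descent inequality for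
`f₂` and the choice of `τ` and `σ` give an inequality for one iteration (`one_step`): the Lagrangian
gap at an arbitrary comparison point `(x', y')`, plus a dissipation term, is at most the expected
decrease of a Lyapunov function centered at the saddle point `(x*, y*)`, plus terms that are linear in
`x' - x*` and `y' - y*`. At the saddle point it says that the weighted distance `Delta` decreases in
the mean and that the dissipation is summable (`sum_p_Delta_step`). Since the comparison point enters
linearly, the inequalities can be added along a trajectory for a comparison point that depends on the
whole trajectory, as the supremum in the smoothed gap requires. The quadratic smoothing terms absorb
the linear ones, so the gap at the average is bounded by squares of sums of slopes (`testGap_le`).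
A sum of slopes is an increment of the trajectory plus a martingale, so its second moment is
controlled by orthogonality and by the summable dissipation, with a bound that does not grow with the
number of iterations. Hence `k` times the expected tested gap after `k` iterations is bounded by
`B + C (1 + s + 1 / s) Δ`, with `Δ` the weighted distance at the beginning of the loop, and Markov's
inequality yields `exists_tail_bound`. The values of `g*` at the start of the loop, bounded by
assumption, enter because the auxiliary dual iterate keeps its initial coordinates until they are
refreshed.

All expectations within a loop are finite iterated averages over the drawn coordinates (`pathExp`), so
that no integrability or measurability is involved; `IsDrawLaw.lintegral_eq` identifies them with
integrals.

*The outer loop.* The weighted distance does not increase in the mean up to a stopping time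
(`sum_pathExp_stopped_le`), and a change of the step sizes increases it at most by the factor `r`. So
its mean at the start of loop `l`, on the event that this loop is reached, is at most `r ^ l Δ₀`
(`lintegral_Delta_start_le`), while `1 + s + 1 / s` also grows at most by the factor `r` per loop;
this is where `r ^ (2 l)` comes from. The fresh draws of a loop are independent of its past and can be
integrated out. This needs measurability of the iterates and of the tested gaps, which follows from
the continuity of the proximal operators and from the lower semicontinuity of the smoothed gap.
A union bound, in which the loop `l` receives a share `q l` of the probability of failure, gives
`le_measure_of_forall_gapAt_le`.

*Counting.* Outside the exceptional events, every loop whose threshold exceeds the target stops within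
its allotted number of iterations, and the first loop with a smaller threshold reaches the target. The
thresholds decrease at least geometrically, so the allotted numbers, read backwards from that loop,
are dominated by geometric sums (`withProb_gapWithin`). Equal shares `q l` give the first two bounds
and the third follows from the first by enlarging constants; geometrically decreasing shares remove
the logarithmic factor in the complexity.
-/

noncomputable section

namespace PureCD

/-! ### Convex functions of one variable and their proximal operators -/

namespace IsClosedConvex

variable {φ : ℝ → EReal}

lemma coe_toReal (h : IsClosedConvex φ) {u : ℝ} (hu : φ u ≠ ⊤) :
    ((φ u).toReal : EReal) = φ u :=
  EReal.coe_toReal hu (h.ne_bot u)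

lemma toReal_convex (h : IsClosedConvex φ) {u v a b : ℝ} (hu : φ u ≠ ⊤) (hv : φ v ≠ ⊤)
    (ha : 0 ≤ a) (hb : 0 ≤ b) (hab : a + b = 1) :
    φ (a * u + b * v) ≠ ⊤ ∧
      (φ (a * u + b * v)).toReal ≤ a * (φ u).toReal + b * (φ v).toReal := by
  have key := h.convex u v a b ha hb hab
  rw [← h.coe_toReal hu, ← h.coe_toReal hv] at key
  norm_cast at key
  have hne : φ (a * u + b * v) ≠ ⊤ := fun htop => by
    rw [htop] at key
    exact absurd key (not_le.2 (EReal.coe_lt_top _))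
  refine ⟨hne, ?_⟩
  rw [← h.coe_toReal hne] at key
  exact_mod_cast key

/-- A closed convex function decreases at most linearly at infinity. -/
lemma exists_linear_minorant (h : IsClosedConvex φ) :
    ∃ u₀ F c : ℝ, φ u₀ = (F : EReal) ∧ 0 ≤ c ∧
      ∀ w, ((F - (1 + |w - u₀|) * c : ℝ) : EReal) ≤ φ w := by
  obtain ⟨u₀, hu₀⟩ := h.proper
  obtain ⟨a, -, hmin⟩ := (h.lsc.lowerSemicontinuousOn (Set.Icc (u₀ - 1) (u₀ + 1))).exists_isMinOn
    ⟨u₀, by constructor <;> linarith⟩ isCompact_Icc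
  have hmin' : ∀ w, |w - u₀| ≤ 1 → φ a ≤ φ w := fun w hw => by
    have := abs_le.1 hw
    exact hmin ⟨by linarith, by linarith⟩
  have ha₀ : φ a ≤ φ u₀ := hmin' u₀ (by simp)
  have ha : φ a ≠ ⊤ := ne_top_of_le_ne_top hu₀ ha₀
  have hc : (φ a).toReal ≤ (φ u₀).toReal :=
    EReal.toReal_le_toReal ha₀ (h.ne_bot _) hu₀
  refine ⟨u₀, (φ u₀).toReal, (φ u₀).toReal - (φ a).toReal, (h.coe_toReal hu₀).symm,
    by linarith, fun w => ?_⟩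
  by_cases hw : φ w = ⊤
  · rw [hw]; exact le_top
  rw [← h.coe_toReal hw]
  norm_cast
  rcases le_total |w - u₀| 1 with hd | hd
  · have h1 := EReal.toReal_le_toReal (hmin' w hd) (h.ne_bot _) hw
    nlinarith [abs_nonneg (w - u₀)]
  · have hpos : 0 < |w - u₀| := by linarith
    have hinv : |w - u₀|⁻¹ ≤ 1 := inv_le_one_of_one_le₀ hd
    -- the point of the segment `[u₀, w]` at distance one from `u₀`
    obtain ⟨hp, hle⟩ := h.toReal_convex (a := 1 - |w - u₀|⁻¹) (b := |w - u₀|⁻¹) hu₀ hw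
      (by linarith) (by positivity) (by ring)
    have h1 := EReal.toReal_le_toReal (hmin' ((1 - |w - u₀|⁻¹) * u₀ + |w - u₀|⁻¹ * w) (by
      have : (1 - |w - u₀|⁻¹) * u₀ + |w - u₀|⁻¹ * w - u₀ = |w - u₀|⁻¹ * (w - u₀) := by ring
      rw [this, abs_mul, abs_inv, abs_abs, inv_mul_cancel₀ hpos.ne'])) (h.ne_bot _) hp
    have h2 := mul_le_mul_of_nonneg_left (h1.trans hle) hpos.le
    have h3 : |w - u₀| * ((1 - |w - u₀|⁻¹) * (φ u₀).toReal + |w - u₀|⁻¹ * (φ w).toReal)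
        = (|w - u₀| - 1) * (φ u₀).toReal + (φ w).toReal := by
      field_simp
    rw [h3] at h2
    nlinarith

lemma exists_prox (h : IsClosedConvex φ) {t : ℝ} (ht : 0 < t) (v : ℝ) :
    ∃ u, ∀ w : ℝ, φ u + (((u - v) ^ 2 / (2 * t) : ℝ) : EReal)
      ≤ φ w + (((w - v) ^ 2 / (2 * t) : ℝ) : EReal) := by
  obtain ⟨u₀, F, c, hF, hc, hlin⟩ := h.exists_linear_minorant
  set R : ℝ := 1 + 2 * |u₀ - v| + 4 * t * c with hR
  have hlsc : LowerSemicontinuous fun w : ℝ => φ w + (((w - v) ^ 2 / (2 * t) : ℝ) : EReal) := by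
    refine h.lsc.add' (Continuous.lowerSemicontinuous
      (continuous_coe_real_ereal.comp (by fun_prop))) fun x => ?_
    exact EReal.continuousAt_add (Or.inr (EReal.coe_ne_bot _)) (Or.inr (EReal.coe_ne_top _))
  have hR0 : 0 ≤ R := by positivity
  obtain ⟨a, -, hmin⟩ := (hlsc.lowerSemicontinuousOn
    (Set.Icc (u₀ - R) (u₀ + R))).exists_isMinOn ⟨u₀, by constructor <;> linarith⟩ isCompact_Icc
  refine ⟨a, fun w => ?_⟩
  rcases le_or_gt |w - u₀| R with hw | hw
  · have := abs_le.1 hw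
    exact hmin ⟨by linarith, by linarith⟩
  · refine (show _ ≤ φ u₀ + _ from hmin ⟨by linarith, by linarith⟩).trans ?_
    refine le_trans ?_ (add_le_add_left (hlin w) _)
    rw [hF]
    norm_cast
    have hsq : (u₀ - v) ^ 2 + 2 * t * ((1 + |w - u₀|) * c) ≤ (w - v) ^ 2 := by
      have e : (w - v) ^ 2 = |w - u₀| ^ 2 + 2 * ((w - u₀) * (u₀ - v)) + (u₀ - v) ^ 2 := by
        rw [sq_abs]; ring
      have hab : -(|w - u₀| * |u₀ - v|) ≤ (w - u₀) * (u₀ - v) := by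
        rw [← abs_mul]; exact neg_abs_le _
      have h1 : 1 ≤ |w - u₀| := by
        have : 0 ≤ 2 * |u₀ - v| + 4 * t * c := by positivity
        linarith
      have htc : 0 ≤ t * c := by positivity
      have h2 : |w - u₀| * R ≤ |w - u₀| * |w - u₀| :=
        mul_le_mul_of_nonneg_left hw.le (abs_nonneg _)
      rw [hR] at h2
      nlinarith [mul_nonneg htc (sub_nonneg.2 h1), abs_nonneg (u₀ - v)]
    have h2t : 0 < 2 * t := by positivity
    have : (u₀ - v) ^ 2 / (2 * t) + (1 + |w - u₀|) * c ≤ (w - v) ^ 2 / (2 * t) := by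
      rw [le_div_iff₀ h2t, add_mul, div_mul_cancel₀ _ h2t.ne']
      linarith
    linarith

lemma prox_ne_top (h : IsClosedConvex φ) {t : ℝ} (ht : 0 < t) (v : ℝ) :
    φ (prox t φ v) ≠ ⊤ := by
  have hp := Classical.epsilon_spec (h.exists_prox ht v)
  obtain ⟨u₀, hu₀⟩ := h.proper
  intro htop
  have := hp u₀
  rw [prox] at htop
  rw [htop, EReal.top_add_coe, ← h.coe_toReal hu₀, ← EReal.coe_add] at this
  exact absurd this (not_le.2 (EReal.coe_lt_top _))

/-- The optimality condition `(v - u) / t ∈ ∂φ(u)` for `u = prox_{tφ}(v)`. -/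
lemma prox_le (h : IsClosedConvex φ) {t : ℝ} (ht : 0 < t) (v : ℝ) {w : ℝ} (hw : φ w ≠ ⊤) :
    (φ (prox t φ v)).toReal + (v - prox t φ v) * (w - prox t φ v) / t ≤ (φ w).toReal := by
  have hu := h.prox_ne_top ht v
  have hp : ∀ w : ℝ, φ (prox t φ v) + (((prox t φ v - v) ^ 2 / (2 * t) : ℝ) : EReal)
      ≤ φ w + (((w - v) ^ 2 / (2 * t) : ℝ) : EReal) :=
    Classical.epsilon_spec (h.exists_prox ht v)
  generalize prox t φ v = u at hu hp ⊢
  have key : ∀ l : ℝ, 0 < l → l ≤ 1 →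
      (φ u).toReal + (v - u) * (w - u) / t ≤ (φ w).toReal + l * ((w - u) ^ 2 / (2 * t)) := by
    intro l hl hl1
    obtain ⟨hne, hle⟩ := h.toReal_convex (a := 1 - l) (b := l) hu hw (by linarith) hl.le (by ring)
    have h1 := hp ((1 - l) * u + l * w)
    rw [← h.coe_toReal hu, ← h.coe_toReal hne] at h1
    norm_cast at h1
    have h2 : ((1 - l) * u + l * w - v) ^ 2 / (2 * t) = (u - v) ^ 2 / (2 * t)
        - l * ((v - u) * (w - u) / t) + l * (l * ((w - u) ^ 2 / (2 * t))) := by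
      field_simp; ring
    rw [h2] at h1
    have : l * ((φ u).toReal + (v - u) * (w - u) / t)
        ≤ l * ((φ w).toReal + l * ((w - u) ^ 2 / (2 * t))) := by linarith
    exact le_of_mul_le_mul_left this hl
  have hq : 0 ≤ (w - u) ^ 2 / (2 * t) := by positivity
  refine le_of_forall_pos_le_add fun ε hε => ?_
  have hl : 0 < min 1 (ε / ((w - u) ^ 2 / (2 * t) + 1)) := by positivity
  refine (key _ hl (min_le_left _ _)).trans ?_
  have : min 1 (ε / ((w - u) ^ 2 / (2 * t) + 1)) * ((w - u) ^ 2 / (2 * t)) ≤ ε := by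
    refine (mul_le_mul_of_nonneg_right (min_le_right _ _) hq).trans ?_
    rw [div_mul_eq_mul_div, div_le_iff₀ (by positivity)]
    nlinarith
  linarith

/-- The three-point inequality for the proximal operator. -/
lemma prox_three_point (h : IsClosedConvex φ) {t : ℝ} (ht : 0 < t) (a b : ℝ) {w : ℝ}
    (hw : φ w ≠ ⊤) :
    (φ (prox t φ (a - t * b))).toReal - (φ w).toReal ≤ -b * (prox t φ (a - t * b) - w)
      + ((a - w) ^ 2 - (prox t φ (a - t * b) - w) ^ 2 - (prox t φ (a - t * b) - a) ^ 2)
        / (2 * t) := by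
  have := h.prox_le ht (a - t * b) hw
  generalize prox t φ (a - t * b) = u at *
  have e : (a - t * b - u) * (w - u) / t = (a - u) * (w - u) / t - b * (w - u) := by
    field_simp; ring
  have e2 : ((a - w) ^ 2 - (u - w) ^ 2 - (u - a) ^ 2) / (2 * t) = - ((a - u) * (w - u) / t) := by
    field_simp; ring
  rw [e] at this
  rw [e2]
  linarith

lemma abs_prox_sub_prox_le (h : IsClosedConvex φ) {t t' : ℝ} (ht : 0 < t) (ht' : 0 < t')
    (v v' : ℝ) : |prox t φ v - prox t' φ v'|
      ≤ |v - v'| + |1 - t / t'| * |v' - prox t' φ v'| := by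
  have h1 := h.prox_le ht v (h.prox_ne_top ht' v')
  have h2 := h.prox_le ht' v' (h.prox_ne_top ht v)
  generalize prox t φ v = u at *
  generalize prox t' φ v' = u' at *
  have h3 : (v - u) * (u' - u) / t + (v' - u') * (u - u') / t' ≤ 0 := by linarith
  have h4 : (u - u') ^ 2 ≤ (u - u') * (v - v' + (1 - t / t') * (v' - u')) := by
    have h5 := mul_nonpos_of_nonneg_of_nonpos ht.le h3
    have e : t * ((v - u) * (u' - u) / t + (v' - u') * (u - u') / t')
        = (u - u') ^ 2 - (u - u') * (v - v' + (1 - t / t') * (v' - u')) := by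
      field_simp; ring
    linarith
  have h5 : |u - u'| * |u - u'| ≤ |u - u'| * |v - v' + (1 - t / t') * (v' - u')| := by
    rw [← abs_mul, ← abs_mul, ← sq, abs_of_nonneg (sq_nonneg _)]
    exact h4.trans (le_abs_self _)
  have h6 : |u - u'| ≤ |v - v' + (1 - t / t') * (v' - u')| := by
    rcases (abs_nonneg (u - u')).eq_or_lt with h0 | h0
    · rw [← h0]; exact abs_nonneg _
    · exact le_of_mul_le_mul_left h5 h0
  exact h6.trans ((abs_add_le _ _).trans (by rw [abs_mul]))

lemma continuousOn_prox (h : IsClosedConvex φ) :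
    ContinuousOn (fun q : ℝ × ℝ => prox q.1 φ q.2) {q | 0 < q.1} := by
  rintro ⟨t', v'⟩ ht'
  have ht' : 0 < t' := ht'
  rw [ContinuousWithinAt, tendsto_iff_dist_tendsto_zero]
  have hlim : Filter.Tendsto (fun q : ℝ × ℝ => |q.2 - v'| + |1 - q.1 / t'| * |v' - prox t' φ v'|)
      (nhdsWithin (t', v') {q | 0 < q.1}) (nhds 0) := by
    have : Continuous fun q : ℝ × ℝ => |q.2 - v'| + |1 - q.1 / t'| * |v' - prox t' φ v'| := by
      fun_prop
    have := (this.tendsto (t', v')).mono_left (nhdsWithin_le_nhds (s := {q : ℝ × ℝ | 0 < q.1}))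
    simpa [ht'.ne'] using this
  refine squeeze_zero' (Filter.Eventually.of_forall fun _ => dist_nonneg) ?_ hlim
  filter_upwards [self_mem_nhdsWithin] with q hq
  rw [Real.dist_eq]
  exact h.abs_prox_sub_prox_le hq ht' _ _

lemma measurable_prox (h : IsClosedConvex φ) {Ω : Type*} {mΩ : MeasurableSpace Ω} {t v : Ω → ℝ}
    (ht : Measurable t) (hv : Measurable v) (hpos : ∀ ω, 0 < t ω) :
    Measurable fun ω => prox (t ω) φ (v ω) := by
  have h0 : MeasurableSet {q : ℝ × ℝ | 0 < q.1} := measurableSet_lt measurable_const measurable_fst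
  have h1 : Measurable ({q : ℝ × ℝ | 0 < q.1}.piecewise (fun q => prox q.1 φ q.2) fun _ => 0) :=
    h.continuousOn_prox.measurable_piecewise continuousOn_const h0
  have h2 := h1.comp (ht.prodMk hv)
  convert h2 using 1
  funext ω
  simp [Set.piecewise, hpos ω]

end IsClosedConvex

lemma conj_ge (φ : ℝ → EReal) (u v : ℝ) : ((u * v : ℝ) : EReal) - φ u ≤ conj φ v :=
  le_iSup (fun u : ℝ => ((u * v : ℝ) : EReal) - φ u) u

lemma conj_ne_bot {φ : ℝ → EReal} (h : IsClosedConvex φ) (v : ℝ) : conj φ v ≠ ⊥ := by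
  obtain ⟨u, hu⟩ := h.proper
  have := conj_ge φ u v
  rw [← h.coe_toReal hu, ← EReal.coe_sub] at this
  exact ne_bot_of_le_ne_bot (EReal.coe_ne_bot _) this

lemma lowerSemicontinuous_conj {φ : ℝ → EReal} (h : IsClosedConvex φ) :
    LowerSemicontinuous (conj φ) := by
  refine lowerSemicontinuous_iSup fun u => ?_
  by_cases hu : φ u = ⊤
  · simp only [hu, EReal.sub_top]
    exact lowerSemicontinuous_const
  · rw [← h.coe_toReal hu]
    simp only [← EReal.coe_sub]
    exact Continuous.lowerSemicontinuous (continuous_coe_real_ereal.comp (by fun_prop))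

lemma isClosedConvex_conj {φ : ℝ → EReal} (h : IsClosedConvex φ) (hp : ∃ v, conj φ v ≠ ⊤) :
    IsClosedConvex (conj φ) where
  ne_bot := conj_ne_bot h
  proper := hp
  lsc := lowerSemicontinuous_conj h
  convex := by
    intro u v a b ha hb hab
    by_cases hu : conj φ u = ⊤
    · rcases ha.eq_or_lt with rfl | ha'
      · obtain rfl : b = 1 := by linarith
        simp
      · rw [hu, EReal.coe_mul_top_of_pos ha', EReal.top_add_of_ne_bot]
        · exact le_top
        · rcases hb.eq_or_lt with rfl | hb'
          · simp
          · by_cases hv : conj φ v = ⊤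
            · rw [hv, EReal.coe_mul_top_of_pos hb']; simp
            · rw [← EReal.coe_toReal hv (conj_ne_bot h v)]
              exact EReal.coe_ne_bot _
    by_cases hv : conj φ v = ⊤
    · rcases hb.eq_or_lt with rfl | hb'
      · obtain rfl : a = 1 := by linarith
        simp
      · rw [hv, EReal.coe_mul_top_of_pos hb', EReal.add_top_of_ne_bot]
        · exact le_top
        · rw [← EReal.coe_toReal hu (conj_ne_bot h u)]
          exact EReal.coe_ne_bot _
    refine iSup_le fun w => ?_
    by_cases hw : φ w = ⊤
    · simp [hw]
    have h1 := conj_ge φ w u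
    have h2 := conj_ge φ w v
    rw [← EReal.coe_toReal hu (conj_ne_bot h u), ← h.coe_toReal hw] at h1
    rw [← EReal.coe_toReal hv (conj_ne_bot h v), ← h.coe_toReal hw] at h2
    rw [← EReal.coe_toReal hu (conj_ne_bot h u), ← EReal.coe_toReal hv (conj_ne_bot h v),
      ← h.coe_toReal hw]
    norm_cast at h1 h2 ⊢
    have := mul_le_mul_of_nonneg_left h1 ha
    have := mul_le_mul_of_nonneg_left h2 hb
    obtain rfl : b = 1 - a := by linarith
    nlinarith

end PureCD

namespace PureCD

lemma coe_sum {ι : Type*} (s : Finset ι) (f : ι → ℝ) :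
    ((∑ i ∈ s, f i : ℝ) : EReal) = ∑ i ∈ s, (f i : EReal) :=
  map_sum (⟨⟨Real.toEReal, EReal.coe_zero⟩, EReal.coe_add⟩ : ℝ →+ EReal) f s

namespace Problem

variable {n m : ℕ} (P : Problem n m)

/-! ### Sampling probabilities and step sizes -/

lemma nonempty_index {n m : ℕ} (P : Problem n m) : Nonempty (Fin n) := by
  by_contra h
  have := P.p_sum
  rw [not_nonempty_iff] at h
  simp at this

lemma pmin_le (i : Fin n) : P.pmin ≤ P.p i :=
  ciInf_le (Set.finite_range P.p).bddBelow i

lemma pmin_pos : 0 < P.pmin := by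
  have := P.nonempty_index
  obtain ⟨i, hi⟩ := exists_eq_ciInf_of_finite (f := P.p)
  rw [pmin, ← hi]
  exact P.p_pos i

lemma p_le_one (i : Fin n) : P.p i ≤ 1 := by
  rw [← P.p_sum]
  exact Finset.single_le_sum (f := P.p) (fun k _ => (P.p_pos k).le) (Finset.mem_univ i)

lemma pmin_le_one : P.pmin ≤ 1 := by
  obtain ⟨i⟩ := P.nonempty_index
  exact (P.pmin_le i).trans (P.p_le_one i)

lemma prob_pos (j : Fin m) : 0 < P.prob j := by
  obtain ⟨i, hi⟩ := P.row_ne j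
  refine Finset.sum_pos' (fun k _ => ?_) ⟨i, Finset.mem_univ i, ?_⟩
  · split_ifs
    exacts [(P.p_pos k).le, le_rfl]
  · rw [if_pos hi]; exact P.p_pos i

lemma prob_le_one (j : Fin m) : P.prob j ≤ 1 := by
  rw [← P.p_sum]
  refine Finset.sum_le_sum fun i _ => ?_
  split_ifs
  exacts [le_rfl, (P.p_pos i).le]

lemma pmin_le_prob (j : Fin m) : P.pmin ≤ P.prob j := by
  obtain ⟨i, hi⟩ := P.row_ne j
  refine (P.pmin_le i).trans ?_
  have := Finset.single_le_sum (f := fun i => if P.A j i ≠ 0 then P.p i else 0)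
    (fun k _ => by split_ifs; exacts [(P.p_pos k).le, le_rfl]) (Finset.mem_univ i)
  rw [prob]
  simpa [hi] using this

lemma theta_pos (j : Fin m) : 0 < P.theta j := div_pos (P.prob_pos j) P.pmin_pos

lemma colNorm_sq (i : Fin n) : P.colNorm i ^ 2 = ∑ j, P.A j i ^ 2 :=
  Real.sq_sqrt (Finset.sum_nonneg fun _ _ => sq_nonneg _)

lemma colNorm_pos {i : Fin n} {j : Fin m} (h : P.A j i ≠ 0) : 0 < P.colNorm i := by
  refine Real.sqrt_pos.2 (Finset.sum_pos' (fun _ _ => sq_nonneg _) ⟨j, Finset.mem_univ j, ?_⟩)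
  positivity

lemma colNorm_le (i : Fin n) : P.colNorm i ≤ P.maxCol :=
  le_ciSup (Set.finite_range P.colNorm).bddAbove i

lemma maxCol_pos : 0 < P.maxCol := by
  obtain ⟨i, hi⟩ := P.row_ne ⟨0, P.m_pos⟩
  exact (P.colNorm_pos hi).trans_le (P.colNorm_le i)

/-- The common value `s / max_i ‖A_i‖` of all products `σ^j(s) θ_j`. -/
def eta (s : ℝ) : ℝ := s / P.maxCol

lemma eta_pos {s : ℝ} (hs : 0 < s) : 0 < P.eta s := div_pos hs P.maxCol_pos

lemma sigma_mul_theta (s : ℝ) (j : Fin m) : P.sigma s j * P.theta j = P.eta s := by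
  have := P.theta_pos j
  have := P.maxCol_pos
  rw [sigma, eta]
  field_simp

lemma sigma_pos {s : ℝ} (hs : 0 < s) (j : Fin m) : 0 < P.sigma s j :=
  div_pos hs (mul_pos (P.theta_pos j) P.maxCol_pos)

lemma sigma_mul_prob (s : ℝ) (j : Fin m) : P.sigma s j * P.prob j = P.eta s * P.pmin := by
  have := P.pmin_pos
  rw [← P.sigma_mul_theta s j, theta]
  field_simp

lemma pmin_div_sigma {s : ℝ} (hs : 0 < s) (j : Fin m) :
    P.pmin / P.sigma s j = P.prob j / P.eta s := by
  have h1 := P.sigma_mul_prob s j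
  rw [div_eq_div_iff (P.sigma_pos hs j).ne' (P.eta_pos hs).ne']
  linarith

lemma one_le_two_sub (i : Fin n) : 1 ≤ 2 - P.pmin / P.p i := by
  have : P.pmin / P.p i ≤ 1 := (div_le_one (P.p_pos i)).2 (P.pmin_le i)
  linarith

lemma two_sub_le (i : Fin n) : 2 - P.pmin / P.p i ≤ 2 := by
  have := div_pos P.pmin_pos (P.p_pos i)
  linarith

lemma tau_denom_pos {s : ℝ} (hs : 0 < s) (i : Fin n) :
    0 < P.Lip i + P.eta s * P.colNorm i ^ 2 := by
  have h0 := P.eta_pos hs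
  rcases P.col_ne i with h | ⟨j, hj⟩
  · have : 0 ≤ P.eta s * P.colNorm i ^ 2 := by positivity
    linarith
  · have := P.colNorm_pos hj
    have := P.Lip_nonneg i
    positivity

lemma tau_eq (γ s : ℝ) (i : Fin n) :
    P.tau γ s i = γ * (2 - P.pmin / P.p i) / (P.Lip i + P.eta s * P.colNorm i ^ 2) := by
  rw [tau, eta, div_mul_eq_mul_div]

lemma tau_pos {γ s : ℝ} (hγ : 0 < γ) (hs : 0 < s) (i : Fin n) : 0 < P.tau γ s i := by
  rw [tau_eq]
  exact div_pos (mul_pos hγ (zero_lt_one.trans_le (P.one_le_two_sub i))) (P.tau_denom_pos hs i)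

lemma tau_mul_denom {γ s : ℝ} (hs : 0 < s) (i : Fin n) :
    P.tau γ s i * (P.Lip i + P.eta s * P.colNorm i ^ 2) = γ * (2 - P.pmin / P.p i) := by
  rw [tau_eq, div_mul_cancel₀ _ (P.tau_denom_pos hs i).ne']

lemma tau_mul_eta_mul_colNorm_sq_le {γ s : ℝ} (hγ : 0 < γ) (hγ' : γ < 1) (hs : 0 < s)
    (i : Fin n) : P.tau γ s i * (P.eta s * P.colNorm i ^ 2) ≤ 2 := by
  have h1 := P.tau_mul_denom (γ := γ) hs i
  have h2 := P.two_sub_le i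
  have h3 := P.one_le_two_sub i
  have h4 := mul_nonneg (P.tau_pos hγ hs i).le (P.Lip_nonneg i)
  nlinarith

/-! ### Finite values of the objective -/

/-- The points at which `f + f₂` is finite. -/
def DomX (x : Fin n → ℝ) : Prop := ∀ i, P.f i (x i) ≠ ⊤

/-- The points at which `g*` is finite. -/
def DomY (y : Fin m → ℝ) : Prop := ∀ j, conj (P.g j) (y j) ≠ ⊤

lemma primal_eq {x : Fin n → ℝ} (hx : P.DomX x) :
    P.primal x = ((∑ i, (P.f i (x i)).toReal + P.f₂ x : ℝ) : EReal) := by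
  rw [primal, EReal.coe_add, coe_sum]
  congr 1
  exact Finset.sum_congr rfl fun i _ => ((P.f_closed i).coe_toReal (hx i)).symm

lemma toReal_primal {x : Fin n → ℝ} (hx : P.DomX x) :
    (P.primal x).toReal = ∑ i, (P.f i (x i)).toReal + P.f₂ x := by
  rw [P.primal_eq hx, EReal.toReal_coe]

lemma coe_toReal_primal {x : Fin n → ℝ} (hx : P.DomX x) :
    ((P.primal x).toReal : EReal) = P.primal x := by
  rw [P.toReal_primal hx, P.primal_eq hx]

lemma coe_toReal_conj {j : Fin m} {v : ℝ} (hv : conj (P.g j) v ≠ ⊤) :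
    ((conj (P.g j) v).toReal : EReal) = conj (P.g j) v :=
  EReal.coe_toReal hv (conj_ne_bot (P.g_closed j) v)

lemma dual_eq {y : Fin m → ℝ} (hy : P.DomY y) :
    P.dual y = ((∑ j, (conj (P.g j) (y j)).toReal : ℝ) : EReal) := by
  rw [dual, coe_sum]
  exact Finset.sum_congr rfl fun j _ => (P.coe_toReal_conj (hy j)).symm

lemma toReal_dual {y : Fin m → ℝ} (hy : P.DomY y) :
    (P.dual y).toReal = ∑ j, (conj (P.g j) (y j)).toReal := by
  rw [P.dual_eq hy, EReal.toReal_coe]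

lemma coe_toReal_dual {y : Fin m → ℝ} (hy : P.DomY y) :
    ((P.dual y).toReal : EReal) = P.dual y := by
  rw [P.toReal_dual hy, P.dual_eq hy]

end Problem

lemma sum_ne_bot {ι : Type*} (s : Finset ι) {f : ι → EReal} (h : ∀ i ∈ s, f i ≠ ⊥) :
    ∑ i ∈ s, f i ≠ ⊥ := by
  classical
  induction s using Finset.induction_on with
  | empty => simp
  | insert a s ha ih =>
    rw [Finset.sum_insert ha, EReal.add_ne_bot_iff]
    exact ⟨h a (Finset.mem_insert_self _ _), ih fun i hi => h i (Finset.mem_insert_of_mem hi)⟩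

lemma sum_eq_top {ι : Type*} (s : Finset ι) {f : ι → EReal} (h : ∀ i ∈ s, f i ≠ ⊥)
    {i : ι} (hi : i ∈ s) (ht : f i = ⊤) : ∑ i ∈ s, f i = ⊤ := by
  classical
  rw [← Finset.add_sum_erase s f hi, ht, EReal.top_add_of_ne_bot]
  exact sum_ne_bot _ fun k hk => h k (Finset.mem_of_mem_erase hk)

namespace Problem

variable {n m : ℕ} (P : Problem n m)

lemma primal_ne_bot (x : Fin n → ℝ) : P.primal x ≠ ⊥ := by
  rw [primal, EReal.add_ne_bot_iff]
  exact ⟨sum_ne_bot _ fun i _ => (P.f_closed i).ne_bot _, EReal.coe_ne_bot _⟩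

lemma dual_ne_bot (y : Fin m → ℝ) : P.dual y ≠ ⊥ :=
  sum_ne_bot _ fun j _ => conj_ne_bot (P.g_closed j) _

lemma domX_of_primal_ne_top {x : Fin n → ℝ} (h : P.primal x ≠ ⊤) : P.DomX x := by
  intro i hi
  refine h ?_
  rw [primal, sum_eq_top _ (fun i _ => (P.f_closed i).ne_bot _) (Finset.mem_univ i) hi,
    EReal.top_add_coe]

lemma domY_of_dual_ne_top {y : Fin m → ℝ} (h : P.dual y ≠ ⊤) : P.DomY y := by
  intro j hj
  exact h (sum_eq_top _ (fun j _ => conj_ne_bot (P.g_closed j) _) (Finset.mem_univ j) hj)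

/-! ### The smooth term -/

lemma fderiv_f₂_apply (x v : Fin n → ℝ) :
    fderiv ℝ P.f₂ x v = ∑ i, v i * partialDeriv P.f₂ x i := by
  conv_lhs => rw [← Finset.univ_sum_single v, map_sum]
  refine Finset.sum_congr rfl fun i _ => ?_
  have : (Pi.single i (v i) : Fin n → ℝ) = v i • Pi.single i (1 : ℝ) := by
    rw [← Pi.single_smul, smul_eq_mul, mul_one]
  rw [this, map_smul, smul_eq_mul, partialDeriv]

lemma hasDerivAt_f₂_line (x v : Fin n → ℝ) (t : ℝ) :
    HasDerivAt (fun t : ℝ => P.f₂ (x + t • v)) (fderiv ℝ P.f₂ (x + t • v) v) t := by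
  have h1 : HasDerivAt (fun t : ℝ => x + t • v) v t := by
    simpa using ((hasDerivAt_id t).smul_const v).const_add x
  exact (P.f₂_diff (x + t • v)).hasFDerivAt.comp_hasDerivAt t h1

lemma f₂_gradient_inequality (x x' : Fin n → ℝ) :
    P.f₂ x + ∑ i, (x' i - x i) * partialDeriv P.f₂ x i ≤ P.f₂ x' := by
  have hconv : ConvexOn ℝ Set.univ fun t : ℝ => P.f₂ (x + t • (x' - x)) := by
    have := P.f₂_convex.comp_affineMap (AffineMap.lineMap x x' : ℝ →ᵃ[ℝ] (Fin n → ℝ))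
    refine this.congr fun t _ => ?_
    simp [AffineMap.lineMap_apply, add_comm]
  have h := hconv.le_slope_of_hasDerivAt (Set.mem_univ 0) (Set.mem_univ 1) one_pos
    (P.hasDerivAt_f₂_line x (x' - x) 0)
  rw [slope_def_field] at h
  simp only [zero_smul, add_zero, one_smul, add_sub_cancel, sub_zero, div_one,
    fderiv_f₂_apply, Pi.sub_apply] at h
  linarith

lemma f₂_descent (x : Fin n → ℝ) (i : Fin n) (h : ℝ) :
    P.f₂ (x + Pi.single i h) ≤ P.f₂ x + h * partialDeriv P.f₂ x i + P.Lip i / 2 * h ^ 2 := by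
  set k : ℝ → ℝ := fun t => P.f₂ x + t * (h * partialDeriv P.f₂ x i)
    + P.Lip i / 2 * h ^ 2 * t ^ 2 - P.f₂ (x + t • Pi.single i h) with hk
  have hd : ∀ t, HasDerivAt k (h * partialDeriv P.f₂ x i + P.Lip i / 2 * h ^ 2 * (2 * t)
      - h * partialDeriv P.f₂ (x + t • Pi.single i h) i) t := by
    intro t
    have h1 := P.hasDerivAt_f₂_line x (Pi.single i h) t
    rw [fderiv_f₂_apply, Finset.sum_eq_single i (fun b _ hb => by simp [Pi.single_eq_of_ne hb])
      (fun hi => absurd (Finset.mem_univ i) hi), Pi.single_eq_same] at h1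
    have h2 : HasDerivAt (fun t : ℝ => P.f₂ x + t * (h * partialDeriv P.f₂ x i)
        + P.Lip i / 2 * h ^ 2 * t ^ 2)
        (h * partialDeriv P.f₂ x i + P.Lip i / 2 * h ^ 2 * (2 * t)) t := by
      have := (((hasDerivAt_id t).mul_const (h * partialDeriv P.f₂ x i)).const_add (P.f₂ x)).add
        (((hasDerivAt_pow 2 t)).const_mul (P.Lip i / 2 * h ^ 2))
      exact this.congr_deriv (by simp)
    exact h2.sub h1
  have hmono : MonotoneOn k (Set.Ici 0) := by
    refine monotoneOn_of_deriv_nonneg (convex_Ici 0)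
      (fun t _ => (hd t).continuousAt.continuousWithinAt)
      (fun t _ => (hd t).differentiableAt.differentiableWithinAt) fun t ht => ?_
    rw [interior_Ici] at ht
    have ht : 0 < t := ht
    rw [(hd t).deriv]
    have h1 := P.f₂_lip i x (t * h)
    have h2 : (Pi.single i (t * h) : Fin n → ℝ) = t • Pi.single i h := by
      rw [← Pi.single_smul, smul_eq_mul]
    rw [h2] at h1
    set a := partialDeriv P.f₂ (x + t • Pi.single i h) i
    set b := partialDeriv P.f₂ x i
    have h3 : h * (a - b) ≤ |h| * (P.Lip i * |t * h|) :=
      (le_abs_self _).trans (by rw [abs_mul]; gcongr)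
    have h4 : |h| * (P.Lip i * |t * h|) = P.Lip i * t * h ^ 2 := by
      rw [abs_mul, abs_of_pos ht, ← sq_abs h]; ring
    nlinarith
  have := hmono (Set.mem_Ici.2 le_rfl) (Set.mem_Ici.2 zero_le_one) zero_le_one
  simp only [hk] at this
  simp at this
  linarith

/-! ### One iteration of PURE-CD -/

lemma coupling_eq (x : Fin n → ℝ) (y : Fin m → ℝ) :
    P.coupling x y = ∑ i, x i * P.A.transpose.mulVec y i := by
  simp only [coupling, Matrix.mulVec, dotProduct, Matrix.transpose_apply, Finset.sum_mul,
    Finset.mul_sum]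
  rw [Finset.sum_comm]
  exact Finset.sum_congr rfl fun i _ => Finset.sum_congr rfl fun j _ => by ring

/-- `L(x, w.y) - L(w.x, w.y)`, where the dual term cancels. -/
def excess (x : Fin n → ℝ) (w : Point n m) : ℝ :=
  ((P.primal x).toReal + P.coupling x w.y) - ((P.primal w.x).toReal + P.coupling w.x w.y)

/-- The quadratic part of the weighted distance `Delta`. -/
def quad (γ s : ℝ) (x : Fin n → ℝ) (y : Fin m → ℝ) (w : Point n m) : ℝ :=
  P.pmin / 2 * ∑ i, (x i - w.x i) ^ 2 / (P.tau γ s i * P.p i)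
    + P.pmin / 2 * ∑ j, (y j - w.y j) ^ 2 / (P.sigma s j * P.prob j)

lemma Delta_eq (γ s : ℝ) (z w : Point n m) :
    P.Delta γ s z w = (1 - P.pmin) * P.excess z.x w + P.quad γ s z.x z.y w := by
  rw [Delta, excess, quad]; ring

lemma quad_eq {γ s : ℝ} (hs : 0 < s) (x : Fin n → ℝ) (y : Fin m → ℝ) (w : Point n m) :
    P.quad γ s x y w = P.pmin / 2 * ∑ i, (x i - w.x i) ^ 2 / (P.tau γ s i * P.p i)
      + 1 / (2 * P.eta s) * ∑ j, (y j - w.y j) ^ 2 := by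
  rw [quad, Finset.mul_sum (s := Finset.univ (α := Fin m)),
    Finset.mul_sum (s := Finset.univ (α := Fin m))]
  congr 1
  refine Finset.sum_congr rfl fun j _ => ?_
  rw [P.sigma_mul_prob]
  have := P.eta_pos hs
  have := P.pmin_pos
  field_simp

/-- The increment `x̄ - x` proposed by an iteration. -/
def dx (γ s : ℝ) (q : State n m) (i : Fin n) : ℝ := P.xbar γ s q i - q.x i

/-- The increment `ȳ - y` proposed by an iteration. -/
def dy (s : ℝ) (q : State n m) (j : Fin m) : ℝ := P.ybar s q j - q.y j

lemma step_x_eq (γ s : ℝ) (i : Fin n) (q : State n m) :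
    (P.step γ s i q).x = q.x + Pi.single i (P.dx γ s q i) := by
  funext k
  by_cases h : k = i
  · subst h; simp [step, dx]
  · simp [step, Function.update_of_ne h, Pi.single_eq_of_ne h]

lemma mulVec_step_x (γ s : ℝ) (i : Fin n) (q : State n m) (j : Fin m) :
    P.A.mulVec ((P.step γ s i q).x - q.x) j = P.A j i * P.dx γ s q i := by
  rw [step_x_eq, add_sub_cancel_left]
  simp

lemma step_y_eq (γ s : ℝ) (i : Fin n) (q : State n m) (j : Fin m) :
    (P.step γ s i q).y j = if P.A j i ≠ 0 then
      P.ybar s q j + P.eta s * (P.A j i * P.dx γ s q i) else q.y j := by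
  rw [← P.mulVec_step_x, ← P.sigma_mul_theta s j]
  rfl

lemma ybar_ne_top {ys : Fin m → ℝ} (hys : P.DomY ys) {s : ℝ} (hs : 0 < s) (q : State n m)
    (j : Fin m) : conj (P.g j) (P.ybar s q j) ≠ ⊤ :=
  (isClosedConvex_conj (P.g_closed j) ⟨_, hys j⟩).prox_ne_top (P.sigma_pos hs j) _

lemma xbar_ne_top {γ s : ℝ} (hγ : 0 < γ) (hs : 0 < s) (q : State n m)
    (i : Fin n) : P.f i (P.xbar γ s q i) ≠ ⊤ :=
  (P.f_closed i).prox_ne_top (P.tau_pos hγ hs i) _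

lemma domX_step {γ s : ℝ} (hγ : 0 < γ) (hs : 0 < s) {q : State n m} (hq : P.DomX q.x)
    (i : Fin n) : P.DomX (P.step γ s i q).x := by
  intro k
  by_cases h : k = i
  · subst h; simpa [step] using P.xbar_ne_top hγ hs q k
  · simpa [step, Function.update_of_ne h] using hq k

/-- The per-coordinate form of the primal inequality: it combines the proximal inequality at the
comparison point `x'` with weight `p̲` and at the current point with weight `p_i - p̲`. -/
lemma primal_step_coord {γ s : ℝ} (hγ : 0 < γ) (hγ' : γ < 1) (hs : 0 < s)
    {q : State n m} (hq : P.DomX q.x) {x' : Fin n → ℝ} (hx' : P.DomX x') (i : Fin n) :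
    P.p i * ((P.primal (P.step γ s i q).x).toReal - (P.primal q.x).toReal)
      ≤ P.pmin * ((P.f i (x' i)).toReal - (P.f i (q.x i)).toReal)
        - P.pmin * ((q.x i - x' i) * (partialDeriv P.f₂ q.x i
            + P.A.transpose.mulVec (P.ybar s q) i))
        - P.p i * (P.A.transpose.mulVec (P.ybar s q) i * P.dx γ s q i)
        + P.pmin / 2 * (((q.x i - x' i) ^ 2 - (P.xbar γ s q i - x' i) ^ 2) / P.tau γ s i)
        - ((1 - γ) / 2 * (P.p i * P.dx γ s q i ^ 2 / P.tau γ s i)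
          + P.eta s / 2 * (P.p i * P.colNorm i ^ 2 * P.dx γ s q i ^ 2)) := by
  have hτ := P.tau_pos hγ hs i
  have hsum : ∑ k, (P.f k ((P.step γ s i q).x k)).toReal
      = ∑ k, (P.f k (q.x k)).toReal + ((P.f i (P.xbar γ s q i)).toReal
        - (P.f i (q.x i)).toReal) := by
    rw [← Finset.add_sum_erase _ _ (Finset.mem_univ i),
      ← Finset.add_sum_erase _ (fun k => (P.f k (q.x k)).toReal) (Finset.mem_univ i)]
    have : ∑ k ∈ Finset.univ.erase i, (P.f k ((P.step γ s i q).x k)).toReal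
        = ∑ k ∈ Finset.univ.erase i, (P.f k (q.x k)).toReal :=
      Finset.sum_congr rfl fun k hk => by
        simp [step, Function.update_of_ne (Finset.ne_of_mem_erase hk)]
    rw [this]
    simp [step]
    ring
  rw [P.toReal_primal (P.domX_step hγ hs hq i), P.toReal_primal hq, hsum]
  have hdesc := P.f₂_descent q.x i (P.dx γ s q i)
  rw [← P.step_x_eq] at hdesc
  have h1 := (P.f_closed i).prox_three_point hτ (q.x i) (partialDeriv P.f₂ q.x i
            + P.A.transpose.mulVec (P.ybar s q) i) (hx' i)
  have h2 := (P.f_closed i).prox_three_point hτ (q.x i) (partialDeriv P.f₂ q.x i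
            + P.A.transpose.mulVec (P.ybar s q) i) (hq i)
  change (P.f i (P.xbar γ s q i)).toReal - _ ≤ -_ * (P.xbar γ s q i - _)
    + (_ - (P.xbar γ s q i - _) ^ 2 - (P.xbar γ s q i - _) ^ 2) / _ at h1 h2
  -- the step size rule: `γ` times the proximal term pays for the curvature of `f₂` and for the dual
  -- extrapolation
  have hkey : P.p i * (P.Lip i + P.eta s * P.colNorm i ^ 2)
      = γ * (2 * P.p i - P.pmin) * (P.tau γ s i)⁻¹ := by
    have := P.tau_mul_denom (γ := γ) hs i
    have hp := P.p_pos i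
    field_simp at this ⊢
    linarith
  rw [show P.eta s / 2 * (P.p i * P.colNorm i ^ 2 * P.dx γ s q i ^ 2)
    = P.p i * (P.eta s * P.colNorm i ^ 2) * P.dx γ s q i ^ 2 / 2 by ring]
  have hx : P.xbar γ s q i = q.x i + P.dx γ s q i := by rw [dx]; ring
  rw [hx] at h1 h2 ⊢
  have hκ : 0 < (P.tau γ s i)⁻¹ := inv_pos.2 hτ
  simp only [div_eq_mul_inv, mul_inv] at h1 h2 ⊢
  have hpm := P.pmin_le i
  have hp0 := P.p_pos i
  have hm0 := P.pmin_pos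
  generalize (P.tau γ s i)⁻¹ = κ at *
  generalize P.dx γ s q i = d at *
  generalize (P.f i (q.x i + d)).toReal = fb at *
  generalize (P.f i (x' i)).toReal = f' at *
  generalize (P.f i (q.x i)).toReal = f0 at *
  generalize partialDeriv P.f₂ q.x i = D at *
  generalize P.A.transpose.mulVec (P.ybar s q) i = a at *
  generalize P.f₂ (P.step γ s i q).x = F1 at *
  generalize P.f₂ q.x = F0 at *
  generalize q.x i = x at *
  generalize x' i = w at *
  generalize P.p i = p at *
  generalize P.pmin = pm at *
  generalize P.Lip i = L at *
  generalize P.eta s * P.colNorm i ^ 2 = N at *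
  have e1 := mul_le_mul_of_nonneg_left h1 hm0.le
  have e2 := mul_le_mul_of_nonneg_left h2 (sub_nonneg.2 hpm)
  have e3 := mul_le_mul_of_nonneg_left hdesc hp0.le
  have e4 : (1 - γ) / 2 * (p * d ^ 2 * κ) ≤ (1 - γ) / 2 * ((2 * p - pm) * d ^ 2 * κ) := by
    have : 0 ≤ (1 - γ) / 2 := by linarith
    have : 0 ≤ d ^ 2 * κ := by positivity
    gcongr
    linarith
  have e5 : p * (L + N) * d ^ 2 = γ * (2 * p - pm) * κ * d ^ 2 := by rw [hkey]
  linarith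

/-- The primal inequality for the mean of one iteration, at an arbitrary comparison point `x'`. -/
lemma primal_step {γ s : ℝ} (hγ : 0 < γ) (hγ' : γ < 1) (hs : 0 < s)
    {q : State n m} (hq : P.DomX q.x) {x' : Fin n → ℝ} (hx' : P.DomX x') :
    ∑ i, P.p i * (P.primal (P.step γ s i q).x).toReal - (P.primal q.x).toReal
      ≤ P.pmin * ((P.primal x').toReal - (P.primal q.x).toReal)
        - P.pmin * (P.coupling q.x (P.ybar s q) - P.coupling x' (P.ybar s q))
        - ∑ i, P.p i * (P.A.transpose.mulVec (P.ybar s q) i * P.dx γ s q i)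
        + P.pmin / 2 * ∑ i, ((q.x i - x' i) ^ 2 - (P.xbar γ s q i - x' i) ^ 2) / P.tau γ s i
        - ((1 - γ) / 2 * ∑ i, P.p i * P.dx γ s q i ^ 2 / P.tau γ s i
          + P.eta s / 2 * ∑ i, P.p i * P.colNorm i ^ 2 * P.dx γ s q i ^ 2) := by
  have hsum := Finset.sum_le_sum fun i (_ : i ∈ Finset.univ) =>
    P.primal_step_coord hγ hγ' hs hq hx' i
  simp only [mul_sub, mul_add, Finset.sum_add_distrib, Finset.sum_sub_distrib,
    ← Finset.mul_sum, ← Finset.sum_mul, P.p_sum, one_mul] at hsum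
  have hgrad := mul_le_mul_of_nonneg_left (P.f₂_gradient_inequality q.x x') P.pmin_pos.le
  have e1 : P.coupling q.x (P.ybar s q) - P.coupling x' (P.ybar s q)
      = ∑ i, (q.x i - x' i) * P.A.transpose.mulVec (P.ybar s q) i := by
    simp only [coupling_eq, sub_mul, Finset.sum_sub_distrib]
  have e2 : ∑ i, (x' i - q.x i) * partialDeriv P.f₂ q.x i
      = - ∑ i, (q.x i - x' i) * partialDeriv P.f₂ q.x i := by
    rw [← Finset.sum_neg_distrib]
    exact Finset.sum_congr rfl fun i _ => by ring
  rw [e1, P.toReal_primal hx', P.toReal_primal hq]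
  rw [P.toReal_primal hq] at hsum
  rw [e2] at hgrad
  simp only [mul_add, mul_sub] at hgrad hsum ⊢
  linarith

/-- The dual inequality for one iteration, at an arbitrary comparison point `y'`. -/
lemma dual_step {s : ℝ} (hs : 0 < s) (q : State n m) {y' : Fin m → ℝ} (hy' : P.DomY y') :
    P.pmin * ((P.dual (P.ybar s q)).toReal - (P.dual y').toReal)
      ≤ P.pmin * (P.coupling q.x (P.ybar s q) - P.coupling q.x y')
        + 1 / (2 * P.eta s) * ∑ j, P.prob j * ((q.y j - y' j) ^ 2 - (P.ybar s q j - y' j) ^ 2)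
        - 1 / (2 * P.eta s) * ∑ j, P.prob j * P.dy s q j ^ 2 := by
  rw [P.toReal_dual fun j => P.ybar_ne_top hy' hs q j, P.toReal_dual hy']
  have hη := P.eta_pos hs
  have hsum := Finset.sum_le_sum fun j (_ : j ∈ Finset.univ) => mul_le_mul_of_nonneg_left
    ((isClosedConvex_conj (P.g_closed j) ⟨_, hy' j⟩).prox_three_point (P.sigma_pos hs j)
      (q.y j) (-P.A.mulVec q.x j) (hy' j)) P.pmin_pos.le
  have e : ∀ j, prox (P.sigma s j) (conj (P.g j)) (q.y j - P.sigma s j * -P.A.mulVec q.x j)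
      = P.ybar s q j := fun j => by rw [ybar]; congr 1; ring
  simp only [e, ← Finset.mul_sum] at hsum
  rw [← Finset.sum_sub_distrib]
  refine hsum.trans (le_of_eq ?_)
  rw [Finset.mul_sum, Finset.mul_sum, Finset.mul_sum, coupling, coupling,
    ← Finset.sum_sub_distrib, Finset.mul_sum, ← Finset.sum_add_distrib, ← Finset.sum_sub_distrib]
  refine Finset.sum_congr rfl fun j _ => ?_
  have h1 : ∀ c : ℝ, P.pmin * (c / (2 * P.sigma s j)) = 1 / (2 * P.eta s) * (P.prob j * c) := by
    intro c
    have := P.pmin_div_sigma hs j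
    have e : P.pmin * (c / (2 * P.sigma s j)) = P.pmin / P.sigma s j * c / 2 := by
      field_simp
    rw [e, this]
    field_simp
  rw [mul_add, h1, dy]
  ring

/-- Averaging a separable function of the primal iterate over the drawn coordinate. -/
lemma sum_p_step_x (γ s : ℝ) (q : State n m) (φ : Fin n → ℝ → ℝ) :
    ∑ i, P.p i * ∑ k, φ k ((P.step γ s i q).x k)
      = ∑ k, (φ k (q.x k) + P.p k * (φ k (P.xbar γ s q k) - φ k (q.x k))) := by
  have h : ∀ i, ∑ k, φ k ((P.step γ s i q).x k)
      = ∑ k, φ k (q.x k) + (φ i (P.xbar γ s q i) - φ i (q.x i)) := by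
    intro i
    rw [← Finset.add_sum_erase _ _ (Finset.mem_univ i),
      ← Finset.add_sum_erase _ (fun k => φ k (q.x k)) (Finset.mem_univ i)]
    have : ∑ k ∈ Finset.univ.erase i, φ k ((P.step γ s i q).x k)
        = ∑ k ∈ Finset.univ.erase i, φ k (q.x k) :=
      Finset.sum_congr rfl fun k hk => by
        simp [step, Function.update_of_ne (Finset.ne_of_mem_erase hk)]
    rw [this]
    simp [step]
    ring
  simp only [h, mul_add, Finset.sum_add_distrib, ← Finset.sum_mul, P.p_sum, one_mul]

lemma sum_p_step_y_sq (γ s : ℝ) (q : State n m) (j : Fin m) (c : ℝ) :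
    ∑ i, P.p i * ((P.step γ s i q).y j - c) ^ 2
      = (q.y j - c) ^ 2 - P.prob j * ((q.y j - c) ^ 2 - (P.ybar s q j - c) ^ 2)
        + 2 * P.eta s * ((P.ybar s q j - c) * ∑ i, P.p i * (P.A j i * P.dx γ s q i))
        + P.eta s ^ 2 * ∑ i, P.p i * P.A j i ^ 2 * P.dx γ s q i ^ 2 := by
  rw [prob, Finset.sum_mul, Finset.mul_sum, Finset.mul_sum, Finset.mul_sum]
  have e : ∑ i, P.p i * (q.y j - c) ^ 2 = (q.y j - c) ^ 2 := by
    rw [← Finset.sum_mul, P.p_sum, one_mul]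
  refine Eq.trans ?_ (congrArg (fun a => a - _ + _ + _) e)
  rw [← Finset.sum_sub_distrib, ← Finset.sum_add_distrib, ← Finset.sum_add_distrib]
  refine Finset.sum_congr rfl fun i _ => ?_
  rw [step_y_eq]
  by_cases h : P.A j i = 0
  · simp [h]
  · simp only [ne_eq, h, not_false_eq_true, if_true]; ring

/-- The mean of the quadratic part of the weighted distance after one iteration. -/
lemma sum_p_quad_step {γ s : ℝ} (hγ : 0 < γ) (hs : 0 < s) (q : State n m) (w : Point n m) :
    ∑ i, P.p i * P.quad γ s (P.step γ s i q).x (P.step γ s i q).y w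
      = P.quad γ s q.x q.y w
        - P.pmin / 2 * ∑ i, ((q.x i - w.x i) ^ 2 - (P.xbar γ s q i - w.x i) ^ 2) / P.tau γ s i
        - 1 / (2 * P.eta s) *
          ∑ j, P.prob j * ((q.y j - w.y j) ^ 2 - (P.ybar s q j - w.y j) ^ 2)
        + ∑ j, (P.ybar s q j - w.y j) * ∑ i, P.p i * (P.A j i * P.dx γ s q i)
        + P.eta s / 2 * ∑ i, P.p i * P.colNorm i ^ 2 * P.dx γ s q i ^ 2 := by
  have hη := P.eta_pos hs
  simp only [P.quad_eq hs, mul_add, Finset.sum_add_distrib]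
  have e1 : ∑ i, P.p i * (P.pmin / 2 *
      ∑ k, ((P.step γ s i q).x k - w.x k) ^ 2 / (P.tau γ s k * P.p k))
      = P.pmin / 2 * ∑ i, (q.x i - w.x i) ^ 2 / (P.tau γ s i * P.p i)
        - P.pmin / 2 *
          ∑ i, ((q.x i - w.x i) ^ 2 - (P.xbar γ s q i - w.x i) ^ 2) / P.tau γ s i := by
    simp only [mul_left_comm _ (P.pmin / 2)]
    rw [← Finset.mul_sum,
      P.sum_p_step_x γ s q fun k t => (t - w.x k) ^ 2 / (P.tau γ s k * P.p k), ← mul_sub,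
      ← Finset.sum_sub_distrib]
    congr 1
    refine Finset.sum_congr rfl fun i _ => ?_
    have := P.tau_pos hγ hs i
    have := P.p_pos i
    field_simp
    ring
  have e2 : ∑ i, P.p i * (1 / (2 * P.eta s) * ∑ j, ((P.step γ s i q).y j - w.y j) ^ 2)
      = 1 / (2 * P.eta s) * ∑ j, (q.y j - w.y j) ^ 2 - 1 / (2 * P.eta s) *
          ∑ j, P.prob j * ((q.y j - w.y j) ^ 2 - (P.ybar s q j - w.y j) ^ 2)
        + ∑ j, (P.ybar s q j - w.y j) * ∑ i, P.p i * (P.A j i * P.dx γ s q i)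
        + P.eta s / 2 * ∑ i, P.p i * P.colNorm i ^ 2 * P.dx γ s q i ^ 2 := by
    simp only [mul_left_comm _ (1 / (2 * P.eta s)), Finset.mul_sum (s := Finset.univ (α := Fin m))]
    rw [Finset.sum_comm]
    simp only [← Finset.mul_sum, P.sum_p_step_y_sq]
    simp only [Finset.sum_add_distrib, Finset.sum_sub_distrib, ← Finset.mul_sum]
    have e3 : ∑ j, ∑ i, P.p i * P.A j i ^ 2 * P.dx γ s q i ^ 2
        = ∑ i, P.p i * P.colNorm i ^ 2 * P.dx γ s q i ^ 2 := by
      rw [Finset.sum_comm]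
      simp only [P.colNorm_sq, Finset.mul_sum, Finset.sum_mul]
    rw [e3]
    field_simp
  rw [e1, e2]
  ring

lemma sum_p_coupling_step (γ s : ℝ) (q : State n m) (y : Fin m → ℝ) :
    ∑ i, P.p i * P.coupling (P.step γ s i q).x y
      = P.coupling q.x y + ∑ i, P.p i * (P.A.transpose.mulVec y i * P.dx γ s q i) := by
  simp only [coupling_eq]
  rw [P.sum_p_step_x γ s q fun k t => t * P.A.transpose.mulVec y k, Finset.sum_add_distrib]
  congr 1
  refine Finset.sum_congr rfl fun i _ => ?_
  rw [dx]; ring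

/-- The Lyapunov function of an iteration: the excess of the Lagrangian plus the quadratic part of the
weighted distance. Compared with `Delta`, the excess has the weight `1` instead of `1 - p̲`. -/
def lyap (γ s : ℝ) (x : Fin n → ℝ) (y : Fin m → ℝ) (w : Point n m) : ℝ :=
  P.excess x w + P.quad γ s x y w

/-- The energy dissipated by an iteration. -/
def diss (γ s : ℝ) (q : State n m) : ℝ :=
  (1 - γ) / 2 * ∑ i, P.p i * P.dx γ s q i ^ 2 / P.tau γ s i
    + 1 / (2 * P.eta s) * ∑ j, P.prob j * P.dy s q j ^ 2

lemma cross_term (γ s : ℝ) (q : State n m) (y : Fin m → ℝ) :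
    ∑ j, (P.ybar s q j - y j) * ∑ i, P.p i * (P.A j i * P.dx γ s q i)
      = ∑ i, P.p i * (P.A.transpose.mulVec (P.ybar s q) i * P.dx γ s q i)
        - ∑ i, P.p i * (P.A.transpose.mulVec y i * P.dx γ s q i) := by
  rw [← Finset.sum_sub_distrib]
  simp only [Matrix.mulVec, dotProduct, Matrix.transpose_apply, Finset.mul_sum, Finset.sum_mul,
    ← Finset.sum_sub_distrib]
  rw [Finset.sum_comm]
  exact Finset.sum_congr rfl fun i _ => Finset.sum_congr rfl fun j _ => by ring

/-- The one-iteration inequality. The comparison point `(x', y')` enters its right-hand side only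
through linear terms, so that it may depend on the whole trajectory. -/
lemma one_step {γ s : ℝ} (hγ : 0 < γ) (hγ' : γ < 1) (hs : 0 < s)
    {q : State n m} (hq : P.DomX q.x) (w : Point n m) {x' : Fin n → ℝ} {y' : Fin m → ℝ}
    (hx' : P.DomX x') (hy' : P.DomY y') :
    P.pmin * (((P.primal q.x).toReal + P.coupling q.x y' - (P.dual y').toReal)
        - ((P.primal x').toReal + P.coupling x' (P.ybar s q) - (P.dual (P.ybar s q)).toReal))
      + P.diss γ s q
      ≤ P.lyap γ s q.x q.y w
        - ∑ i, P.p i * P.lyap γ s (P.step γ s i q).x (P.step γ s i q).y w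
        + ∑ i, P.pmin / P.tau γ s i * P.dx γ s q i * (x' i - w.x i)
        + ∑ j, P.prob j / P.eta s * P.dy s q j * (y' j - w.y j) := by
  have h1 := P.primal_step hγ hγ' hs hq hx'
  have h2 := P.dual_step hs q hy'
  have h3 := P.sum_p_quad_step hγ hs q w
  rw [cross_term] at h3
  have h4 := P.sum_p_coupling_step γ s q w.y
  have h5 : ∑ i, P.p i * P.lyap γ s (P.step γ s i q).x (P.step γ s i q).y w
      = ∑ i, P.p i * (P.primal (P.step γ s i q).x).toReal
        + ∑ i, P.p i * P.coupling (P.step γ s i q).x w.y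
        - ((P.primal w.x).toReal + P.coupling w.x w.y)
        + ∑ i, P.p i * P.quad γ s (P.step γ s i q).x (P.step γ s i q).y w := by
    simp only [lyap, excess, mul_add, mul_sub, Finset.sum_add_distrib, Finset.sum_sub_distrib,
      ← Finset.sum_mul, P.p_sum, one_mul]
  have hη := P.eta_pos hs
  -- the quadratic terms depend on the comparison point affinely
  have h6 : P.pmin / 2 * ∑ i, ((q.x i - x' i) ^ 2 - (P.xbar γ s q i - x' i) ^ 2) / P.tau γ s i
      = P.pmin / 2 * ∑ i, ((q.x i - w.x i) ^ 2 - (P.xbar γ s q i - w.x i) ^ 2) / P.tau γ s i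
        + ∑ i, P.pmin / P.tau γ s i * P.dx γ s q i * (x' i - w.x i) := by
    rw [Finset.mul_sum, Finset.mul_sum, ← Finset.sum_add_distrib]
    refine Finset.sum_congr rfl fun i _ => ?_
    have := P.tau_pos hγ hs i
    rw [dx]
    field_simp
    ring
  have h7 : 1 / (2 * P.eta s) * ∑ j, P.prob j * ((q.y j - y' j) ^ 2 - (P.ybar s q j - y' j) ^ 2)
      = 1 / (2 * P.eta s) * ∑ j, P.prob j * ((q.y j - w.y j) ^ 2 - (P.ybar s q j - w.y j) ^ 2)
        + ∑ j, P.prob j / P.eta s * P.dy s q j * (y' j - w.y j) := by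
    rw [Finset.mul_sum, Finset.mul_sum, ← Finset.sum_add_distrib]
    refine Finset.sum_congr rfl fun j _ => ?_
    rw [dy]
    field_simp
    ring
  rw [h6] at h1
  rw [h7] at h2
  rw [h5, h3, h4]
  simp only [lyap, excess, diss]
  simp only [mul_add, mul_sub] at *
  linarith

/-! ### Iterated averaging over the drawn coordinates -/

/-- Averaging over the `k`-th draw: the conditional expectation given the other draws. -/
def resample (k : ℕ) : ((ℕ → Fin n) → ℝ) →ₗ[ℝ] ((ℕ → Fin n) → ℝ) where
  toFun H d := ∑ i, P.p i * H (Function.update d k i)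
  map_add' H H' := by funext d; simp [mul_add, Finset.sum_add_distrib]
  map_smul' c H := by funext d; simp [Finset.mul_sum, mul_left_comm]

/-- The expectation of a function of the first `k` draws. The other draws are frozen at an arbitrary
value, which makes this a linear form on the space of all functions of the draws. -/
def pathExp : ℕ → ((ℕ → Fin n) → ℝ) →ₗ[ℝ] ℝ
  | 0 => LinearMap.proj (fun _ => Classical.choice P.nonempty_index)
  | k + 1 => (pathExp k).comp (P.resample k)

lemma resample_apply (k : ℕ) (H : (ℕ → Fin n) → ℝ) (d : ℕ → Fin n) :
    P.resample k H d = ∑ i, P.p i * H (Function.update d k i) := rfl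

lemma pathExp_succ (k : ℕ) (H : (ℕ → Fin n) → ℝ) :
    P.pathExp (k + 1) H = P.pathExp k (P.resample k H) := rfl

lemma resample_mono (k : ℕ) {H H' : (ℕ → Fin n) → ℝ} (h : ∀ d, H d ≤ H' d) (d : ℕ → Fin n) :
    P.resample k H d ≤ P.resample k H' d := by
  simp only [resample_apply]
  exact Finset.sum_le_sum fun i _ => mul_le_mul_of_nonneg_left (h _) (P.p_pos i).le

lemma pathExp_mono (k : ℕ) {H H' : (ℕ → Fin n) → ℝ} (h : ∀ d, H d ≤ H' d) :
    P.pathExp k H ≤ P.pathExp k H' := by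
  induction k generalizing H H' with
  | zero => exact h _
  | succ k ih => exact ih (P.resample_mono k h)

lemma resample_const (k : ℕ) (c : ℝ) : P.resample k (fun _ => c) = fun _ => c := by
  funext d
  rw [resample_apply, ← Finset.sum_mul, P.p_sum, one_mul]

lemma pathExp_const (k : ℕ) (c : ℝ) : P.pathExp k (fun _ => c) = c := by
  induction k with
  | zero => rfl
  | succ k ih => rw [pathExp_succ, resample_const, ih]

lemma pathExp_nonneg (k : ℕ) {H : (ℕ → Fin n) → ℝ} (h : ∀ d, 0 ≤ H d) : 0 ≤ P.pathExp k H := by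
  have := P.pathExp_mono k h
  rwa [pathExp_const] at this

lemma pathExp_add (k : ℕ) (H H' : (ℕ → Fin n) → ℝ) :
    P.pathExp k (fun d => H d + H' d) = P.pathExp k H + P.pathExp k H' :=
  map_add (P.pathExp k) H H'

lemma pathExp_sub (k : ℕ) (H H' : (ℕ → Fin n) → ℝ) :
    P.pathExp k (fun d => H d - H' d) = P.pathExp k H - P.pathExp k H' :=
  map_sub (P.pathExp k) H H'

lemma pathExp_const_mul (k : ℕ) (c : ℝ) (H : (ℕ → Fin n) → ℝ) :
    P.pathExp k (fun d => c * H d) = c * P.pathExp k H :=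
  map_smul (P.pathExp k) c H

lemma pathExp_sum {ι : Type*} (k : ℕ) (t : Finset ι) (H : ι → (ℕ → Fin n) → ℝ) :
    P.pathExp k (fun d => ∑ a ∈ t, H a d) = ∑ a ∈ t, P.pathExp k (H a) := by
  rw [← map_sum]
  congr 1
  funext d
  rw [Finset.sum_apply]

lemma resample_sub (k : ℕ) (H H' : (ℕ → Fin n) → ℝ) (d : ℕ → Fin n) :
    P.resample k (fun d => H d - H' d) d = P.resample k H d - P.resample k H' d :=
  congrFun (map_sub (P.resample k) H H') d

lemma _root_.DependsOn.apply_update {β : Type*} {H : (ℕ → Fin n) → β} {k j : ℕ}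
    (h : DependsOn H (Set.Iio k)) (hkj : k ≤ j) (d : ℕ → Fin n) (i : Fin n) :
    H (Function.update d j i) = H d :=
  h fun t ht => Function.update_of_ne (by have : t < k := ht; omega) _ _

lemma resample_of_dependsOn {H : (ℕ → Fin n) → ℝ} {k j : ℕ} (h : DependsOn H (Set.Iio k))
    (hkj : k ≤ j) : P.resample j H = H := by
  funext d
  simp only [resample_apply, h.apply_update hkj, ← Finset.sum_mul, P.p_sum, one_mul]

lemma resample_mul {G : (ℕ → Fin n) → ℝ} {k : ℕ} (hG : DependsOn G (Set.Iio k))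
    (H : (ℕ → Fin n) → ℝ) (d : ℕ → Fin n) :
    P.resample k (fun d => G d * H d) d = G d * P.resample k H d := by
  simp only [resample_apply, hG.apply_update le_rfl, Finset.mul_sum, mul_left_comm]

lemma dependsOn_resample {H : (ℕ → Fin n) → ℝ} {k : ℕ} (h : DependsOn H (Set.Iio (k + 1))) :
    DependsOn (P.resample k H) (Set.Iio k) := by
  intro d d' hd
  simp only [resample_apply]
  refine Finset.sum_congr rfl fun i _ => congrArg _ (h fun t ht => ?_)
  have ht : t < k + 1 := ht
  rcases eq_or_ne t k with rfl | hne
  · simp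
  · rw [Function.update_of_ne hne, Function.update_of_ne hne]
    exact hd t (show t < k by omega)

lemma pathExp_of_dependsOn {H : (ℕ → Fin n) → ℝ} {k K : ℕ} (h : DependsOn H (Set.Iio k))
    (hk : k ≤ K) : P.pathExp K H = P.pathExp k H := by
  induction K, hk using Nat.le_induction with
  | base => rfl
  | succ K hK ih => rw [pathExp_succ, P.resample_of_dependsOn h hK, ih]

/-- The tower property. -/
lemma pathExp_resample {H : (ℕ → Fin n) → ℝ} {k K : ℕ} (h : DependsOn H (Set.Iio (k + 1)))
    (hk : k < K) : P.pathExp K (P.resample k H) = P.pathExp K H := by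
  rw [P.pathExp_of_dependsOn h hk, P.pathExp_of_dependsOn (P.dependsOn_resample h) hk.le,
    pathExp_succ]

lemma _root_.DependsOn.comp_left {β β' : Type*} {H : (ℕ → Fin n) → β} {t : Set ℕ}
    (h : DependsOn H t) (φ : β → β') : DependsOn (fun d => φ (H d)) t :=
  fun _ _ hd => congrArg φ (h hd)

lemma _root_.DependsOn.comp_left₂ {β β' β'' : Type*} {H : (ℕ → Fin n) → β}
    {H' : (ℕ → Fin n) → β'} {t : Set ℕ}
    (h : DependsOn H t) (h' : DependsOn H' t) (φ : β → β' → β'') :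
    DependsOn (fun d => φ (H d) (H' d)) t :=
  fun d d' hd => by simp only [h hd, h' hd]

lemma _root_.DependsOn.sum {ι : Type*} {t : Set ℕ} (a : Finset ι) {H : ι → (ℕ → Fin n) → ℝ}
    (h : ∀ i ∈ a, DependsOn (H i) t) : DependsOn (fun d => ∑ i ∈ a, H i d) t :=
  fun _ _ hd => Finset.sum_congr rfl fun i hi => h i hi hd

lemma _root_.DependsOn.mono_Iio {β : Type*} {H : (ℕ → Fin n) → β} {k k' : ℕ}
    (h : DependsOn H (Set.Iio k)) (hk : k ≤ k') : DependsOn H (Set.Iio k') :=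
  h.mono (Set.Iio_subset_Iio hk)

/-- The second moment of a sum of martingale differences `I_t - E_t I_t` is at most the sum of the
second moments of the `I_t`. -/
lemma pathExp_sq_sum_sub_resample_le {I : ℕ → (ℕ → Fin n) → ℝ}
    (hI : ∀ t, DependsOn (I t) (Set.Iio (t + 1))) (K : ℕ) :
    P.pathExp K (fun d => (∑ t ∈ Finset.range K, (I t d - P.resample t (I t) d)) ^ 2)
      ≤ ∑ t ∈ Finset.range K, P.pathExp K (fun d => I t d ^ 2) := by
  have hN : ∀ t, DependsOn (fun d => I t d - P.resample t (I t) d) (Set.Iio (t + 1)) := fun t =>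
    (hI t).comp_left₂ ((P.dependsOn_resample (hI t)).mono_Iio t.le_succ) fun a b => a - b
  have hW : ∀ k, DependsOn (fun d => ∑ t ∈ Finset.range k, (I t d - P.resample t (I t) d))
      (Set.Iio k) := fun k => DependsOn.sum _ fun t ht =>
    (hN t).mono_Iio (Finset.mem_range.1 ht)
  suffices h : ∀ k ≤ K,
      P.pathExp K (fun d => (∑ t ∈ Finset.range k, (I t d - P.resample t (I t) d)) ^ 2)
        ≤ ∑ t ∈ Finset.range k, P.pathExp K (fun d => I t d ^ 2) from h K le_rfl
  intro k
  induction k with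
  | zero => intro _; simp [pathExp_const]
  | succ k ih =>
    intro hk
    have hk' : k < K := hk
    set W : (ℕ → Fin n) → ℝ := fun d => ∑ t ∈ Finset.range k, (I t d - P.resample t (I t) d)
      with hWdef
    set N : (ℕ → Fin n) → ℝ := fun d => I k d - P.resample k (I k) d with hNdef
    have hres0 : ∀ d, P.resample k N d = 0 := fun d => by
      rw [hNdef, resample_sub, P.resample_of_dependsOn (P.dependsOn_resample (hI k)) le_rfl,
        sub_self]
    have hcross : P.pathExp K (fun d => W d * N d) = 0 := by
      rw [← P.pathExp_resample (((hW k).mono_Iio k.le_succ).comp_left₂ (hN k) fun a b => a * b) hk']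
      have : P.resample k (fun d => W d * N d) = fun _ => 0 := by
        funext d
        rw [P.resample_mul (hW k), hres0, mul_zero]
      rw [this, pathExp_const]
    have hsq : P.pathExp K (fun d => N d ^ 2) ≤ P.pathExp K (fun d => I k d ^ 2) := by
      have e : (fun d => I k d ^ 2) = fun d => N d ^ 2
          + (2 * (P.resample k (I k) d * N d) + (P.resample k (I k) d) ^ 2) := by
        funext d; simp only [hNdef]; ring
      have hc : P.pathExp K (fun d => P.resample k (I k) d * N d) = 0 := by
        rw [← P.pathExp_resample (((P.dependsOn_resample (hI k)).mono_Iio k.le_succ).comp_left₂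
          (hN k) fun a b => a * b) hk']
        have : P.resample k (fun d => P.resample k (I k) d * N d) = fun _ => 0 := by
          funext d
          rw [P.resample_mul (P.dependsOn_resample (hI k)), hres0, mul_zero]
        rw [this, pathExp_const]
      rw [e, pathExp_add, pathExp_add, pathExp_const_mul, hc]
      have := P.pathExp_nonneg K (H := fun d => (P.resample k (I k) d) ^ 2) fun d => sq_nonneg _
      linarith
    have e : (fun d => (∑ t ∈ Finset.range (k + 1), (I t d - P.resample t (I t) d)) ^ 2)
        = fun d => W d ^ 2 + (2 * (W d * N d) + N d ^ 2) := by
      funext d; rw [Finset.sum_range_succ]; simp only [hWdef, hNdef]; ring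
    rw [e, pathExp_add, pathExp_add, pathExp_const_mul, hcross, Finset.sum_range_succ]
    have := ih hk'.le
    linarith

/-! ### The trajectory as a function of the draws -/

lemma dependsOn_inner (γ s : ℝ) (z : Point n m) (k : ℕ) :
    DependsOn (fun d => P.inner γ s z d k) (Set.Iio k) := by
  induction k with
  | zero => exact fun _ _ _ => rfl
  | succ k ih =>
    intro d d' hd
    have h1 : P.inner γ s z d k = P.inner γ s z d' k :=
      ih fun t ht => hd t (lt_trans (show t < k from ht) k.lt_succ_self)
    have h2 : d k = d' k := hd k k.lt_succ_self
    simp only [inner, h1, h2]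

lemma inner_update (γ s : ℝ) (z : Point n m) (d : ℕ → Fin n) (k : ℕ) (i : Fin n) :
    P.inner γ s z (Function.update d k i) (k + 1) = P.step γ s i (P.inner γ s z d k) := by
  rw [inner, Function.update_self]
  congr 1
  exact (P.dependsOn_inner γ s z k).apply_update le_rfl d i

lemma resample_inner (γ s : ℝ) (z : Point n m) (k : ℕ) (φ : State n m → ℝ) (d : ℕ → Fin n) :
    P.resample k (fun d => φ (P.inner γ s z d (k + 1))) d
      = ∑ i, P.p i * φ (P.step γ s i (P.inner γ s z d k)) := by
  simp only [resample_apply, inner_update]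

/-- The law of total expectation for a function of two successive states. -/
lemma pathExp_inner_succ (γ s : ℝ) (z : Point n m) {k K : ℕ} (hk : k < K)
    (φ : State n m → ℝ) :
    P.pathExp K (fun d => φ (P.inner γ s z d (k + 1)))
      = P.pathExp K (fun d => ∑ i, P.p i * φ (P.step γ s i (P.inner γ s z d k))) := by
  rw [← P.pathExp_resample ((P.dependsOn_inner γ s z (k + 1)).comp_left φ) hk]
  congr 1
  funext d
  exact P.resample_inner γ s z k φ d

lemma domX_inner {γ s : ℝ} (hγ : 0 < γ) (hs : 0 < s) {z : Point n m} (hz : P.DomX z.x)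
    (d : ℕ → Fin n) (k : ℕ) : P.DomX (P.inner γ s z d k).x := by
  induction k with
  | zero => exact hz
  | succ k ih => exact P.domX_step hγ hs ih _

/-! ### Saddle points and descent of the weighted distance -/

lemma lagrangian_eq {x : Fin n → ℝ} {y : Fin m → ℝ} (hx : P.DomX x) (hy : P.DomY y) :
    P.lagrangian x y
      = (((P.primal x).toReal + P.coupling x y - (P.dual y).toReal : ℝ) : EReal) := by
  rw [lagrangian, EReal.coe_sub, EReal.coe_add, P.coe_toReal_primal hx, P.coe_toReal_dual hy]

namespace IsSaddle

variable {P} {w : Point n m}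

lemma domX (hw : P.IsSaddle w) : P.DomX w.x := P.domX_of_primal_ne_top hw.primal_ne_top

lemma domY (hw : P.IsSaddle w) : P.DomY w.y := P.domY_of_dual_ne_top hw.dual_ne_top

lemma excess_nonneg (hw : P.IsSaddle w) {x : Fin n → ℝ} (hx : P.DomX x) : 0 ≤ P.excess x w := by
  have := hw.le_right x
  rw [P.lagrangian_eq hw.domX hw.domY, P.lagrangian_eq hx hw.domY, EReal.coe_le_coe_iff] at this
  rw [excess]
  linarith

lemma dual_le (hw : P.IsSaddle w) {y : Fin m → ℝ} (hy : P.DomY y) :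
    P.coupling w.x y - (P.dual y).toReal ≤ P.coupling w.x w.y - (P.dual w.y).toReal := by
  have := hw.le_left y
  rw [P.lagrangian_eq hw.domX hw.domY, P.lagrangian_eq hw.domX hy, EReal.coe_le_coe_iff] at this
  linarith

end IsSaddle

/-- The Bregman-type function `g_j*(v) - (A x*)_j v`, minimal at a saddle point. -/
def tilt (w : Point n m) (j : Fin m) (v : ℝ) : ℝ :=
  (conj (P.g j) v).toReal - P.A.mulVec w.x j * v

lemma IsSaddle.tilt_le {P : Problem n m} {w : Point n m} (hw : P.IsSaddle w) {j : Fin m} {v : ℝ}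
    (hv : conj (P.g j) v ≠ ⊤) : P.tilt w j (w.y j) ≤ P.tilt w j v := by
  have hdom : P.DomY (Function.update w.y j v) := fun k => by
    by_cases h : k = j
    · subst h; simpa using hv
    · simpa [Function.update_of_ne h] using hw.domY k
  have h := hw.dual_le hdom
  rw [P.toReal_dual hdom, P.toReal_dual hw.domY, coupling, coupling,
    ← Finset.sum_sub_distrib, ← Finset.sum_sub_distrib,
    ← Finset.add_sum_erase _ _ (Finset.mem_univ j),
    ← Finset.add_sum_erase _ (fun k => P.A.mulVec w.x k * w.y k - (conj (P.g k) (w.y k)).toReal)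
      (Finset.mem_univ j)] at h
  have e : ∑ k ∈ Finset.univ.erase j, (P.A.mulVec w.x k * Function.update w.y j v k
      - (conj (P.g k) (Function.update w.y j v k)).toReal)
      = ∑ k ∈ Finset.univ.erase j, (P.A.mulVec w.x k * w.y k
      - (conj (P.g k) (w.y k)).toReal) :=
    Finset.sum_congr rfl fun k hk => by rw [Function.update_of_ne (Finset.ne_of_mem_erase hk)]
  rw [e, Function.update_self] at h
  rw [tilt, tilt]
  linarith

lemma diss_nonneg {γ s : ℝ} (hγ : 0 < γ) (hγ' : γ < 1) (hs : 0 < s) (q : State n m) :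
    0 ≤ P.diss γ s q := by
  have := P.eta_pos hs
  have h1 : 0 ≤ (1 - γ) / 2 := by linarith
  refine add_nonneg (mul_nonneg h1 (Finset.sum_nonneg fun i _ => ?_))
    (mul_nonneg (by positivity) (Finset.sum_nonneg fun j _ => ?_))
  · have := P.tau_pos hγ hs i
    have := P.p_pos i
    positivity
  · have := P.prob_pos j
    positivity

lemma quad_nonneg {γ s : ℝ} (hγ : 0 < γ) (hs : 0 < s) (x : Fin n → ℝ) (y : Fin m → ℝ)
    (w : Point n m) : 0 ≤ P.quad γ s x y w := by
  have := P.pmin_pos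
  refine add_nonneg (mul_nonneg (by positivity) (Finset.sum_nonneg fun i _ => ?_))
    (mul_nonneg (by positivity) (Finset.sum_nonneg fun j _ => ?_))
  · have := P.tau_pos hγ hs i
    have := P.p_pos i
    positivity
  · have := P.sigma_pos hs j
    have := P.prob_pos j
    positivity

lemma quad_le_Delta {γ s : ℝ} {z w : Point n m} (hw : P.IsSaddle w) (hz : P.DomX z.x) :
    P.quad γ s z.x z.y w ≤ P.Delta γ s z w := by
  rw [Delta_eq]
  have := mul_nonneg (sub_nonneg.2 P.pmin_le_one) (hw.excess_nonneg hz)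
  linarith

lemma Delta_nonneg {γ s : ℝ} (hγ : 0 < γ) (hs : 0 < s) {z w : Point n m} (hw : P.IsSaddle w)
    (hz : P.DomX z.x) : 0 ≤ P.Delta γ s z w :=
  (P.quad_nonneg hγ hs _ _ _).trans (P.quad_le_Delta hw hz)

/-- The weighted distance to a saddle point decreases on average. -/
lemma sum_p_Delta_step {γ s : ℝ} (hγ : 0 < γ) (hγ' : γ < 1) (hs : 0 < s)
    {q : State n m} (hq : P.DomX q.x) {w : Point n m} (hw : P.IsSaddle w) :
    ∑ i, P.p i * P.Delta γ s ⟨(P.step γ s i q).x, (P.step γ s i q).y⟩ w + P.diss γ s q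
      ≤ P.Delta γ s ⟨q.x, q.y⟩ w := by
  have h1 := P.one_step hγ hγ' hs hq w hw.domX hw.domY
  simp only [sub_self, mul_zero, Finset.sum_const_zero, add_zero] at h1
  have h2 := hw.dual_le (y := P.ybar s q) fun j => P.ybar_ne_top hw.domY hs q j
  have h3 : ∑ i, P.p i * P.Delta γ s ⟨(P.step γ s i q).x, (P.step γ s i q).y⟩ w
      ≤ ∑ i, P.p i * P.lyap γ s (P.step γ s i q).x (P.step γ s i q).y w := by
    refine Finset.sum_le_sum fun i _ => mul_le_mul_of_nonneg_left ?_ (P.p_pos i).le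
    have := mul_nonneg P.pmin_pos.le (hw.excess_nonneg (P.domX_step hγ hs hq i))
    rw [Delta_eq, lyap]
    linarith
  have h4 : P.lyap γ s q.x q.y w
      = P.Delta γ s ⟨q.x, q.y⟩ w + P.pmin * P.excess q.x w := by
    rw [Delta_eq, lyap]; ring
  have h5 : P.pmin * P.excess q.x w
      ≤ P.pmin * (((P.primal q.x).toReal + P.coupling q.x w.y - (P.dual w.y).toReal)
        - ((P.primal w.x).toReal + P.coupling w.x (P.ybar s q)
          - (P.dual (P.ybar s q)).toReal)) := by
    refine mul_le_mul_of_nonneg_left ?_ P.pmin_pos.le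
    rw [excess]
    linarith
  linarith

/-! ### Second moments along the trajectory -/

/-- The standing assumptions on an inner loop started at `z`, with step sizes given by `s`, and on
the saddle point `w` to which its iterates are compared. -/
structure Admissible (γ s : ℝ) (z w : Point n m) : Prop where
  γ_pos : 0 < γ
  γ_lt_one : γ < 1
  s_pos : 0 < s
  dom : P.DomX z.x
  saddle : P.IsSaddle w

section Moments

variable {γ s : ℝ} {z w : Point n m}

lemma pathExp_Delta_add_diss_le (H : P.Admissible γ s z w) {k K : ℕ} (hk : k ≤ K) :
    P.pathExp K (fun d => P.Delta γ s ⟨(P.inner γ s z d k).x, (P.inner γ s z d k).y⟩ w)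
      + ∑ t ∈ Finset.range k, P.pathExp K (fun d => P.diss γ s (P.inner γ s z d t))
      ≤ P.Delta γ s z w := by
  induction k with
  | zero => simp only [inner, Finset.range_zero, Finset.sum_empty, pathExp_const, add_zero]; rfl
  | succ k ih =>
    have h1 := P.pathExp_inner_succ γ s z hk fun q => P.Delta γ s ⟨q.x, q.y⟩ w
    rw [h1, Finset.sum_range_succ]
    have h2 := P.pathExp_mono K fun d =>
      P.sum_p_Delta_step H.γ_pos H.γ_lt_one H.s_pos
        (P.domX_inner H.γ_pos H.s_pos H.dom d k) H.saddle
    rw [pathExp_add] at h2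
    have h3 := ih (Nat.le_of_succ_le hk)
    linarith

lemma pathExp_quad_le (H : P.Admissible γ s z w) {k K : ℕ} (hk : k ≤ K) :
    P.pathExp K (fun d => P.quad γ s (P.inner γ s z d k).x (P.inner γ s z d k).y w)
      ≤ P.Delta γ s z w := by
  have h1 := P.pathExp_Delta_add_diss_le H hk
  have h2 := P.pathExp_mono K fun d =>
    P.quad_le_Delta (γ := γ) (s := s) (z := ⟨(P.inner γ s z d k).x, (P.inner γ s z d k).y⟩) H.saddle
      (P.domX_inner H.γ_pos H.s_pos H.dom d k)
  have h3 := Finset.sum_nonneg fun t (_ : t ∈ Finset.range k) =>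
    P.pathExp_nonneg K fun d => P.diss_nonneg H.γ_pos H.γ_lt_one H.s_pos (P.inner γ s z d t)
  exact h2.trans (by linarith)

lemma sq_sub_x_le_quad (hγ : 0 < γ) (hs : 0 < s) (x : Fin n → ℝ) (y : Fin m → ℝ)
    (w : Point n m) (i : Fin n) :
    (x i - w.x i) ^ 2 ≤ 2 / P.pmin * P.tau γ s i * P.quad γ s x y w := by
  have hτ := P.tau_pos hγ hs i
  have hp := P.p_pos i
  have hpm := P.pmin_pos
  have h1 : (x i - w.x i) ^ 2 / (P.tau γ s i * P.p i)
      ≤ ∑ k, (x k - w.x k) ^ 2 / (P.tau γ s k * P.p k) :=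
    Finset.single_le_sum (f := fun k => (x k - w.x k) ^ 2 / (P.tau γ s k * P.p k))
      (fun k _ => by have := P.tau_pos hγ hs k; have := P.p_pos k; positivity) (Finset.mem_univ i)
  have h2 : P.pmin / 2 * ((x i - w.x i) ^ 2 / (P.tau γ s i * P.p i)) ≤ P.quad γ s x y w := by
    rw [P.quad_eq hs]
    have := P.eta_pos hs
    have h3 : 0 ≤ 1 / (2 * P.eta s) * ∑ j, (y j - w.y j) ^ 2 := by positivity
    have h4 := mul_le_mul_of_nonneg_left h1 (half_pos hpm).le
    linarith
  have h5 : (x i - w.x i) ^ 2 / P.tau γ s i ≤ (x i - w.x i) ^ 2 / (P.tau γ s i * P.p i) := by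
    refine div_le_div_of_nonneg_left (sq_nonneg _) (by positivity) ?_
    nlinarith [P.p_le_one i]
  have h6 : (x i - w.x i) ^ 2
      = 2 / P.pmin * P.tau γ s i * (P.pmin / 2 * ((x i - w.x i) ^ 2 / P.tau γ s i)) := by
    field_simp
  rw [h6]
  refine mul_le_mul_of_nonneg_left (le_trans ?_ h2) (by positivity)
  gcongr

lemma sq_sub_y_le_quad (hγ : 0 < γ) (hs : 0 < s) (x : Fin n → ℝ) (y : Fin m → ℝ) (w : Point n m) :
    ∑ j, (y j - w.y j) ^ 2 ≤ 2 * P.eta s * P.quad γ s x y w := by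
  have hη := P.eta_pos hs
  have h : 1 / (2 * P.eta s) * ∑ j, (y j - w.y j) ^ 2 ≤ P.quad γ s x y w := by
    rw [P.quad_eq hs]
    have h3 : 0 ≤ ∑ i, (x i - w.x i) ^ 2 / (P.tau γ s i * P.p i) :=
      Finset.sum_nonneg fun k _ => by
        have := P.tau_pos hγ hs k; have := P.p_pos k; positivity
    have := mul_nonneg (half_pos P.pmin_pos).le h3
    linarith
  rw [div_mul_eq_mul_div, one_mul, div_le_iff₀ (by positivity)] at h
  linarith

lemma pathExp_sq_x_le (H : P.Admissible γ s z w) {k K : ℕ} (hk : k ≤ K) (i : Fin n) :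
    P.pathExp K (fun d => ((P.inner γ s z d k).x i - w.x i) ^ 2)
      ≤ 2 / P.pmin * P.tau γ s i * P.Delta γ s z w := by
  have h := P.pathExp_mono K fun d =>
    P.sq_sub_x_le_quad H.γ_pos H.s_pos (P.inner γ s z d k).x (P.inner γ s z d k).y w i
  rw [pathExp_const_mul] at h
  refine h.trans (mul_le_mul_of_nonneg_left (P.pathExp_quad_le H hk) ?_)
  have := P.tau_pos H.γ_pos H.s_pos i
  have := P.pmin_pos
  positivity

lemma pathExp_sq_y_le (H : P.Admissible γ s z w) {k K : ℕ} (hk : k ≤ K) (j : Fin m) :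
    P.pathExp K (fun d => ((P.inner γ s z d k).y j - w.y j) ^ 2)
      ≤ 2 * P.eta s * P.Delta γ s z w := by
  have h := P.pathExp_mono K fun d =>
    (Finset.single_le_sum (f := fun j => ((P.inner γ s z d k).y j - w.y j) ^ 2)
      (fun _ _ => sq_nonneg _) (Finset.mem_univ j)).trans
    (P.sq_sub_y_le_quad H.γ_pos H.s_pos (P.inner γ s z d k).x (P.inner γ s z d k).y w)
  rw [pathExp_const_mul] at h
  refine h.trans (mul_le_mul_of_nonneg_left (P.pathExp_quad_le H hk) ?_)
  have := P.eta_pos H.s_pos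
  positivity

lemma sum_pathExp_diss_le (H : P.Admissible γ s z w) (K : ℕ) :
    ∑ t ∈ Finset.range K, P.pathExp K (fun d => P.diss γ s (P.inner γ s z d t))
      ≤ P.Delta γ s z w := by
  have h1 := P.pathExp_Delta_add_diss_le H (le_refl K)
  have h2 := P.pathExp_nonneg K fun d => P.Delta_nonneg (γ := γ) (s := s)
    (z := ⟨(P.inner γ s z d K).x, (P.inner γ s z d K).y⟩) H.γ_pos H.s_pos H.saddle
    (P.domX_inner H.γ_pos H.s_pos H.dom d K)
  linarith

lemma sum_pathExp_dx_le (H : P.Admissible γ s z w) (K : ℕ) (i : Fin n) :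
    ∑ t ∈ Finset.range K, P.pathExp K (fun d => P.p i * P.dx γ s (P.inner γ s z d t) i ^ 2)
      ≤ 2 / (1 - γ) * P.tau γ s i * P.Delta γ s z w := by
  have hτ := P.tau_pos H.γ_pos H.s_pos i
  have hg : 0 < 1 - γ := by linarith [H.γ_lt_one]
  have h : ∀ q : State n m, P.p i * P.dx γ s q i ^ 2
      ≤ 2 / (1 - γ) * P.tau γ s i * P.diss γ s q := by
    intro q
    have h1 : P.p i * P.dx γ s q i ^ 2 / P.tau γ s i
        ≤ ∑ k, P.p k * P.dx γ s q k ^ 2 / P.tau γ s k :=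
      Finset.single_le_sum (f := fun k => P.p k * P.dx γ s q k ^ 2 / P.tau γ s k)
        (fun k _ => by have := P.tau_pos H.γ_pos H.s_pos k; have := P.p_pos k; positivity)
        (Finset.mem_univ i)
    have h2 : (1 - γ) / 2 * (P.p i * P.dx γ s q i ^ 2 / P.tau γ s i) ≤ P.diss γ s q := by
      have h3 : 0 ≤ 1 / (2 * P.eta s) * ∑ j, P.prob j * P.dy s q j ^ 2 := by
        have := P.eta_pos H.s_pos
        refine mul_nonneg (by positivity) (Finset.sum_nonneg fun j _ => ?_)
        have := P.prob_pos j
        positivity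
      have := mul_le_mul_of_nonneg_left h1 (half_pos hg).le
      rw [diss]
      linarith
    calc P.p i * P.dx γ s q i ^ 2
        = 2 / (1 - γ) * P.tau γ s i
          * ((1 - γ) / 2 * (P.p i * P.dx γ s q i ^ 2 / P.tau γ s i)) := by field_simp
      _ ≤ _ := mul_le_mul_of_nonneg_left h2 (by positivity)
  have h4 := Finset.sum_le_sum fun t (_ : t ∈ Finset.range K) =>
    P.pathExp_mono K fun d => h (P.inner γ s z d t)
  simp only [pathExp_const_mul _ K (2 / (1 - γ) * P.tau γ s i), ← Finset.mul_sum] at h4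
  exact h4.trans (mul_le_mul_of_nonneg_left (P.sum_pathExp_diss_le H K)
    (by positivity))

lemma sum_pathExp_dy_le (H : P.Admissible γ s z w) (K : ℕ) (j : Fin m) :
    ∑ t ∈ Finset.range K, P.pathExp K (fun d => P.prob j * P.dy s (P.inner γ s z d t) j ^ 2)
      ≤ 2 * P.eta s * P.Delta γ s z w := by
  have hη := P.eta_pos H.s_pos
  have hg : 0 < 1 - γ := by linarith [H.γ_lt_one]
  have h : ∀ q : State n m, P.prob j * P.dy s q j ^ 2 ≤ 2 * P.eta s * P.diss γ s q := by
    intro q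
    have h1 : P.prob j * P.dy s q j ^ 2 ≤ ∑ k, P.prob k * P.dy s q k ^ 2 :=
      Finset.single_le_sum (f := fun k => P.prob k * P.dy s q k ^ 2)
        (fun k _ => by have := P.prob_pos k; positivity)
        (Finset.mem_univ j)
    have h2 : 1 / (2 * P.eta s) * (P.prob j * P.dy s q j ^ 2) ≤ P.diss γ s q := by
      have h3 : 0 ≤ (1 - γ) / 2 * ∑ i, P.p i * P.dx γ s q i ^ 2 / P.tau γ s i := by
        refine mul_nonneg (by positivity) (Finset.sum_nonneg fun i _ => ?_)
        have := P.p_pos i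
        have := P.tau_pos H.γ_pos H.s_pos i
        positivity
      have := mul_le_mul_of_nonneg_left h1 (show 0 ≤ 1 / (2 * P.eta s) by positivity)
      rw [diss]
      linarith
    rw [div_mul_eq_mul_div, one_mul, div_le_iff₀ (by positivity)] at h2
    linarith
  have h4 := Finset.sum_le_sum fun t (_ : t ∈ Finset.range K) =>
    P.pathExp_mono K fun d => h (P.inner γ s z d t)
  simp only [pathExp_const_mul _ K (2 * P.eta s), ← Finset.mul_sum] at h4
  exact h4.trans (mul_le_mul_of_nonneg_left (P.sum_pathExp_diss_le H K)
    (by positivity))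

end Moments

section Moments

variable {γ s : ℝ} {z w : Point n m}

lemma step_yc_eq (γ s : ℝ) (i : Fin n) (q : State n m) (j : Fin m) :
    (P.step γ s i q).yc j = if P.A j i ≠ 0 then P.ybar s q j else q.yc j := rfl

/-- Averaging a function of a dual coordinate that is refreshed when `A_{j,i} ≠ 0`. -/
lemma sum_p_ite (j : Fin m) (a b : ℝ) :
    ∑ i, P.p i * (if P.A j i ≠ 0 then a else b) = P.prob j * a + (1 - P.prob j) * b := by
  have : ∀ i, P.p i * (if P.A j i ≠ 0 then a else b)
      = (if P.A j i ≠ 0 then P.p i else 0) * (a - b) + P.p i * b := by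
    intro i
    split_ifs <;> ring
  simp only [this, Finset.sum_add_distrib, ← Finset.sum_mul, P.p_sum]
  rw [prob]
  ring

/-- The extrapolation `y - y̌` decays geometrically, up to the last primal increments. -/
lemma sum_p_sq_extrapolation (γ s : ℝ) (q : State n m) (j : Fin m) :
    ∑ i, P.p i * ((P.step γ s i q).y j - (P.step γ s i q).yc j) ^ 2
      = (1 - P.prob j) * (q.y j - q.yc j) ^ 2
        + P.eta s ^ 2 * ∑ i, P.A j i ^ 2 * (P.p i * P.dx γ s q i ^ 2) := by
  have h : ∀ i, P.p i * ((P.step γ s i q).y j - (P.step γ s i q).yc j) ^ 2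
      = P.p i * (if P.A j i ≠ 0 then 0 else (q.y j - q.yc j) ^ 2)
        + P.eta s ^ 2 * (P.A j i ^ 2 * (P.p i * P.dx γ s q i ^ 2)) := by
    intro i
    rw [step_y_eq, step_yc_eq]
    by_cases h : P.A j i = 0
    · simp [h]
    · simp only [ne_eq, h, not_false_eq_true, if_true]; ring
  simp only [h, Finset.sum_add_distrib, ← Finset.mul_sum, P.sum_p_ite]
  ring

lemma sq_entry_le (j : Fin m) (i : Fin n) : P.A j i ^ 2 ≤ P.colNorm i ^ 2 := by
  rw [P.colNorm_sq]
  exact Finset.single_le_sum (f := fun j => P.A j i ^ 2) (fun _ _ => sq_nonneg _)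
    (Finset.mem_univ j)

lemma eta_mul_sq_entry_mul_tau_le (hγ : 0 < γ) (hγ' : γ < 1) (hs : 0 < s) (j : Fin m)
    (i : Fin n) : P.eta s * P.A j i ^ 2 * P.tau γ s i ≤ 2 := by
  refine le_trans ?_ (P.tau_mul_eta_mul_colNorm_sq_le hγ hγ' hs i)
  have := P.eta_pos hs
  have := P.tau_pos hγ hs i
  have := P.sq_entry_le j i
  rw [mul_comm]
  gcongr

lemma extrapolation_recursion {k K : ℕ} (hk : k ≤ K) (j : Fin m) :
    P.pathExp K (fun d => ((P.inner γ s z d k).y j - (P.inner γ s z d k).yc j) ^ 2)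
      + P.prob j * ∑ t ∈ Finset.range k, P.pathExp K (fun d =>
        ((P.inner γ s z d t).y j - (P.inner γ s z d t).yc j) ^ 2)
      = P.eta s ^ 2 * ∑ i, P.A j i ^ 2 * ∑ t ∈ Finset.range k,
        P.pathExp K (fun d => P.p i * P.dx γ s (P.inner γ s z d t) i ^ 2) := by
  induction k with
  | zero => simp [inner, pathExp_const]
  | succ k ih =>
    have h1 := P.pathExp_inner_succ γ s z hk fun q => (q.y j - q.yc j) ^ 2
    simp only [P.sum_p_sq_extrapolation] at h1
    rw [pathExp_add, pathExp_const_mul, pathExp_const_mul, pathExp_sum] at h1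
    simp only [pathExp_const_mul _ K (P.A j _ ^ 2)] at h1
    simp only [Finset.sum_range_succ, mul_add, Finset.sum_add_distrib]
    have h2 := ih (Nat.le_of_succ_le hk)
    rw [h1]
    linarith

lemma extrapolation_le (H : P.Admissible γ s z w) {k K : ℕ} (hk : k ≤ K) (j : Fin m) :
    P.pathExp K (fun d => ((P.inner γ s z d k).y j - (P.inner γ s z d k).yc j) ^ 2)
      + P.prob j * ∑ t ∈ Finset.range k, P.pathExp K (fun d =>
        ((P.inner γ s z d t).y j - (P.inner γ s z d t).yc j) ^ 2)
      ≤ 4 * n / (1 - γ) * P.eta s * P.Delta γ s z w := by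
  rw [P.extrapolation_recursion hk j]
  have hη := P.eta_pos H.s_pos
  have hg : 0 < 1 - γ := by linarith [H.γ_lt_one]
  have hΔ := P.Delta_nonneg H.γ_pos H.s_pos H.saddle H.dom
  have h : ∀ i ∈ Finset.univ, P.A j i ^ 2 * ∑ t ∈ Finset.range k,
        P.pathExp K (fun d => P.p i * P.dx γ s (P.inner γ s z d t) i ^ 2)
      ≤ 4 / (1 - γ) * (P.eta s)⁻¹ * P.Delta γ s z w := by
    intro i _
    have h1 : ∑ t ∈ Finset.range k,
        P.pathExp K (fun d => P.p i * P.dx γ s (P.inner γ s z d t) i ^ 2)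
        ≤ 2 / (1 - γ) * P.tau γ s i * P.Delta γ s z w := by
      refine le_trans ?_ (P.sum_pathExp_dx_le H K i)
      refine Finset.sum_le_sum_of_subset_of_nonneg (Finset.range_mono hk) fun t _ _ => ?_
      exact P.pathExp_nonneg K fun d => mul_nonneg (P.p_pos i).le (sq_nonneg _)
    have h2 := P.eta_mul_sq_entry_mul_tau_le H.γ_pos H.γ_lt_one H.s_pos j i
    calc _ ≤ P.A j i ^ 2 * (2 / (1 - γ) * P.tau γ s i * P.Delta γ s z w) := by gcongr
      _ = 2 / (1 - γ) * P.Delta γ s z w * (P.eta s)⁻¹ * (P.eta s * P.A j i ^ 2 * P.tau γ s i) := by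
        field_simp
      _ ≤ 2 / (1 - γ) * P.Delta γ s z w * (P.eta s)⁻¹ * 2 := by gcongr
      _ = _ := by ring
  have h3 := mul_le_mul_of_nonneg_left (Finset.sum_le_sum h) (sq_nonneg (P.eta s))
  refine h3.trans (le_of_eq ?_)
  rw [Finset.sum_const, Finset.card_univ, Fintype.card_fin, nsmul_eq_mul]
  field_simp

/-- A constant that bounds the second moments of the auxiliary dual iterates. -/
def momentConst (n : ℕ) (γ : ℝ) : ℝ := 4 + 8 * n / (1 - γ)

lemma four_le_momentConst (hγ' : γ < 1) : 4 ≤ momentConst n γ := by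
  have : 0 < 1 - γ := by linarith
  have : 0 ≤ 8 * n / (1 - γ) := by positivity
  rw [momentConst]
  linarith

lemma pathExp_sq_extrapolation_le (H : P.Admissible γ s z w) {k K : ℕ} (hk : k ≤ K) (j : Fin m) :
    P.pathExp K (fun d => ((P.inner γ s z d k).y j - (P.inner γ s z d k).yc j) ^ 2)
      ≤ 4 * n / (1 - γ) * P.eta s * P.Delta γ s z w := by
  have h1 := P.extrapolation_le H hk j
  have h2 : 0 ≤ P.prob j * ∑ t ∈ Finset.range k, P.pathExp K (fun d =>
        ((P.inner γ s z d t).y j - (P.inner γ s z d t).yc j) ^ 2) :=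
    mul_nonneg (P.prob_pos j).le (Finset.sum_nonneg fun t _ =>
      P.pathExp_nonneg K fun d => sq_nonneg _)
  linarith

lemma sum_pathExp_sq_extrapolation_le (H : P.Admissible γ s z w) (K : ℕ) (j : Fin m) :
    ∑ t ∈ Finset.range K, P.pathExp K (fun d =>
        P.prob j * ((P.inner γ s z d t).y j - (P.inner γ s z d t).yc j) ^ 2)
      ≤ 4 * n / (1 - γ) * P.eta s * P.Delta γ s z w := by
  have h1 := P.extrapolation_le H (le_refl K) j
  have h2 := P.pathExp_nonneg K fun d => sq_nonneg
    ((P.inner γ s z d K).y j - (P.inner γ s z d K).yc j)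
  simp only [pathExp_const_mul, ← Finset.mul_sum]
  linarith

lemma pathExp_sq_add_le (K : ℕ) (a b c : (ℕ → Fin n) → ℝ) (h : ∀ d, c d = a d + b d) :
    P.pathExp K (fun d => c d ^ 2)
      ≤ 2 * P.pathExp K (fun d => a d ^ 2) + 2 * P.pathExp K (fun d => b d ^ 2) := by
  rw [← pathExp_const_mul, ← pathExp_const_mul, ← pathExp_add]
  refine P.pathExp_mono K fun d => ?_
  rw [h]
  nlinarith [sq_nonneg (a d - b d)]

lemma pathExp_sq_yc_le (H : P.Admissible γ s z w) {k K : ℕ} (hk : k ≤ K) (j : Fin m) :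
    P.pathExp K (fun d => ((P.inner γ s z d k).yc j - w.y j) ^ 2)
      ≤ momentConst n γ * P.eta s * P.Delta γ s z w := by
  have h1 := P.pathExp_sq_add_le K (fun d => (P.inner γ s z d k).y j - w.y j)
    (fun d => -((P.inner γ s z d k).y j - (P.inner γ s z d k).yc j))
    (fun d => (P.inner γ s z d k).yc j - w.y j) fun d => by ring
  simp only [neg_sq] at h1
  have h2 := P.pathExp_sq_y_le H hk j
  have h3 := P.pathExp_sq_extrapolation_le H hk j
  have e : momentConst n γ * P.eta s * P.Delta γ s z w
      = 2 * (2 * P.eta s * P.Delta γ s z w)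
        + 2 * (4 * n / (1 - γ) * P.eta s * P.Delta γ s z w) := by
    rw [momentConst]; ring
  linarith

lemma sum_pathExp_sq_ybar_sub_yc_le (H : P.Admissible γ s z w) (K : ℕ) (j : Fin m) :
    ∑ t ∈ Finset.range K, P.pathExp K (fun d =>
        P.prob j * (P.ybar s (P.inner γ s z d t) j - (P.inner γ s z d t).yc j) ^ 2)
      ≤ momentConst n γ * P.eta s * P.Delta γ s z w := by
  have h1 := P.sum_pathExp_dy_le H K j
  have h2 := P.sum_pathExp_sq_extrapolation_le H K j
  have h3 : ∀ t ∈ Finset.range K, P.pathExp K (fun d =>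
        P.prob j * (P.ybar s (P.inner γ s z d t) j - (P.inner γ s z d t).yc j) ^ 2)
      ≤ 2 * P.pathExp K (fun d => P.prob j * P.dy s (P.inner γ s z d t) j ^ 2)
        + 2 * P.pathExp K (fun d =>
          P.prob j * ((P.inner γ s z d t).y j - (P.inner γ s z d t).yc j) ^ 2) := by
    intro t _
    have := P.pathExp_sq_add_le K (fun d => P.dy s (P.inner γ s z d t) j)
      (fun d => (P.inner γ s z d t).y j - (P.inner γ s z d t).yc j)
      (fun d => P.ybar s (P.inner γ s z d t) j - (P.inner γ s z d t).yc j)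
      fun d => by rw [dy]; ring
    have := mul_le_mul_of_nonneg_left this (P.prob_pos j).le
    simp only [pathExp_const_mul] at this ⊢
    linarith
  have h4 := Finset.sum_le_sum h3
  rw [Finset.sum_add_distrib, ← Finset.mul_sum, ← Finset.mul_sum] at h4
  have e : momentConst n γ * P.eta s * P.Delta γ s z w
      = 2 * (2 * P.eta s * P.Delta γ s z w)
        + 2 * (4 * n / (1 - γ) * P.eta s * P.Delta γ s z w) := by
    rw [momentConst]; ring
  linarith

/-- The sum of the predicted increments of an adapted process is controlled in mean square by the
process itself and by the second moments of its increments. -/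
lemma pathExp_sq_sum_resample_le {I : ℕ → (ℕ → Fin n) → ℝ}
    (hI : ∀ t, DependsOn (I t) (Set.Iio (t + 1))) (K : ℕ) :
    P.pathExp K (fun d => (∑ t ∈ Finset.range K, P.resample t (I t) d) ^ 2)
      ≤ 2 * P.pathExp K (fun d => (∑ t ∈ Finset.range K, I t d) ^ 2)
        + 2 * ∑ t ∈ Finset.range K, P.pathExp K (P.resample t fun d => I t d ^ 2) := by
  have h1 := P.pathExp_sq_add_le K (fun d => ∑ t ∈ Finset.range K, I t d)
    (fun d => -∑ t ∈ Finset.range K, (I t d - P.resample t (I t) d))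
    (fun d => ∑ t ∈ Finset.range K, P.resample t (I t) d)
    fun d => by rw [Finset.sum_sub_distrib]; ring
  simp only [neg_sq] at h1
  have h2 := P.pathExp_sq_sum_sub_resample_le hI K
  have h3 : ∑ t ∈ Finset.range K, P.pathExp K (P.resample t fun d => I t d ^ 2)
      = ∑ t ∈ Finset.range K, P.pathExp K fun d => I t d ^ 2 :=
    Finset.sum_congr rfl fun t ht =>
      P.pathExp_resample ((hI t).comp_left fun a => a ^ 2) (Finset.mem_range.1 ht)
  rw [h3]
  linarith

lemma dependsOn_increment (γ s : ℝ) (z : Point n m) (φ : State n m → State n m → ℝ) (t : ℕ) :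
    DependsOn (fun d => φ (P.inner γ s z d t) (P.inner γ s z d (t + 1))) (Set.Iio (t + 1)) :=
  ((P.dependsOn_inner γ s z t).mono_Iio t.le_succ).comp_left₂
    (P.dependsOn_inner γ s z (t + 1)) φ

lemma resample_increment (γ s : ℝ) (z : Point n m) (φ : State n m → State n m → ℝ) (t : ℕ)
    (d : ℕ → Fin n) :
    P.resample t (fun d => φ (P.inner γ s z d t) (P.inner γ s z d (t + 1))) d
      = ∑ i, P.p i * φ (P.inner γ s z d t) (P.step γ s i (P.inner γ s z d t)) := by
  simp only [resample_apply, inner_update]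
  refine Finset.sum_congr rfl fun i _ => ?_
  rw [(P.dependsOn_inner γ s z t).apply_update le_rfl]

/-- The mean square control of the predicted increments, for increments that are functions of two
successive states. -/
lemma pathExp_sq_sum_mean_le (γ s : ℝ) (z : Point n m) (φ : State n m → State n m → ℝ) (K : ℕ) :
    P.pathExp K (fun d => (∑ t ∈ Finset.range K,
        ∑ i, P.p i * φ (P.inner γ s z d t) (P.step γ s i (P.inner γ s z d t))) ^ 2)
      ≤ 2 * P.pathExp K (fun d => (∑ t ∈ Finset.range K,
          φ (P.inner γ s z d t) (P.inner γ s z d (t + 1))) ^ 2)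
        + 2 * ∑ t ∈ Finset.range K, P.pathExp K (fun d =>
          ∑ i, P.p i * φ (P.inner γ s z d t) (P.step γ s i (P.inner γ s z d t)) ^ 2) := by
  have h := P.pathExp_sq_sum_resample_le (P.dependsOn_increment γ s z φ) K
  simp only [P.resample_increment γ s z φ] at h
  refine h.trans (le_of_eq ?_)
  congr 2
  refine Finset.sum_congr rfl fun t _ => congrArg _ (funext fun d => ?_)
  exact P.resample_increment γ s z (fun q q' => φ q q' ^ 2) t d

lemma sum_p_step_x_coord (γ s : ℝ) (q : State n m) (i : Fin n) (φ : ℝ → ℝ) (h0 : φ 0 = 0) :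
    ∑ k, P.p k * φ ((P.step γ s k q).x i - q.x i) = P.p i * φ (P.dx γ s q i) := by
  rw [Finset.sum_eq_single i]
  · rw [step_x_eq]; simp
  · intro k _ hk
    rw [step_x_eq]
    simp [Pi.single_eq_of_ne hk.symm, h0]
  · intro hi; exact absurd (Finset.mem_univ i) hi

lemma pathExp_sq_x_sub_start_le (H : P.Admissible γ s z w) (K : ℕ) (i : Fin n) :
    P.pathExp K (fun d => ((P.inner γ s z d K).x i - z.x i) ^ 2)
      ≤ 8 / P.pmin * P.tau γ s i * P.Delta γ s z w := by
  have h := P.pathExp_sq_add_le K (fun d => (P.inner γ s z d K).x i - w.x i)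
    (fun d => -((P.inner γ s z d 0).x i - w.x i))
    (fun d => (P.inner γ s z d K).x i - z.x i) fun d => by simp only [inner]; ring
  simp only [neg_sq] at h
  have h1 := P.pathExp_sq_x_le H (le_refl K) i
  have h2 := P.pathExp_sq_x_le H (Nat.zero_le K) i
  have e : 8 / P.pmin * P.tau γ s i * P.Delta γ s z w
      = 2 * (2 / P.pmin * P.tau γ s i * P.Delta γ s z w)
        + 2 * (2 / P.pmin * P.tau γ s i * P.Delta γ s z w) := by ring
  linarith

lemma pathExp_sq_sum_dx_le (H : P.Admissible γ s z w) (K : ℕ) (i : Fin n) :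
    P.pathExp K (fun d => (∑ t ∈ Finset.range K, P.p i * P.dx γ s (P.inner γ s z d t) i) ^ 2)
      ≤ (16 / P.pmin + 4 / (1 - γ)) * P.tau γ s i * P.Delta γ s z w := by
  have h := P.pathExp_sq_sum_mean_le γ s z (fun q q' => q'.x i - q.x i) K
  have e1 : ∀ q, ∑ k, P.p k * ((P.step γ s k q).x i - q.x i) = P.p i * P.dx γ s q i :=
    fun q => P.sum_p_step_x_coord γ s q i (fun a => a) rfl
  have e2 : ∀ q, ∑ k, P.p k * ((P.step γ s k q).x i - q.x i) ^ 2 = P.p i * P.dx γ s q i ^ 2 :=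
    fun q => P.sum_p_step_x_coord γ s q i (fun a => a ^ 2) (by simp)
  have e3 : ∀ d, ∑ t ∈ Finset.range K, ((P.inner γ s z d (t + 1)).x i - (P.inner γ s z d t).x i)
      = (P.inner γ s z d K).x i - z.x i := fun d =>
    Finset.sum_range_sub (fun t => (P.inner γ s z d t).x i) K
  simp only [e1, e2, e3] at h
  have h1 := P.pathExp_sq_x_sub_start_le H K i
  have h2 := P.sum_pathExp_dx_le H K i
  have e : (16 / P.pmin + 4 / (1 - γ)) * P.tau γ s i * P.Delta γ s z w
      = 2 * (8 / P.pmin * P.tau γ s i * P.Delta γ s z w)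
        + 2 * (2 / (1 - γ) * P.tau γ s i * P.Delta γ s z w) := by ring
  linarith

lemma pathExp_sq_yc_sub_start_le (H : P.Admissible γ s z w) (K : ℕ) (j : Fin m) :
    P.pathExp K (fun d => ((P.inner γ s z d K).yc j - z.y j) ^ 2)
      ≤ 4 * momentConst n γ * P.eta s * P.Delta γ s z w := by
  have h := P.pathExp_sq_add_le K (fun d => (P.inner γ s z d K).yc j - w.y j)
    (fun d => -((P.inner γ s z d 0).yc j - w.y j))
    (fun d => (P.inner γ s z d K).yc j - z.y j) fun d => by simp only [inner]; ring
  simp only [neg_sq] at h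
  have h1 := P.pathExp_sq_yc_le H (le_refl K) j
  have h2 := P.pathExp_sq_yc_le H (Nat.zero_le K) j
  linarith

lemma pathExp_sq_y_sub_start_le (H : P.Admissible γ s z w) (K : ℕ) (j : Fin m) :
    P.pathExp K (fun d => ((P.inner γ s z d K).y j - z.y j) ^ 2)
      ≤ 8 * P.eta s * P.Delta γ s z w := by
  have h := P.pathExp_sq_add_le K (fun d => (P.inner γ s z d K).y j - w.y j)
    (fun d => -((P.inner γ s z d 0).y j - w.y j))
    (fun d => (P.inner γ s z d K).y j - z.y j) fun d => by simp only [inner]; ring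
  simp only [neg_sq] at h
  have h1 := P.pathExp_sq_y_le H (le_refl K) j
  have h2 := P.pathExp_sq_y_le H (Nat.zero_le K) j
  linarith

/-- The accumulated difference between the vectors `ȳ_{k+1}` and `y̌_{k+1}` stays bounded in mean
square. -/
lemma pathExp_sq_sum_ybar_sub_yc_le (H : P.Admissible γ s z w) (K : ℕ) (j : Fin m) :
    P.pathExp K (fun d => (∑ t ∈ Finset.range K,
        (P.ybar s (P.inner γ s z d t) j - (P.inner γ s z d (t + 1)).yc j)) ^ 2)
      ≤ 28 / P.pmin ^ 2 * momentConst n γ * P.eta s * P.Delta γ s z w := by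
  have h := P.pathExp_sq_sum_mean_le γ s z (fun q q' => q'.yc j - q.yc j) K
  have e0 : ∀ q (i : Fin n), (P.step γ s i q).yc j - q.yc j
      = if P.A j i ≠ 0 then P.ybar s q j - q.yc j else 0 := fun q i => by
    rw [step_yc_eq]; split_ifs <;> ring
  have e1 : ∀ q, ∑ i, P.p i * ((P.step γ s i q).yc j - q.yc j)
      = P.prob j * (P.ybar s q j - q.yc j) := fun q => by
    simp only [e0, P.sum_p_ite, mul_zero, add_zero]
  have e2 : ∀ q, ∑ i, P.p i * ((P.step γ s i q).yc j - q.yc j) ^ 2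
      = P.prob j * (P.ybar s q j - q.yc j) ^ 2 := fun q => by
    simp only [e0, ite_pow, P.sum_p_ite]; ring
  have e3 : ∀ d, ∑ t ∈ Finset.range K, ((P.inner γ s z d (t + 1)).yc j
      - (P.inner γ s z d t).yc j) = (P.inner γ s z d K).yc j - z.y j := fun d =>
    Finset.sum_range_sub (fun t => (P.inner γ s z d t).yc j) K
  simp only [e1, e2, e3, ← Finset.mul_sum, mul_pow] at h
  rw [pathExp_const_mul] at h
  have h1 := P.pathExp_sq_yc_sub_start_le H K j
  have h2 := P.sum_pathExp_sq_ybar_sub_yc_le H K j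
  -- `ȳ_{t+1} - y̌_{t+1}` is `ȳ_{t+1} - y̌_t`, which is proportional to the predicted increment of `y̌`,
  -- minus the actual increment of `y̌`
  have h3 := P.pathExp_sq_add_le K
    (fun d => ∑ t ∈ Finset.range K, (P.ybar s (P.inner γ s z d t) j - (P.inner γ s z d t).yc j))
    (fun d => -((P.inner γ s z d K).yc j - z.y j))
    (fun d => ∑ t ∈ Finset.range K,
        (P.ybar s (P.inner γ s z d t) j - (P.inner γ s z d (t + 1)).yc j)) fun d => by
      rw [← e3 d, ← sub_eq_add_neg, ← Finset.sum_sub_distrib]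
      exact Finset.sum_congr rfl fun t _ => by ring
  simp only [neg_sq] at h3
  set S := P.pathExp K fun d => (∑ t ∈ Finset.range K,
    (P.ybar s (P.inner γ s z d t) j - (P.inner γ s z d t).yc j)) ^ 2 with hS
  have hS0 : 0 ≤ S := P.pathExp_nonneg K fun d => sq_nonneg _
  set B := momentConst n γ * P.eta s * P.Delta γ s z w with hB
  have hB0 : 0 ≤ B := mul_nonneg (mul_nonneg (by linarith [four_le_momentConst (n := n) H.γ_lt_one])
    (P.eta_pos H.s_pos).le) (P.Delta_nonneg H.γ_pos H.s_pos H.saddle H.dom)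
  have hpm := P.pmin_pos
  have h5 : P.pmin ^ 2 * S ≤ 10 * B := by
    have : P.pmin ^ 2 * S ≤ P.prob j ^ 2 * S := by
      have := P.pmin_le_prob j
      gcongr
    linarith
  have h6 : S ≤ 10 * B / P.pmin ^ 2 := by
    rw [le_div_iff₀ (by positivity)]; linarith
  have h7 : B ≤ B / P.pmin ^ 2 := by
    rw [le_div_iff₀ (by positivity)]
    have : P.pmin ^ 2 ≤ 1 := pow_le_one₀ hpm.le P.pmin_le_one
    nlinarith
  have e : 28 / P.pmin ^ 2 * momentConst n γ * P.eta s * P.Delta γ s z w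
      = 2 * (10 * B / P.pmin ^ 2) + 8 * (B / P.pmin ^ 2) := by rw [hB]; ring
  rw [e]
  linarith

lemma sq_mulVec_le (v : Fin n → ℝ) (j : Fin m) :
    P.A.mulVec v j ^ 2 ≤ n * ∑ i, P.A j i ^ 2 * v i ^ 2 := by
  have := sq_sum_le_card_mul_sum_sq (s := Finset.univ) (f := fun i => P.A j i * v i)
  simpa [Matrix.mulVec, dotProduct, mul_pow] using this

lemma pathExp_sq_mulVec_x_sub_start_le (H : P.Admissible γ s z w) (K : ℕ) (j : Fin m) :
    P.eta s * P.pathExp K (fun d => P.A.mulVec (fun i => (P.inner γ s z d K).x i - z.x i) j ^ 2)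
      ≤ 16 * n ^ 2 / P.pmin * P.Delta γ s z w := by
  have hη := P.eta_pos H.s_pos
  have hpm := P.pmin_pos
  have hΔ := P.Delta_nonneg H.γ_pos H.s_pos H.saddle H.dom
  have h1 := P.pathExp_mono K fun d =>
    P.sq_mulVec_le (fun i => (P.inner γ s z d K).x i - z.x i) j
  rw [pathExp_const_mul, pathExp_sum] at h1
  simp only [pathExp_const_mul] at h1
  have h2 : ∀ i ∈ Finset.univ, P.eta s * (P.A j i ^ 2 * P.pathExp K (fun d =>
      ((P.inner γ s z d K).x i - z.x i) ^ 2)) ≤ 16 / P.pmin * P.Delta γ s z w := by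
    intro i _
    have h3 := P.eta_mul_sq_entry_mul_tau_le H.γ_pos H.γ_lt_one H.s_pos j i
    calc _ ≤ P.eta s * (P.A j i ^ 2 * (8 / P.pmin * P.tau γ s i * P.Delta γ s z w)) := by
          gcongr; exact P.pathExp_sq_x_sub_start_le H K i
      _ = 8 / P.pmin * P.Delta γ s z w * (P.eta s * P.A j i ^ 2 * P.tau γ s i) := by ring
      _ ≤ 8 / P.pmin * P.Delta γ s z w * 2 := by gcongr
      _ = _ := by ring
  have h4 := Finset.sum_le_sum h2
  rw [← Finset.mul_sum, Finset.sum_const, Finset.card_univ, Fintype.card_fin, nsmul_eq_mul] at h4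
  calc _ ≤ P.eta s * (n * ∑ i, P.A j i ^ 2 * P.pathExp K (fun d =>
      ((P.inner γ s z d K).x i - z.x i) ^ 2)) := by gcongr
    _ = n * (P.eta s * ∑ i, P.A j i ^ 2 * P.pathExp K (fun d =>
      ((P.inner γ s z d K).x i - z.x i) ^ 2)) := by ring
    _ ≤ n * (n * (16 / P.pmin * P.Delta γ s z w)) := by gcongr
    _ = _ := by ring

lemma pathExp_sq_sum_dy_le (H : P.Admissible γ s z w) (K : ℕ) (j : Fin m) :
    P.pathExp K (fun d => (∑ t ∈ Finset.range K, P.prob j * P.dy s (P.inner γ s z d t) j) ^ 2)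
      ≤ (36 + 64 * n ^ 2 / P.pmin) * P.eta s * P.Delta γ s z w := by
  have hη := P.eta_pos H.s_pos
  -- the increment of `y^j` without its extrapolation term
  have h := P.pathExp_sq_sum_mean_le γ s z (fun q q' => (q'.y j - q.y j)
    - P.eta s * P.A.mulVec (fun i => q'.x i - q.x i) j) K
  have e0 : ∀ q (i : Fin n), ((P.step γ s i q).y j - q.y j)
      - P.eta s * P.A.mulVec (fun k => (P.step γ s i q).x k - q.x k) j
      = if P.A j i ≠ 0 then P.dy s q j else 0 := fun q i => by
    have := P.mulVec_step_x γ s i q j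
    rw [show (fun k => (P.step γ s i q).x k - q.x k) = (P.step γ s i q).x - q.x from rfl, this,
      step_y_eq, dy]
    by_cases h : P.A j i = 0
    · simp [h]
    · simp only [ne_eq, h, not_false_eq_true, if_true]; ring
  have e1 : ∀ q, ∑ i, P.p i * (((P.step γ s i q).y j - q.y j)
      - P.eta s * P.A.mulVec (fun k => (P.step γ s i q).x k - q.x k) j)
      = P.prob j * P.dy s q j := fun q => by
    simp only [e0, P.sum_p_ite, mul_zero, add_zero]
  have e2 : ∀ q, ∑ i, P.p i * (((P.step γ s i q).y j - q.y j)
      - P.eta s * P.A.mulVec (fun k => (P.step γ s i q).x k - q.x k) j) ^ 2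
      = P.prob j * P.dy s q j ^ 2 := fun q => by
    simp only [e0, ite_pow, P.sum_p_ite]; ring
  have e3 : ∀ d, ∑ t ∈ Finset.range K, (((P.inner γ s z d (t + 1)).y j - (P.inner γ s z d t).y j)
      - P.eta s * P.A.mulVec (fun i => (P.inner γ s z d (t + 1)).x i
        - (P.inner γ s z d t).x i) j) = ((P.inner γ s z d K).y j - z.y j)
      + -(P.eta s * P.A.mulVec (fun i => (P.inner γ s z d K).x i - z.x i) j) := fun d => by
    have : ∀ t, P.A.mulVec (fun i => (P.inner γ s z d (t + 1)).x i - (P.inner γ s z d t).x i) j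
        = P.A.mulVec (P.inner γ s z d (t + 1)).x j - P.A.mulVec (P.inner γ s z d t).x j :=
      fun t => congrFun (Matrix.mulVec_sub P.A _ _) j
    have h0 : P.A.mulVec (fun i => (P.inner γ s z d K).x i - z.x i) j
        = P.A.mulVec (P.inner γ s z d K).x j - P.A.mulVec z.x j :=
      congrFun (Matrix.mulVec_sub P.A _ _) j
    rw [h0]
    simp only [this, Finset.sum_sub_distrib (f := fun t => (P.inner γ s z d (t + 1)).y j - _),
      ← Finset.mul_sum]
    rw [Finset.sum_range_sub (fun t => (P.inner γ s z d t).y j),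
      Finset.sum_range_sub (fun t => P.A.mulVec (P.inner γ s z d t).x j), ← sub_eq_add_neg]
    rfl
  simp only [e1, e2, e3] at h
  have h1 := P.pathExp_sq_add_le K _ _ _ fun d => rfl
    (a := ((P.inner γ s z d K).y j - z.y j)
      + -(P.eta s * P.A.mulVec (fun i => (P.inner γ s z d K).x i - z.x i) j))
  simp only [neg_sq, mul_pow] at h1
  rw [pathExp_const_mul _ K (P.eta s ^ 2)] at h1
  have h2 := P.sum_pathExp_dy_le H K j
  have h3 := P.pathExp_sq_y_sub_start_le H K j
  have h4 := mul_le_mul_of_nonneg_left (P.pathExp_sq_mulVec_x_sub_start_le H K j) hη.le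
  have e : (36 + 64 * n ^ 2 / P.pmin) * P.eta s * P.Delta γ s z w
      = 2 * (2 * (8 * P.eta s * P.Delta γ s z w)
        + 2 * (P.eta s * (16 * n ^ 2 / P.pmin * P.Delta γ s z w)))
        + 2 * (2 * P.eta s * P.Delta γ s z w) := by ring
  rw [e]
  linarith

end Moments

end Problem
end PureCD

namespace PureCD

/-! ### Averages and Jensen's inequality -/

lemma _root_.ConvexOn.map_mean_range_le {E : Type*} [AddCommGroup E] [Module ℝ E] {S : Set E}
    {φ : E → ℝ} (h : ConvexOn ℝ S φ) {K : ℕ} (hK : 1 ≤ K) {u : ℕ → E}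
    (hu : ∀ t < K, u t ∈ S) :
    (K : ℝ)⁻¹ • ∑ t ∈ Finset.range K, u t ∈ S ∧
      K * φ ((K : ℝ)⁻¹ • ∑ t ∈ Finset.range K, u t) ≤ ∑ t ∈ Finset.range K, φ (u t) := by
  have hK0 : (0 : ℝ) < K := by exact_mod_cast hK
  have hw : ∑ _t ∈ Finset.range K, (K : ℝ)⁻¹ = 1 := by
    rw [Finset.sum_const, Finset.card_range, nsmul_eq_mul, mul_inv_cancel₀ hK0.ne']
  have h0 : ∀ t ∈ Finset.range K, 0 ≤ (K : ℝ)⁻¹ := fun _ _ => by positivity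
  have hu' : ∀ t ∈ Finset.range K, u t ∈ S := fun t ht => hu t (Finset.mem_range.1 ht)
  rw [Finset.smul_sum]
  refine ⟨h.1.sum_mem h0 hw hu', ?_⟩
  have := mul_le_mul_of_nonneg_left (h.map_sum_le h0 hw hu') hK0.le
  rwa [← Finset.smul_sum (f := fun t => φ (u t)), smul_eq_mul, mul_inv_cancel_left₀ hK0.ne'] at this

lemma IsClosedConvex.convexOn {φ : ℝ → EReal} (h : IsClosedConvex φ) :
    ConvexOn ℝ {u | φ u ≠ ⊤} fun u => (φ u).toReal :=
  ⟨fun _ hu _ hv _ _ ha hb hab => (h.toReal_convex hu hv ha hb hab).1,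
    fun _ hu _ hv _ _ ha hb hab => (h.toReal_convex hu hv ha hb hab).2⟩

namespace Problem

variable {n m : ℕ} (P : Problem n m)

lemma sum_Icc_eq_sum_range {f : ℕ → ℝ} (K : ℕ) :
    ∑ k ∈ Finset.Icc 1 K, f k = ∑ t ∈ Finset.range K, f (t + 1) := by
  rw [Finset.range_eq_Ico, Finset.sum_Ico_add' f 0 K 1]
  rfl

section Gap

variable {γ s : ℝ} {z w : Point n m}

lemma average_x (γ s : ℝ) (z : Point n m) (d : ℕ → Fin n) (K : ℕ) :
    (P.average γ s z d K).x
      = (K : ℝ)⁻¹ • ∑ t ∈ Finset.range K, (P.inner γ s z d (t + 1)).x := by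
  funext i
  simp only [average]
  rw [sum_Icc_eq_sum_range, Pi.smul_apply, Finset.sum_apply, smul_eq_mul, div_eq_inv_mul]

lemma average_y (γ s : ℝ) (z : Point n m) (d : ℕ → Fin n) (K : ℕ) :
    (P.average γ s z d K).y
      = (K : ℝ)⁻¹ • ∑ t ∈ Finset.range K, (P.inner γ s z d (t + 1)).yc := by
  funext i
  simp only [average]
  rw [sum_Icc_eq_sum_range, Pi.smul_apply, Finset.sum_apply, smul_eq_mul, div_eq_inv_mul]

lemma primal_average_le {K : ℕ} (hK : 1 ≤ K) {u : ℕ → Fin n → ℝ} (hu : ∀ t < K, P.DomX (u t)) :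
    P.DomX ((K : ℝ)⁻¹ • ∑ t ∈ Finset.range K, u t) ∧
      K * (P.primal ((K : ℝ)⁻¹ • ∑ t ∈ Finset.range K, u t)).toReal
        ≤ ∑ t ∈ Finset.range K, (P.primal (u t)).toReal := by
  have e : ∀ i, ((K : ℝ)⁻¹ • ∑ t ∈ Finset.range K, u t) i
      = (K : ℝ)⁻¹ • ∑ t ∈ Finset.range K, u t i := fun i => by
    rw [Pi.smul_apply, Finset.sum_apply]
  have h1 : ∀ i, _ := fun i => (P.f_closed i).convexOn.map_mean_range_le hK
    (u := fun t => u t i) fun t ht => hu t ht i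
  have hdom : P.DomX ((K : ℝ)⁻¹ • ∑ t ∈ Finset.range K, u t) := fun i => by
    rw [e]; exact (h1 i).1
  refine ⟨hdom, ?_⟩
  have h2 := (P.f₂_convex.map_mean_range_le hK (u := u) fun _ _ => Set.mem_univ _).2
  have h3 := Finset.sum_le_sum fun i (_ : i ∈ Finset.univ) => (h1 i).2
  rw [P.toReal_primal hdom, mul_add, Finset.mul_sum]
  simp only [e]
  rw [Finset.sum_congr rfl fun t ht => P.toReal_primal (hu t (Finset.mem_range.1 ht)),
    Finset.sum_add_distrib, Finset.sum_comm]
  linarith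

lemma dual_average_le {ys : Fin m → ℝ} (hys : P.DomY ys) {K : ℕ} (hK : 1 ≤ K)
    {u : ℕ → Fin m → ℝ} (hu : ∀ t < K, P.DomY (u t)) :
    P.DomY ((K : ℝ)⁻¹ • ∑ t ∈ Finset.range K, u t) ∧
      K * (P.dual ((K : ℝ)⁻¹ • ∑ t ∈ Finset.range K, u t)).toReal
        ≤ ∑ t ∈ Finset.range K, (P.dual (u t)).toReal := by
  have e : ∀ i, ((K : ℝ)⁻¹ • ∑ t ∈ Finset.range K, u t) i
      = (K : ℝ)⁻¹ • ∑ t ∈ Finset.range K, u t i := fun i => by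
    rw [Pi.smul_apply, Finset.sum_apply]
  have h1 : ∀ j, _ := fun j =>
    (isClosedConvex_conj (P.g_closed j) ⟨_, hys j⟩).convexOn.map_mean_range_le hK
    (u := fun t => u t j) fun t ht => hu t ht j
  have hdom : P.DomY ((K : ℝ)⁻¹ • ∑ t ∈ Finset.range K, u t) := fun j => by
    rw [e]; exact (h1 j).1
  refine ⟨hdom, ?_⟩
  have h3 := Finset.sum_le_sum fun j (_ : j ∈ Finset.univ) => (h1 j).2
  rw [P.toReal_dual hdom, Finset.mul_sum]
  simp only [e]
  rw [Finset.sum_congr rfl fun t ht => P.toReal_dual (hu t (Finset.mem_range.1 ht)),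
    Finset.sum_comm]
  exact h3

/-! ### Linearization of the gap along a trajectory -/

lemma entry_ne_zero_of_prob_eq_one {j : Fin m} (h : P.prob j = 1) (i : Fin n) : P.A j i ≠ 0 := by
  intro h0
  have : P.prob j < 1 := by
    rw [← P.p_sum, prob]
    refine Finset.sum_lt_sum (fun k _ => ?_) ⟨i, Finset.mem_univ i, ?_⟩
    · split_ifs
      exacts [le_rfl, (P.p_pos k).le]
    · simpa [h0] using P.p_pos i
  exact this.ne h

/-- After one iteration, `g*` is finite at `y̌`: the dual coordinates at which it may be infinite
initially are those that every iteration refreshes. -/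
lemma domY_yc (hw : P.IsSaddle w) (hs : 0 < s) (γ : ℝ)
    (hz : ∀ j, P.prob j < 1 → conj (P.g j) (z.y j) ≠ ⊤) (d : ℕ → Fin n) (k : ℕ) :
    P.DomY (P.inner γ s z d (k + 1)).yc := by
  have hbar := P.ybar_ne_top hw.domY hs
  have h1 : ∀ k, ∀ j, P.prob j < 1 → conj (P.g j) ((P.inner γ s z d k).yc j) ≠ ⊤ := by
    intro k
    induction k with
    | zero => exact hz
    | succ k ih =>
      intro j hj
      rw [inner, step_yc_eq]
      split_ifs
      exacts [hbar _ j, ih j hj]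
  intro j
  rcases (P.prob_le_one j).lt_or_eq with hj | hj
  · exact h1 _ j hj
  · rw [inner, step_yc_eq, if_pos (P.entry_ne_zero_of_prob_eq_one hj _)]
    exact hbar _ j

/-- The coefficient of `x' - x*` contributed by the transition from `q` to `q'`. -/
def slopeX (γ s : ℝ) (q q' : State n m) (i : Fin n) : ℝ :=
  P.pmin / P.tau γ s i * P.dx γ s q i
    + P.pmin * ∑ j, P.A j i * (P.ybar s q j - q'.yc j)

/-- The coefficient of `y' - y*` contributed by the transition from `q` to `q'`. -/
def slopeY (s : ℝ) (q q' : State n m) (j : Fin m) : ℝ :=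
  P.prob j / P.eta s * P.dy s q j + P.pmin * P.A.mulVec (fun i => q'.x i - q.x i) j

/-- The contribution of the transition from `q` to `q'` that does not depend on the comparison
point. -/
def offset (γ s : ℝ) (w : Point n m) (q q' : State n m) : ℝ :=
  P.lyap γ s q.x q.y w - ∑ i, P.p i * P.lyap γ s (P.step γ s i q).x (P.step γ s i q).y w
    + P.pmin * (P.excess q'.x w - P.excess q.x w)
    + P.pmin * ∑ j, (P.tilt w j (q'.yc j) - P.tilt w j (P.ybar s q j))

lemma coupling_sub_sub (x x' : Fin n → ℝ) (y y' : Fin m → ℝ) :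
    P.coupling x y - P.coupling x' y - (P.coupling x y' - P.coupling x' y')
      = ∑ j, P.A.mulVec (fun i => x i - x' i) j * (y j - y' j) := by
  have : ∀ j, P.A.mulVec (fun i => x i - x' i) j = P.A.mulVec x j - P.A.mulVec x' j := fun j =>
    congrFun (Matrix.mulVec_sub P.A x x') j
  simp only [this, coupling, ← Finset.sum_sub_distrib]
  exact Finset.sum_congr rfl fun j _ => by ring

/-- The one-iteration inequality with the proposed `ȳ` replaced by the auxiliary iterate `y̌` that
enters the average, and with the new primal iterate. -/
lemma transition_le (hγ : 0 < γ) (hγ' : γ < 1) (hs : 0 < s) {q q' : State n m}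
    (hq : P.DomX q.x) (hq' : P.DomY q'.yc) {x' : Fin n → ℝ} {y' : Fin m → ℝ}
    (hx' : P.DomX x') (hy' : P.DomY y') :
    P.pmin * (((P.primal q'.x).toReal + P.coupling q'.x y' - (P.dual y').toReal)
        - ((P.primal x').toReal + P.coupling x' q'.yc - (P.dual q'.yc).toReal))
      ≤ P.offset γ s w q q' + ∑ i, P.slopeX γ s q q' i * (x' i - w.x i)
        + ∑ j, P.slopeY s q q' j * (y' j - w.y j) := by
  have h1 := P.one_step hγ hγ' hs hq w hx' hy'
  have h2 := P.diss_nonneg hγ hγ' hs q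
  have h3 : (P.primal q'.x).toReal + P.coupling q'.x y' - ((P.primal q.x).toReal
      + P.coupling q.x y') = P.excess q'.x w - P.excess q.x w
        + ∑ j, P.A.mulVec (fun i => q'.x i - q.x i) j * (y' j - w.y j) := by
    rw [← P.coupling_sub_sub, excess, excess]; ring
  have h4 : P.coupling x' (P.ybar s q) - (P.dual (P.ybar s q)).toReal
      - (P.coupling x' q'.yc - (P.dual q'.yc).toReal)
      = ∑ j, (P.tilt w j (q'.yc j) - P.tilt w j (P.ybar s q j))
        + ∑ i, (∑ j, P.A j i * (P.ybar s q j - q'.yc j)) * (x' i - w.x i) := by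
    have h5 := P.coupling_sub_sub x' w.x (P.ybar s q) q'.yc
    have h6 : ∑ i, (∑ j, P.A j i * (P.ybar s q j - q'.yc j)) * (x' i - w.x i)
        = ∑ j, P.A.mulVec (fun i => x' i - w.x i) j * (P.ybar s q j - q'.yc j) := by
      simp only [Matrix.mulVec, dotProduct, Finset.sum_mul]
      rw [Finset.sum_comm]
      exact Finset.sum_congr rfl fun j _ => Finset.sum_congr rfl fun i _ => by ring
    rw [h6, ← h5, P.toReal_dual hq', P.toReal_dual fun j => P.ybar_ne_top hy' hs q j]
    simp only [tilt, Finset.sum_sub_distrib, coupling]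
    ring
  have e1 : ∑ i, P.slopeX γ s q q' i * (x' i - w.x i)
      = ∑ i, P.pmin / P.tau γ s i * P.dx γ s q i * (x' i - w.x i)
        + P.pmin * ∑ i, (∑ j, P.A j i * (P.ybar s q j - q'.yc j)) * (x' i - w.x i) := by
    rw [Finset.mul_sum, ← Finset.sum_add_distrib]
    exact Finset.sum_congr rfl fun i _ => by rw [slopeX]; ring
  have e2 : ∑ j, P.slopeY s q q' j * (y' j - w.y j)
      = ∑ j, P.prob j / P.eta s * P.dy s q j * (y' j - w.y j)
        + P.pmin * ∑ j, P.A.mulVec (fun i => q'.x i - q.x i) j * (y' j - w.y j) := by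
    rw [Finset.mul_sum, ← Finset.sum_add_distrib]
    exact Finset.sum_congr rfl fun j _ => by rw [slopeY]; ring
  rw [e1, e2, offset]
  have h7 := congrArg (fun a => P.pmin * a) h3
  have h8 := congrArg (fun a => P.pmin * a) h4
  simp only [mul_add, mul_sub] at *
  linarith

/-- The expected total offset: the Lyapunov terms telescope, and so do the values of `g*` at the
auxiliary dual iterates, weighted by `π_j⁻¹ - 1`. -/
lemma sum_pathExp_offset_le (H : P.Admissible γ s z w)
    (hz : ∀ j, P.prob j < 1 → conj (P.g j) (z.y j) ≠ ⊤) {K : ℕ} (hK : 1 ≤ K) :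
    ∑ t ∈ Finset.range K, P.pathExp K (fun d =>
        P.offset γ s w (P.inner γ s z d t) (P.inner γ s z d (t + 1)))
      ≤ P.Delta γ s z w + P.pmin * ∑ j, ((P.prob j)⁻¹ - 1)
        * (P.tilt w j (z.y j) - P.tilt w j (w.y j)) := by
  have h1 : ∀ t ∈ Finset.range K, P.pathExp K (fun d =>
        P.offset γ s w (P.inner γ s z d t) (P.inner γ s z d (t + 1)))
      = (P.pathExp K (fun d => P.lyap γ s (P.inner γ s z d t).x (P.inner γ s z d t).y w
            - P.pmin * P.excess (P.inner γ s z d t).x w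
            + P.pmin * ∑ j, ((P.prob j)⁻¹ - 1) * P.tilt w j ((P.inner γ s z d t).yc j))
        - P.pathExp K (fun d => P.lyap γ s (P.inner γ s z d (t + 1)).x
            (P.inner γ s z d (t + 1)).y w - P.pmin * P.excess (P.inner γ s z d (t + 1)).x w
            + P.pmin * ∑ j, ((P.prob j)⁻¹ - 1)
              * P.tilt w j ((P.inner γ s z d (t + 1)).yc j))) := by
    intro t ht
    have ht : t < K := Finset.mem_range.1 ht
    have h2 := P.pathExp_inner_succ γ s z ht fun q => P.lyap γ s q.x q.y w
    -- `y̌^j` is refreshed with probability `π_j`, so a value at `ȳ` is a combination of values at two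
    -- successive `y̌`
    have h3 : ∀ j, P.pathExp K (fun d => P.tilt w j (P.ybar s (P.inner γ s z d t) j))
        = (P.prob j)⁻¹ * P.pathExp K (fun d => P.tilt w j ((P.inner γ s z d (t + 1)).yc j))
          - ((P.prob j)⁻¹ - 1)
            * P.pathExp K (fun d => P.tilt w j ((P.inner γ s z d t).yc j)) := by
      intro j
      have h4 := P.pathExp_inner_succ γ s z ht fun q => P.tilt w j (q.yc j)
      have h5 : ∀ q, ∑ i, P.p i * P.tilt w j ((P.step γ s i q).yc j)
          = P.prob j * P.tilt w j (P.ybar s q j) + (1 - P.prob j) * P.tilt w j (q.yc j) := by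
        intro q
        rw [← P.sum_p_ite]
        refine Finset.sum_congr rfl fun i _ => ?_
        rw [step_yc_eq]
        split_ifs <;> rfl
      simp only [h5] at h4
      rw [pathExp_add, pathExp_const_mul, pathExp_const_mul] at h4
      rw [h4]
      have := P.prob_pos j
      field_simp
      ring
    simp only [offset]
    simp only [pathExp_add, pathExp_sub, pathExp_const_mul, pathExp_sum, h3]
    rw [h2]
    simp only [pathExp_sum, pathExp_const_mul, mul_sub, Finset.sum_sub_distrib, sub_mul, one_mul]
    ring
  rw [Finset.sum_congr rfl h1, Finset.sum_range_sub']
  simp only [inner, pathExp_const]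
  have h6 : P.lyap γ s z.x z.y w - P.pmin * P.excess z.x w = P.Delta γ s z w := by
    rw [lyap, Delta_eq]; ring
  obtain ⟨k, rfl⟩ : ∃ k, K = k + 1 := ⟨K - 1, by omega⟩
  have h7 : P.pathExp (k + 1) (fun _ => P.pmin * ∑ j, ((P.prob j)⁻¹ - 1) * P.tilt w j (w.y j))
      ≤ P.pathExp (k + 1) (fun d => P.lyap γ s (P.inner γ s z d (k + 1)).x
            (P.inner γ s z d (k + 1)).y w - P.pmin * P.excess (P.inner γ s z d (k + 1)).x w
            + P.pmin * ∑ j, ((P.prob j)⁻¹ - 1)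
              * P.tilt w j ((P.inner γ s z d (k + 1)).yc j)) := by
    refine P.pathExp_mono _ fun d => ?_
    have h8 := P.Delta_nonneg (γ := γ) (s := s)
      (z := ⟨(P.inner γ s z d (k + 1)).x, (P.inner γ s z d (k + 1)).y⟩) H.γ_pos H.s_pos H.saddle
      (P.domX_inner H.γ_pos H.s_pos H.dom d (k + 1))
    rw [Delta_eq] at h8
    have h9 : ∑ j, ((P.prob j)⁻¹ - 1) * P.tilt w j (w.y j)
        ≤ ∑ j, ((P.prob j)⁻¹ - 1) * P.tilt w j ((P.inner γ s z d (k + 1)).yc j) := by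
      refine Finset.sum_le_sum fun j _ => mul_le_mul_of_nonneg_left
        (H.saddle.tilt_le (P.domY_yc H.saddle H.s_pos γ hz d k j)) ?_
      exact sub_nonneg.2 ((one_le_inv₀ (P.prob_pos j)).2 (P.prob_le_one j))
    have h10 := mul_le_mul_of_nonneg_left h9 P.pmin_pos.le
    rw [lyap]
    linarith
  rw [pathExp_const] at h7
  simp only [mul_sub, Finset.sum_sub_distrib] at h7 ⊢
  linarith

lemma pathExp_sq_sum_slopeX_le (H : P.Admissible γ s z w) (K : ℕ) (i : Fin n) :
    P.tau γ s i * P.pathExp K (fun d => (∑ t ∈ Finset.range K,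
        P.slopeX γ s (P.inner γ s z d t) (P.inner γ s z d (t + 1)) i) ^ 2)
      ≤ 2 * (16 / P.pmin + 4 / (1 - γ) + 56 * m * momentConst n γ) * P.Delta γ s z w := by
  have hτ := P.tau_pos H.γ_pos H.s_pos i
  have hη := P.eta_pos H.s_pos
  have hpm := P.pmin_pos
  have hp := P.p_pos i
  have hc : 0 ≤ momentConst n γ := by linarith [four_le_momentConst (n := n) H.γ_lt_one]
  have hΔ := P.Delta_nonneg H.γ_pos H.s_pos H.saddle H.dom
  have h1 := P.pathExp_sq_add_le K
    (fun d => ∑ t ∈ Finset.range K, P.pmin / P.tau γ s i * P.dx γ s (P.inner γ s z d t) i)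
    (fun d => P.pmin * ∑ j, P.A j i * ∑ t ∈ Finset.range K,
      (P.ybar s (P.inner γ s z d t) j - (P.inner γ s z d (t + 1)).yc j))
    (fun d => ∑ t ∈ Finset.range K,
      P.slopeX γ s (P.inner γ s z d t) (P.inner γ s z d (t + 1)) i) fun d => by
      simp only [slopeX, Finset.sum_add_distrib, ← Finset.mul_sum]
      congr 2
      rw [Finset.sum_comm]
      simp only [← Finset.mul_sum]
  have h2 : P.tau γ s i * P.pathExp K (fun d => (∑ t ∈ Finset.range K,
      P.pmin / P.tau γ s i * P.dx γ s (P.inner γ s z d t) i) ^ 2)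
      ≤ (16 / P.pmin + 4 / (1 - γ)) * P.Delta γ s z w := by
    have h3 : P.pathExp K (fun d => (∑ t ∈ Finset.range K,
        P.pmin / P.tau γ s i * P.dx γ s (P.inner γ s z d t) i) ^ 2)
        ≤ ((P.tau γ s i)⁻¹) ^ 2 * P.pathExp K (fun d =>
          (∑ t ∈ Finset.range K, P.p i * P.dx γ s (P.inner γ s z d t) i) ^ 2) := by
      rw [← pathExp_const_mul]
      refine P.pathExp_mono K fun d => ?_
      rw [← Finset.mul_sum, ← Finset.mul_sum, mul_pow, mul_pow, ← mul_assoc, div_eq_mul_inv,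
        mul_pow, mul_comm (P.pmin ^ 2)]
      have := P.pmin_le i
      gcongr
    have h4 := P.pathExp_sq_sum_dx_le H K i
    calc _ ≤ P.tau γ s i * (((P.tau γ s i)⁻¹) ^ 2 *
          ((16 / P.pmin + 4 / (1 - γ)) * P.tau γ s i * P.Delta γ s z w)) := by
          refine mul_le_mul_of_nonneg_left (h3.trans ?_) hτ.le
          gcongr
      _ = _ := by field_simp
  have h5 : P.tau γ s i * P.pathExp K (fun d => (P.pmin * ∑ j, P.A j i * ∑ t ∈ Finset.range K,
      (P.ybar s (P.inner γ s z d t) j - (P.inner γ s z d (t + 1)).yc j)) ^ 2)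
      ≤ 56 * m * momentConst n γ * P.Delta γ s z w := by
    have h6 : P.pathExp K (fun d => (P.pmin * ∑ j, P.A j i * ∑ t ∈ Finset.range K,
        (P.ybar s (P.inner γ s z d t) j - (P.inner γ s z d (t + 1)).yc j)) ^ 2)
        ≤ P.pmin ^ 2 * P.colNorm i ^ 2 * ∑ j, P.pathExp K (fun d => (∑ t ∈ Finset.range K,
        (P.ybar s (P.inner γ s z d t) j - (P.inner γ s z d (t + 1)).yc j)) ^ 2) := by
      rw [← pathExp_sum, ← pathExp_const_mul]
      refine P.pathExp_mono K fun d => ?_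
      rw [mul_pow, mul_assoc, P.colNorm_sq]
      refine mul_le_mul_of_nonneg_left ?_ (sq_nonneg _)
      exact Finset.sum_mul_sq_le_sq_mul_sq _ _ _
    have h7 := Finset.sum_le_sum fun j (_ : j ∈ Finset.univ) =>
      P.pathExp_sq_sum_ybar_sub_yc_le H K j
    rw [Finset.sum_const, Finset.card_univ, Fintype.card_fin, nsmul_eq_mul] at h7
    have h8 := P.tau_mul_eta_mul_colNorm_sq_le H.γ_pos H.γ_lt_one H.s_pos i
    calc _ ≤ P.tau γ s i * (P.pmin ^ 2 * P.colNorm i ^ 2 *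
          (m * (28 / P.pmin ^ 2 * momentConst n γ * P.eta s * P.Delta γ s z w))) := by
          refine mul_le_mul_of_nonneg_left (h6.trans ?_) hτ.le
          gcongr
      _ = 28 * m * momentConst n γ * P.Delta γ s z w
          * (P.tau γ s i * (P.eta s * P.colNorm i ^ 2)) := by field_simp
      _ ≤ 28 * m * momentConst n γ * P.Delta γ s z w * 2 := by gcongr
      _ = _ := by ring
  have h9 := mul_le_mul_of_nonneg_left h1 hτ.le
  refine h9.trans ?_
  linarith

lemma pathExp_sq_sum_slopeY_le (H : P.Admissible γ s z w) (K : ℕ) (j : Fin m) :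
    P.eta s * P.pathExp K (fun d => (∑ t ∈ Finset.range K,
        P.slopeY s (P.inner γ s z d t) (P.inner γ s z d (t + 1)) j) ^ 2)
      ≤ 2 * (36 + 80 * n ^ 2 / P.pmin) * P.Delta γ s z w := by
  have hη := P.eta_pos H.s_pos
  have hpm := P.pmin_pos
  have hΔ := P.Delta_nonneg H.γ_pos H.s_pos H.saddle H.dom
  have e : ∀ d, ∑ t ∈ Finset.range K, P.A.mulVec (fun i => (P.inner γ s z d (t + 1)).x i
      - (P.inner γ s z d t).x i) j = P.A.mulVec (fun i => (P.inner γ s z d K).x i - z.x i) j := by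
    intro d
    have h : ∀ x x' : Fin n → ℝ, P.A.mulVec (fun i => x i - x' i) j
        = P.A.mulVec x j - P.A.mulVec x' j := fun x x' => congrFun (Matrix.mulVec_sub P.A x x') j
    simp only [h]
    exact Finset.sum_range_sub (fun t => P.A.mulVec (P.inner γ s z d t).x j) K
  have h1 := P.pathExp_sq_add_le K
    (fun d => (P.eta s)⁻¹ * ∑ t ∈ Finset.range K, P.prob j * P.dy s (P.inner γ s z d t) j)
    (fun d => P.pmin * P.A.mulVec (fun i => (P.inner γ s z d K).x i - z.x i) j)
    (fun d => ∑ t ∈ Finset.range K,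
      P.slopeY s (P.inner γ s z d t) (P.inner γ s z d (t + 1)) j) fun d => by
      simp only [slopeY, Finset.sum_add_distrib, ← Finset.mul_sum, e]
      ring
  simp only [mul_pow] at h1
  rw [pathExp_const_mul, pathExp_const_mul] at h1
  have h2 := P.pathExp_sq_sum_dy_le H K j
  have h3 := P.pathExp_sq_mulVec_x_sub_start_le H K j
  have h4 : P.eta s * ((P.eta s)⁻¹ ^ 2 * P.pathExp K (fun d => (∑ t ∈ Finset.range K,
      P.prob j * P.dy s (P.inner γ s z d t) j) ^ 2))
      ≤ (36 + 64 * n ^ 2 / P.pmin) * P.Delta γ s z w := by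
    calc _ ≤ P.eta s * ((P.eta s)⁻¹ ^ 2 *
          ((36 + 64 * n ^ 2 / P.pmin) * P.eta s * P.Delta γ s z w)) := by gcongr
      _ = _ := by field_simp
  have h5 : P.pmin ^ 2 * (P.eta s * P.pathExp K (fun d =>
      P.A.mulVec (fun i => (P.inner γ s z d K).x i - z.x i) j ^ 2))
      ≤ 16 * n ^ 2 / P.pmin * P.Delta γ s z w := by
    refine le_trans (mul_le_of_le_one_left ?_ (pow_le_one₀ hpm.le P.pmin_le_one)) h3
    exact mul_nonneg hη.le (P.pathExp_nonneg K fun d => sq_nonneg _)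
  have h6 := mul_le_mul_of_nonneg_left h1 hη.le
  refine h6.trans ?_
  have e2 : 2 * (36 + 80 * n ^ 2 / P.pmin) * P.Delta γ s z w
      = 2 * ((36 + 64 * n ^ 2 / P.pmin) * P.Delta γ s z w)
        + 2 * (16 * n ^ 2 / P.pmin * P.Delta γ s z w) := by ring
  rw [e2]
  linarith

end Gap

section GapBound

variable {γ s : ℝ} {z w : Point n m}

/-! ### The tested gap within one inner loop -/

/-- A bound on `k p̲` times the tested gap after `k` iterations, obtained by maximizing
the linearized Lagrangian gap minus the quadratic smoothing terms. -/
def gapMajorant (γ c₁ c₂ s : ℝ) (z w : Point n m) (k : ℕ) (d : ℕ → Fin n) : ℝ :=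
  ∑ t ∈ Finset.range k, P.offset γ s w (P.inner γ s z d t) (P.inner γ s z d (t + 1))
    + ∑ i, ((1 / (2 * (P.pmin * c₁ * s)) + P.tau γ s i / 2) * (∑ t ∈ Finset.range k,
          P.slopeX γ s (P.inner γ s z d t) (P.inner γ s z d (t + 1)) i) ^ 2
        + 1 / (2 * P.tau γ s i) * ((P.average γ s z d k).x i - w.x i) ^ 2)
    + ∑ j, ((1 / (2 * (P.pmin * c₂ / s)) + P.eta s / 2) * (∑ t ∈ Finset.range k,
          P.slopeY s (P.inner γ s z d t) (P.inner γ s z d (t + 1)) j) ^ 2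
        + 1 / (2 * P.eta s) * ((P.average γ s z d k).y j - w.y j) ^ 2)

/-- A linear function of `a` minus a quadratic one. The completion of the square is split so that the
linear function may be centered at `c` and the quadratic one at `b`. -/
lemma linear_sub_sq_le {κ τ : ℝ} (hκ : 0 < κ) (hτ : 0 < τ) (u a b c : ℝ) :
    u * (a - c) - κ / 2 * (a - b) ^ 2
      ≤ (1 / (2 * κ) + τ / 2) * u ^ 2 + 1 / (2 * τ) * (b - c) ^ 2 := by
  have h1 : 0 ≤ (u - κ * (a - b)) ^ 2 / (2 * κ) := by positivity
  have h2 : 0 ≤ (τ * u - (b - c)) ^ 2 / (2 * τ) := by positivity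
  have e1 : (u - κ * (a - b)) ^ 2 / (2 * κ)
      = 1 / (2 * κ) * u ^ 2 - u * (a - b) + κ / 2 * (a - b) ^ 2 := by
    field_simp; ring
  have e2 : (τ * u - (b - c)) ^ 2 / (2 * τ)
      = τ / 2 * u ^ 2 - u * (b - c) + 1 / (2 * τ) * (b - c) ^ 2 := by
    field_simp; ring
  linarith

lemma domX_average (hγ : 0 < γ) (hs : 0 < s) (hz : P.DomX z.x) (d : ℕ → Fin n) {k : ℕ}
    (hk : 1 ≤ k) : P.DomX (P.average γ s z d k).x := by
  rw [average_x]
  exact (P.primal_average_le hk fun t _ => P.domX_inner hγ hs hz d (t + 1)).1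

lemma domY_average (hw : P.IsSaddle w) (hs : 0 < s) (γ : ℝ)
    (hz : ∀ j, P.prob j < 1 → conj (P.g j) (z.y j) ≠ ⊤) (d : ℕ → Fin n) {k : ℕ}
    (hk : 1 ≤ k) : P.DomY (P.average γ s z d k).y := by
  rw [average_y]
  exact (P.dual_average_le hw.domY hk fun t _ => P.domY_yc hw hs γ hz d t).1

lemma lagrangian_gap_le_gapMajorant (H : P.Admissible γ s z w)
    (hz : ∀ j, P.prob j < 1 → conj (P.g j) (z.y j) ≠ ⊤) {c₁ c₂ : ℝ} (hc₁ : 0 < c₁) (hc₂ : 0 < c₂)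
    {k : ℕ} (hk : 1 ≤ k) (d : ℕ → Fin n) {x' : Fin n → ℝ} {y' : Fin m → ℝ} (hx' : P.DomX x')
    (hy' : P.DomY y') :
    k * P.pmin * ((P.primal (P.average γ s z d k).x).toReal
        + (P.dual (P.average γ s z d k).y).toReal
        + (P.coupling (P.average γ s z d k).x y' - P.coupling x' (P.average γ s z d k).y
          - c₁ * s / k / 2 * ∑ i, (x' i - (P.average γ s z d k).x i) ^ 2
          - c₂ / (k * s) / 2 * ∑ j, (y' j - (P.average γ s z d k).y j) ^ 2)
        - ((P.primal x').toReal + (P.dual y').toReal))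
      ≤ P.gapMajorant γ c₁ c₂ s z w k d := by
  have hk0 : (0 : ℝ) < k := by exact_mod_cast hk
  have hs := H.s_pos
  have hpm := P.pmin_pos
  have h1 := Finset.sum_le_sum fun t (_ : t ∈ Finset.range k) =>
    P.transition_le (w := w) H.γ_pos H.γ_lt_one H.s_pos (P.domX_inner H.γ_pos H.s_pos H.dom d t)
      (P.domY_yc H.saddle H.s_pos γ hz d t) (q' := P.inner γ s z d (t + 1)) hx' hy'
  rw [← Finset.mul_sum, Finset.sum_add_distrib, Finset.sum_add_distrib,
    Finset.sum_comm (t := (Finset.univ : Finset (Fin n))),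
    Finset.sum_comm (t := (Finset.univ : Finset (Fin m)))] at h1
  simp only [← Finset.sum_mul] at h1
  have h2 := (P.primal_average_le hk (u := fun t => (P.inner γ s z d (t + 1)).x)
    fun t _ => P.domX_inner H.γ_pos H.s_pos H.dom d (t + 1)).2
  have h3 := (P.dual_average_le H.saddle.domY hk (u := fun t => (P.inner γ s z d (t + 1)).yc)
    fun t _ => P.domY_yc H.saddle H.s_pos γ hz d t).2
  rw [← average_x] at h2
  rw [← average_y] at h3
  have h4 : ∑ t ∈ Finset.range k, P.coupling (P.inner γ s z d (t + 1)).x y'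
      = k * P.coupling (P.average γ s z d k).x y' := by
    simp only [coupling_eq, average_x, Pi.smul_apply, Finset.sum_apply, smul_eq_mul]
    rw [Finset.sum_comm, Finset.mul_sum]
    refine Finset.sum_congr rfl fun i _ => ?_
    rw [← Finset.sum_mul]
    field_simp
  have h5 : ∑ t ∈ Finset.range k, P.coupling x' (P.inner γ s z d (t + 1)).yc
      = k * P.coupling x' (P.average γ s z d k).y := by
    simp only [coupling, average_y, Pi.smul_apply, Finset.sum_apply, smul_eq_mul]
    rw [Finset.sum_comm, Finset.mul_sum]
    refine Finset.sum_congr rfl fun i _ => ?_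
    rw [← Finset.mul_sum]
    field_simp
  simp only [Finset.sum_sub_distrib, Finset.sum_add_distrib, Finset.sum_const, Finset.card_range,
    nsmul_eq_mul, h4, h5] at h1
  have h6 := Finset.sum_le_sum fun i (_ : i ∈ Finset.univ) =>
    linear_sub_sq_le (show 0 < P.pmin * c₁ * s by positivity) (P.tau_pos H.γ_pos H.s_pos i)
      (∑ t ∈ Finset.range k, P.slopeX γ s (P.inner γ s z d t) (P.inner γ s z d (t + 1)) i)
      (x' i) ((P.average γ s z d k).x i) (w.x i)
  have h7 := Finset.sum_le_sum fun j (_ : j ∈ Finset.univ) =>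
    linear_sub_sq_le (show 0 < P.pmin * c₂ / s by positivity) (P.eta_pos H.s_pos)
      (∑ t ∈ Finset.range k, P.slopeY s (P.inner γ s z d t) (P.inner γ s z d (t + 1)) j)
      (y' j) ((P.average γ s z d k).y j) (w.y j)
  rw [Finset.sum_sub_distrib, ← Finset.mul_sum] at h6 h7
  rw [gapMajorant]
  have e : k * P.pmin * ((P.primal (P.average γ s z d k).x).toReal
        + (P.dual (P.average γ s z d k).y).toReal
        + (P.coupling (P.average γ s z d k).x y' - P.coupling x' (P.average γ s z d k).y
          - c₁ * s / k / 2 * ∑ i, (x' i - (P.average γ s z d k).x i) ^ 2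
          - c₂ / (k * s) / 2 * ∑ j, (y' j - (P.average γ s z d k).y j) ^ 2)
        - ((P.primal x').toReal + (P.dual y').toReal))
      = P.pmin * (k * (P.primal (P.average γ s z d k).x).toReal
          + k * P.coupling (P.average γ s z d k).x y' - k * (P.dual y').toReal
          - (k * (P.primal x').toReal + k * P.coupling x' (P.average γ s z d k).y
            - k * (P.dual (P.average γ s z d k).y).toReal))
        - P.pmin * c₁ * s / 2 * ∑ i, (x' i - (P.average γ s z d k).x i) ^ 2
        - P.pmin * c₂ / s / 2 * ∑ j, (y' j - (P.average γ s z d k).y j) ^ 2 := by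
    field_simp
    ring
  rw [e]
  have h8 : P.pmin * (k * (P.primal (P.average γ s z d k).x).toReal
          + k * P.coupling (P.average γ s z d k).x y' - k * (P.dual y').toReal
          - (k * (P.primal x').toReal + k * P.coupling x' (P.average γ s z d k).y
            - k * (P.dual (P.average γ s z d k).y).toReal))
      ≤ _ := le_trans (mul_le_mul_of_nonneg_left (by linarith) hpm.le) h1
  linarith

lemma gapMajorant_nonneg (H : P.Admissible γ s z w)
    (hz : ∀ j, P.prob j < 1 → conj (P.g j) (z.y j) ≠ ⊤) {c₁ c₂ : ℝ} (hc₁ : 0 < c₁) (hc₂ : 0 < c₂)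
    {k : ℕ} (hk : 1 ≤ k) (d : ℕ → Fin n) : 0 ≤ P.gapMajorant γ c₁ c₂ s z w k d := by
  -- comparison with the averaged iterate itself
  have h := P.lagrangian_gap_le_gapMajorant H hz hc₁ hc₂ hk d
    (P.domX_average H.γ_pos H.s_pos H.dom d hk) (P.domY_average H.saddle H.s_pos γ hz d hk)
  simpa using h

lemma testGap_le (H : P.Admissible γ s z w)
    (hz : ∀ j, P.prob j < 1 → conj (P.g j) (z.y j) ≠ ⊤) {c₁ c₂ : ℝ} (hc₁ : 0 < c₁) (hc₂ : 0 < c₂)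
    {k : ℕ} (hk : 1 ≤ k) (d : ℕ → Fin n) :
    P.testGap γ c₁ c₂ s z d k
      ≤ ((P.gapMajorant γ c₁ c₂ s z w k d / (k * P.pmin) : ℝ) : EReal) := by
  have hk0 : (0 : ℝ) < k := by exact_mod_cast hk
  have hpm := P.pmin_pos
  refine iSup_le fun x' => iSup_le fun y' => ?_
  rw [← P.coe_toReal_primal (P.domX_average H.γ_pos H.s_pos H.dom d hk),
    ← P.coe_toReal_dual (P.domY_average H.saddle H.s_pos γ hz d hk)]
  by_cases hx : P.primal x' = ⊤
  · rw [hx, EReal.top_add_of_ne_bot (P.dual_ne_bot y'), EReal.sub_top]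
    exact bot_le
  by_cases hy : P.dual y' = ⊤
  · rw [hy, EReal.add_top_of_ne_bot (P.primal_ne_bot x'), EReal.sub_top]
    exact bot_le
  have hx' := P.domX_of_primal_ne_top hx
  have hy' := P.domY_of_dual_ne_top hy
  rw [← P.coe_toReal_primal hx', ← P.coe_toReal_dual hy']
  have h := P.lagrangian_gap_le_gapMajorant H hz hc₁ hc₂ hk d hx' hy'
  simp only [← EReal.coe_add, ← EReal.coe_sub]
  rw [EReal.coe_le_coe_iff, le_div_iff₀ (by positivity), mul_comm]
  exact h

lemma inv_mul_tau_le (hγ : 0 < γ) (hs : 0 < s) (i : Fin n) :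
    1 / (s * P.tau γ s i) ≤ (P.Lip i + P.colNorm i ^ 2 / P.maxCol) / γ * (1 + s + 1 / s) := by
  have hτ := P.tau_pos hγ hs i
  have h1 := P.tau_mul_denom (γ := γ) hs i
  have h2 := P.one_le_two_sub i
  have hL := P.Lip_nonneg i
  have ha := P.maxCol_pos
  rw [eta] at h1
  have h3 : γ ≤ P.tau γ s i * (P.Lip i + s / P.maxCol * P.colNorm i ^ 2) := by
    rw [h1]; nlinarith
  rw [div_le_iff₀ (by positivity)]
  have h4 : P.Lip i + s / P.maxCol * P.colNorm i ^ 2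
      ≤ (P.Lip i + P.colNorm i ^ 2 / P.maxCol) * (1 + s + 1 / s) * s := by
    have e : (P.Lip i + P.colNorm i ^ 2 / P.maxCol) * (1 + s + 1 / s) * s
        = (P.Lip i + P.colNorm i ^ 2 / P.maxCol) * (s + s ^ 2 + 1) := by
      field_simp
    have h5 : 0 ≤ P.colNorm i ^ 2 / P.maxCol := by positivity
    have e2 : s / P.maxCol * P.colNorm i ^ 2 = P.colNorm i ^ 2 / P.maxCol * s := by ring
    rw [e, e2]
    nlinarith [mul_nonneg hL hs.le, mul_nonneg hL (sq_nonneg s), mul_nonneg h5 (sq_nonneg s)]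
  calc (1 : ℝ) = γ / γ := by field_simp
    _ ≤ P.tau γ s i * (P.Lip i + s / P.maxCol * P.colNorm i ^ 2) / γ := by gcongr
    _ ≤ P.tau γ s i * ((P.Lip i + P.colNorm i ^ 2 / P.maxCol) * (1 + s + 1 / s) * s) / γ := by
      gcongr
    _ = _ := by ring

lemma sq_mean_le {k : ℕ} (hk : 1 ≤ k) (u : ℕ → ℝ) (c : ℝ) :
    ((∑ t ∈ Finset.range k, u t) / k - c) ^ 2
      ≤ (k : ℝ)⁻¹ * ∑ t ∈ Finset.range k, (u t - c) ^ 2 := by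
  have hk0 : (0 : ℝ) < k := by exact_mod_cast hk
  have h := sq_sum_le_card_mul_sum_sq (s := Finset.range k) (f := fun t => u t - c)
  rw [Finset.sum_sub_distrib, Finset.sum_const, Finset.card_range, nsmul_eq_mul] at h
  have e : (∑ t ∈ Finset.range k, u t) / k - c = (∑ t ∈ Finset.range k, u t - k * c) / k := by
    field_simp
  rw [e, div_pow, div_le_iff₀ (by positivity)]
  refine h.trans (le_of_eq ?_)
  field_simp

lemma pathExp_sq_average_x_le (H : P.Admissible γ s z w) {k : ℕ} (hk : 1 ≤ k) (i : Fin n) :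
    P.pathExp k (fun d => ((P.average γ s z d k).x i - w.x i) ^ 2)
      ≤ 2 / P.pmin * P.tau γ s i * P.Delta γ s z w := by
  have hk0 : (0 : ℝ) < k := by exact_mod_cast hk
  have h1 := P.pathExp_mono k fun d =>
    sq_mean_le hk (fun t => (P.inner γ s z d (t + 1)).x i) (w.x i)
  rw [pathExp_const_mul, pathExp_sum] at h1
  have h2 := Finset.sum_le_sum fun t (ht : t ∈ Finset.range k) =>
    P.pathExp_sq_x_le H (show t + 1 ≤ k from Finset.mem_range.1 ht) i
  rw [Finset.sum_const, Finset.card_range, nsmul_eq_mul] at h2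
  have h3 := mul_le_mul_of_nonneg_left h2 (inv_nonneg.2 hk0.le)
  rw [inv_mul_cancel_left₀ hk0.ne'] at h3
  simp only [average, sum_Icc_eq_sum_range]
  exact h1.trans h3

lemma pathExp_sq_average_y_le (H : P.Admissible γ s z w) {k : ℕ} (hk : 1 ≤ k) (j : Fin m) :
    P.pathExp k (fun d => ((P.average γ s z d k).y j - w.y j) ^ 2)
      ≤ momentConst n γ * P.eta s * P.Delta γ s z w := by
  have hk0 : (0 : ℝ) < k := by exact_mod_cast hk
  have h1 := P.pathExp_mono k fun d =>
    sq_mean_le hk (fun t => (P.inner γ s z d (t + 1)).yc j) (w.y j)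
  rw [pathExp_const_mul, pathExp_sum] at h1
  have h2 := Finset.sum_le_sum fun t (ht : t ∈ Finset.range k) =>
    P.pathExp_sq_yc_le H (show t + 1 ≤ k from Finset.mem_range.1 ht) j
  rw [Finset.sum_const, Finset.card_range, nsmul_eq_mul] at h2
  have h3 := mul_le_mul_of_nonneg_left h2 (inv_nonneg.2 hk0.le)
  rw [inv_mul_cancel_left₀ hk0.ne'] at h3
  simp only [average, sum_Icc_eq_sum_range]
  exact h1.trans h3

/-- The expectation of the majorant is bounded independently of the number of iterations. The
dependence on the step size parameter is through the factor `1 + s + s⁻¹` only. -/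
lemma exists_pathExp_gapMajorant_le (hγ : 0 < γ) (hγ' : γ < 1) {c₁ c₂ : ℝ} (hc₁ : 0 < c₁)
    (hc₂ : 0 < c₂) : ∃ C : ℝ, 0 < C ∧ ∀ (s : ℝ) (z w : Point n m), P.Admissible γ s z w →
      (∀ j, P.prob j < 1 → conj (P.g j) (z.y j) ≠ ⊤) → ∀ k, 1 ≤ k →
      P.pathExp k (P.gapMajorant γ c₁ c₂ s z w k) ≤ C * (1 + s + 1 / s) * P.Delta γ s z w
        + P.pmin * ∑ j, ((P.prob j)⁻¹ - 1) * (P.tilt w j (z.y j) - P.tilt w j (w.y j)) := by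
  have hpm := P.pmin_pos
  have ha := P.maxCol_pos
  have hg : 0 < 1 - γ := by linarith
  set c₀ := momentConst n γ with hc₀
  have hc₀' : 0 ≤ c₀ := by linarith [four_le_momentConst (n := n) hγ']
  set cX : ℝ := 2 * (16 / P.pmin + 4 / (1 - γ) + 56 * m * c₀) with hcX
  set cY : ℝ := 2 * (36 + 80 * n ^ 2 / P.pmin) with hcY
  have hcX0 : 0 ≤ cX := by positivity
  have hcY0 : 0 ≤ cY := by positivity
  set CX : Fin n → ℝ := fun i =>
    ((P.Lip i + P.colNorm i ^ 2 / P.maxCol) / γ / (2 * (P.pmin * c₁)) + 1 / 2) * cX + 1 / P.pmin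
    with hCX
  set CY : ℝ := (P.maxCol / (2 * (P.pmin * c₂)) + 1 / 2) * cY + c₀ / 2 with hCY
  have hCX0 : ∀ i, 0 ≤ CX i := fun i => by
    have := P.Lip_nonneg i
    positivity
  have hCY0 : 0 ≤ CY := by positivity
  refine ⟨1 + ∑ i, CX i + m * CY, ?_, ?_⟩
  · have := Finset.sum_nonneg fun i (_ : i ∈ Finset.univ) => hCX0 i
    positivity
  intro s z w H hz k hk
  have hs := H.s_pos
  have hη := P.eta_pos hs
  have hΔ := P.Delta_nonneg H.γ_pos H.s_pos H.saddle H.dom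
  set Δ := P.Delta γ s z w with hΔdef
  set κ : ℝ := 1 + s + 1 / s with hκ
  have hκ1 : 1 ≤ κ := by
    have : 0 ≤ 1 / s := by positivity
    linarith
  have e : P.gapMajorant γ c₁ c₂ s z w k = fun d =>
      ∑ t ∈ Finset.range k, P.offset γ s w (P.inner γ s z d t) (P.inner γ s z d (t + 1))
    + ∑ i, ((1 / (2 * (P.pmin * c₁ * s)) + P.tau γ s i / 2) * (∑ t ∈ Finset.range k,
          P.slopeX γ s (P.inner γ s z d t) (P.inner γ s z d (t + 1)) i) ^ 2
        + 1 / (2 * P.tau γ s i) * ((P.average γ s z d k).x i - w.x i) ^ 2)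
    + ∑ j, ((1 / (2 * (P.pmin * c₂ / s)) + P.eta s / 2) * (∑ t ∈ Finset.range k,
          P.slopeY s (P.inner γ s z d t) (P.inner γ s z d (t + 1)) j) ^ 2
        + 1 / (2 * P.eta s) * ((P.average γ s z d k).y j - w.y j) ^ 2) := rfl
  rw [e]
  simp only [pathExp_add, pathExp_sum, pathExp_const_mul]
  have h0 := P.sum_pathExp_offset_le H hz hk
  have hX : ∀ i ∈ Finset.univ, (1 / (2 * (P.pmin * c₁ * s)) + P.tau γ s i / 2)
        * P.pathExp k (fun d => (∑ t ∈ Finset.range k,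
          P.slopeX γ s (P.inner γ s z d t) (P.inner γ s z d (t + 1)) i) ^ 2)
        + 1 / (2 * P.tau γ s i) * P.pathExp k (fun d => ((P.average γ s z d k).x i - w.x i) ^ 2)
      ≤ CX i * (κ * Δ) := by
    intro i _
    have hτ := P.tau_pos hγ hs i
    have h1 := P.pathExp_sq_sum_slopeX_le H k i
    rw [mul_comm, ← le_div_iff₀ hτ] at h1
    have h2 := P.pathExp_sq_average_x_le H hk i
    have h3 := P.inv_mul_tau_le hγ hs i
    have hL := P.Lip_nonneg i
    calc _ ≤ (1 / (2 * (P.pmin * c₁ * s)) + P.tau γ s i / 2) * (cX * Δ / P.tau γ s i)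
          + 1 / (2 * P.tau γ s i) * (2 / P.pmin * P.tau γ s i * Δ) := by gcongr
      _ = (1 / (s * P.tau γ s i) / (2 * (P.pmin * c₁)) + 1 / 2 * 1) * cX * Δ
          + 1 / P.pmin * (1 * Δ) := by field_simp
      _ ≤ ((P.Lip i + P.colNorm i ^ 2 / P.maxCol) / γ * κ / (2 * (P.pmin * c₁))
          + 1 / 2 * κ) * cX * Δ + 1 / P.pmin * (κ * Δ) := by gcongr
      _ = _ := by rw [hCX]; ring
  have hY : ∀ j ∈ Finset.univ, (1 / (2 * (P.pmin * c₂ / s)) + P.eta s / 2)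
        * P.pathExp k (fun d => (∑ t ∈ Finset.range k,
          P.slopeY s (P.inner γ s z d t) (P.inner γ s z d (t + 1)) j) ^ 2)
        + 1 / (2 * P.eta s) * P.pathExp k (fun d => ((P.average γ s z d k).y j - w.y j) ^ 2)
      ≤ CY * (κ * Δ) := by
    intro j _
    have h1 := P.pathExp_sq_sum_slopeY_le H k j
    rw [mul_comm, ← le_div_iff₀ hη] at h1
    have h2 := P.pathExp_sq_average_y_le H hk j
    calc _ ≤ (1 / (2 * (P.pmin * c₂ / s)) + P.eta s / 2) * (cY * Δ / P.eta s)
          + 1 / (2 * P.eta s) * (c₀ * P.eta s * Δ) := by gcongr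
      _ = CY * (1 * Δ) := by rw [hCY, eta]; field_simp
      _ ≤ _ := by gcongr
  have hX' := Finset.sum_le_sum hX
  have hY' := Finset.sum_le_sum hY
  rw [← Finset.sum_mul] at hX'
  rw [Finset.sum_const, Finset.card_univ, Fintype.card_fin, nsmul_eq_mul] at hY'
  have h1 : Δ ≤ κ * Δ := le_mul_of_one_le_left hΔ hκ1
  have e2 : (1 + ∑ i, CX i + m * CY) * κ * Δ
      = κ * Δ + (∑ i, CX i) * (κ * Δ) + m * (CY * (κ * Δ)) := by ring
  rw [e2]
  linarith

end GapBound

section Tail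

variable {γ s : ℝ} {z w : Point n m}

/-! ### Tail of the tested gap and stopping -/

lemma dependsOn_testGap (γ c₁ c₂ s : ℝ) (z : Point n m) (k : ℕ) :
    DependsOn (fun d => P.testGap γ c₁ c₂ s z d k) (Set.Iio k) := by
  intro d d' hd
  have h : P.average γ s z d k = P.average γ s z d' k := by
    have h1 : ∀ k' ∈ Finset.Icc 1 k, P.inner γ s z d k' = P.inner γ s z d' k' := fun k' hk' =>
      ((P.dependsOn_inner γ s z k').mono_Iio (Finset.mem_Icc.1 hk').2) hd
    simp only [average]
    congr 1
    · funext i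
      rw [Finset.sum_congr rfl fun k' hk' => by rw [h1 k' hk']]
    · funext j
      rw [Finset.sum_congr rfl fun k' hk' => by rw [h1 k' hk']]
  simp only [testGap, h]

lemma sum_tilt_sub_le (H : P.Admissible γ s z w) {M : ℝ}
    (hM : ∑ j, ((P.prob j)⁻¹ - 1) * (conj (P.g j) (z.y j)).toReal ≤ M) :
    ∑ j, ((P.prob j)⁻¹ - 1) * (P.tilt w j (z.y j) - P.tilt w j (w.y j))
      ≤ |M| + ∑ j, |((P.prob j)⁻¹ - 1) * (conj (P.g j) (w.y j)).toReal|
        + ∑ j, (((P.prob j)⁻¹ - 1) * P.A.mulVec w.x j) ^ 2 / 2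
        + 1 / P.maxCol * (1 + s + 1 / s) * P.Delta γ s z w := by
  have hs := H.s_pos
  have ha := P.maxCol_pos
  have hΔ := P.Delta_nonneg H.γ_pos H.s_pos H.saddle H.dom
  have h1 : ∀ j ∈ Finset.univ, ((P.prob j)⁻¹ - 1) * (P.tilt w j (z.y j) - P.tilt w j (w.y j))
      ≤ ((P.prob j)⁻¹ - 1) * (conj (P.g j) (z.y j)).toReal
        + |((P.prob j)⁻¹ - 1) * (conj (P.g j) (w.y j)).toReal|
        + (((P.prob j)⁻¹ - 1) * P.A.mulVec w.x j) ^ 2 / 2 + 2⁻¹ * (z.y j - w.y j) ^ 2 := by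
    intro j _
    have h2 := neg_abs_le (((P.prob j)⁻¹ - 1) * (conj (P.g j) (w.y j)).toReal)
    rw [tilt, tilt]
    nlinarith [sq_nonneg (((P.prob j)⁻¹ - 1) * P.A.mulVec w.x j + (z.y j - w.y j))]
  have h2 := Finset.sum_le_sum h1
  simp only [Finset.sum_add_distrib, ← Finset.mul_sum] at h2
  have h3 := P.sq_sub_y_le_quad H.γ_pos H.s_pos z.x z.y w
  have h4 : P.eta s * P.quad γ s z.x z.y w ≤ 1 / P.maxCol * (1 + s + 1 / s) * P.Delta γ s z w := by
    have h5 := P.quad_le_Delta (γ := γ) (s := s) H.saddle H.dom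
    have h6 : P.eta s ≤ 1 / P.maxCol * (1 + s + 1 / s) := by
      rw [eta, div_eq_mul_one_div, mul_comm]
      have : 0 < 1 / s := by positivity
      gcongr
      linarith
    have h7 := P.eta_pos hs
    calc _ ≤ P.eta s * P.Delta γ s z w := by gcongr
      _ ≤ _ := by gcongr
  have h8 := le_abs_self M
  linarith

/-- Markov's inequality for the tested gap after a fixed number of iterations. -/
lemma exists_tail_bound (hγ : 0 < γ) (hγ' : γ < 1) {c₁ c₂ : ℝ} (hc₁ : 0 < c₁)
    (hc₂ : 0 < c₂) : ∃ C : ℝ, 0 < C ∧ ∀ (w : Point n m) (M : ℝ), ∃ B : ℝ, 0 < B ∧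
      ∀ (s : ℝ) (z : Point n m), P.Admissible γ s z w →
      (∀ j, P.prob j < 1 → conj (P.g j) (z.y j) ≠ ⊤) →
      ∑ j, ((P.prob j)⁻¹ - 1) * (conj (P.g j) (z.y j)).toReal ≤ M → ∀ k, 1 ≤ k → ∀ θ : ℝ, 0 < θ →
      P.pathExp k ({d | (θ : EReal) < P.testGap γ c₁ c₂ s z d k}.indicator fun _ => 1)
        ≤ (B + C * (1 + s + 1 / s) * P.Delta γ s z w) / (k * θ) := by
  obtain ⟨C, hC, hbound⟩ := P.exists_pathExp_gapMajorant_le hγ hγ' hc₁ hc₂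
  have hpm := P.pmin_pos
  have ha := P.maxCol_pos
  refine ⟨C / P.pmin + 1 / P.maxCol, by positivity, fun w M => ⟨|M|
    + ∑ j, |((P.prob j)⁻¹ - 1) * (conj (P.g j) (w.y j)).toReal|
    + ∑ j, (((P.prob j)⁻¹ - 1) * P.A.mulVec w.x j) ^ 2 / 2 + 1, by positivity, ?_⟩⟩
  intro s z H hz hM k hk θ hθ
  have hk0 : (0 : ℝ) < k := by exact_mod_cast hk
  have h1 : P.pathExp k ({d | (θ : EReal) < P.testGap γ c₁ c₂ s z d k}.indicator fun _ => 1)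
      ≤ P.pathExp k (fun d => 1 / (k * P.pmin * θ) * P.gapMajorant γ c₁ c₂ s z w k d) := by
    refine P.pathExp_mono k fun d => ?_
    have h0 := P.gapMajorant_nonneg H hz hc₁ hc₂ hk d
    refine Set.indicator_le' (s := {d | (θ : EReal) < P.testGap γ c₁ c₂ s z d k})
      (g := fun d => 1 / (k * P.pmin * θ) * P.gapMajorant γ c₁ c₂ s z w k d)
      (fun d hd => ?_) (fun d _ => ?_) d
    · have h2 : (θ : EReal) < _ := lt_of_lt_of_le hd (P.testGap_le H hz hc₁ hc₂ hk d)
      rw [EReal.coe_lt_coe_iff, lt_div_iff₀ (by positivity)] at h2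
      rw [div_mul_eq_mul_div, one_mul, le_div_iff₀ (by positivity)]
      linarith
    · have := P.gapMajorant_nonneg H hz hc₁ hc₂ hk d
      positivity
  rw [pathExp_const_mul] at h1
  have h2 := hbound s z w H hz k hk
  have h3 := P.sum_tilt_sub_le H hM
  refine h1.trans ?_
  rw [div_mul_eq_mul_div, one_mul, div_le_div_iff₀ (by positivity) (by positivity)]
  have h4 := mul_le_mul_of_nonneg_left h3 hpm.le
  have h5 : P.pathExp k (P.gapMajorant γ c₁ c₂ s z w k) ≤ P.pmin * (|M|
    + ∑ j, |((P.prob j)⁻¹ - 1) * (conj (P.g j) (w.y j)).toReal|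
    + ∑ j, (((P.prob j)⁻¹ - 1) * P.A.mulVec w.x j) ^ 2 / 2 + 1
    + (C / P.pmin + 1 / P.maxCol) * (1 + s + 1 / s) * P.Delta γ s z w) := by
    have e : P.pmin * ((C / P.pmin + 1 / P.maxCol) * (1 + s + 1 / s) * P.Delta γ s z w)
        = C * (1 + s + 1 / s) * P.Delta γ s z w
          + P.pmin * (1 / P.maxCol * (1 + s + 1 / s) * P.Delta γ s z w) := by
      field_simp
    linarith
  calc _ ≤ _ := mul_le_mul_of_nonneg_right h5 (show 0 ≤ k * θ by positivity)
    _ = _ := by ring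

/-- The draws for which no tested gap up to the `k`-th iteration is at most `θ`. -/
def active (γ c₁ c₂ s θ : ℝ) (z : Point n m) (k : ℕ) : Set (ℕ → Fin n) :=
  {d | ∀ k', 1 ≤ k' → k' ≤ k → (θ : EReal) < P.testGap γ c₁ c₂ s z d k'}

lemma dependsOn_active (γ c₁ c₂ s θ : ℝ) (z : Point n m) (k : ℕ) :
    DependsOn (fun d => d ∈ P.active γ c₁ c₂ s θ z k) (Set.Iio k) := by
  intro d d' hd
  refine propext (forall_congr' fun k' => forall_congr' fun _ => forall_congr' fun hk' => ?_)
  rw [show P.testGap γ c₁ c₂ s z d k' = P.testGap γ c₁ c₂ s z d' k' from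
    ((P.dependsOn_testGap γ c₁ c₂ s z k').mono_Iio hk') hd]

lemma loopLength_eq_succ_iff (γ c₁ c₂ s θ : ℝ) (z : Point n m) (d : ℕ → Fin n) (k : ℕ) :
    P.loopLength γ c₁ c₂ s θ z d = k + 1 ↔
      d ∈ P.active γ c₁ c₂ s θ z k ∧ d ∉ P.active γ c₁ c₂ s θ z (k + 1) := by
  constructor
  · intro h
    have hne : {k : ℕ | 1 ≤ k ∧ P.testGap γ c₁ c₂ s z d k ≤ (θ : EReal)}.Nonempty :=
      Nat.nonempty_of_sInf_eq_succ h
    have hmem := Nat.sInf_mem hne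
    rw [loopLength] at h
    rw [h] at hmem
    refine ⟨fun k' hk' hk'' => ?_, fun hact => ?_⟩
    · by_contra hlt
      have := Nat.sInf_le (show k' ∈ {k : ℕ | 1 ≤ k ∧ P.testGap γ c₁ c₂ s z d k ≤ (θ : EReal)}
        from ⟨hk', not_lt.1 hlt⟩)
      omega
    · exact absurd (hact (k + 1) hmem.1 le_rfl) (not_lt.2 hmem.2)
  · rintro ⟨h1, h2⟩
    have h3 : P.testGap γ c₁ c₂ s z d (k + 1) ≤ (θ : EReal) := by
      by_contra hlt
      refine h2 fun k' hk' hk'' => ?_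
      rcases Nat.lt_or_ge k' (k + 1) with h | h
      · exact h1 k' hk' (by omega)
      · obtain rfl : k' = k + 1 := by omega
        exact not_le.1 hlt
    refine le_antisymm (Nat.sInf_le ⟨by omega, h3⟩) ?_
    refine le_csInf ⟨k + 1, by omega, h3⟩ fun b hb => ?_
    by_contra hlt
    exact absurd (h1 b hb.1 (by omega)) (not_lt.2 hb.2)

lemma active_succ_subset (γ c₁ c₂ s θ : ℝ) (z : Point n m) (k : ℕ) :
    P.active γ c₁ c₂ s θ z (k + 1) ⊆ P.active γ c₁ c₂ s θ z k :=
  fun _ hd k' hk' hk'' => hd k' hk' (by omega)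

lemma dependsOn_loopLength_eq (γ c₁ c₂ s θ : ℝ) (z : Point n m) (k : ℕ) :
    DependsOn (fun d => P.loopLength γ c₁ c₂ s θ z d = k + 1) (Set.Iio (k + 1)) := by
  simp only [loopLength_eq_succ_iff]
  exact ((P.dependsOn_active γ c₁ c₂ s θ z k).mono_Iio k.le_succ).comp_left₂
    (P.dependsOn_active γ c₁ c₂ s θ z (k + 1)) fun a b => a ∧ ¬b

lemma _root_.DependsOn.indicator {t : Set ℕ} {S : Set (ℕ → Fin n)} {H : (ℕ → Fin n) → ℝ}
    (hS : DependsOn (fun d => d ∈ S) t) (hH : DependsOn H t) : DependsOn (S.indicator H) t := by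
  intro d d' hd
  have h1 : d ∈ S ↔ d' ∈ S := iff_of_eq (hS hd)
  by_cases h : d ∈ S
  · rw [Set.indicator_of_mem h, Set.indicator_of_mem (h1.1 h), hH hd]
  · rw [Set.indicator_of_notMem h, Set.indicator_of_notMem (mt h1.2 h)]

/-- The weighted distance to a saddle point at the end of a loop that may stop at any time. -/
lemma sum_pathExp_stopped_le (H : P.Admissible γ s z w) (c₁ c₂ θ : ℝ) (N : ℕ) :
    ∑ k ∈ Finset.range N, P.pathExp (k + 1)
      ({d | P.loopLength γ c₁ c₂ s θ z d = k + 1}.indicator fun d =>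
        P.Delta γ s ⟨(P.inner γ s z d (k + 1)).x, (P.inner γ s z d (k + 1)).y⟩ w)
      ≤ P.Delta γ s z w := by
  set D : ℕ → (ℕ → Fin n) → ℝ := fun k d =>
    P.Delta γ s ⟨(P.inner γ s z d k).x, (P.inner γ s z d k).y⟩ w with hD
  have hD0 : ∀ k d, 0 ≤ D k d := fun k d =>
    P.Delta_nonneg H.γ_pos H.s_pos H.saddle (P.domX_inner H.γ_pos H.s_pos H.dom d k)
  have hDdep : ∀ k, DependsOn (D k) (Set.Iio k) := fun k =>
    (P.dependsOn_inner γ s z k).comp_left fun q => P.Delta γ s ⟨q.x, q.y⟩ w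
  -- the loops that have stopped and those still running are accounted for together
  suffices h : ∀ N, ∑ k ∈ Finset.range N, P.pathExp (k + 1)
      ({d | P.loopLength γ c₁ c₂ s θ z d = k + 1}.indicator (D (k + 1)))
      + P.pathExp N ((P.active γ c₁ c₂ s θ z N).indicator (D N)) ≤ P.Delta γ s z w by
    have h1 := P.pathExp_nonneg N (H := (P.active γ c₁ c₂ s θ z N).indicator (D N)) fun d =>
      Set.indicator_nonneg (fun d _ => hD0 N d) d
    linarith [h N]
  intro N
  induction N with
  | zero =>
    rw [Finset.range_zero, Finset.sum_empty, zero_add]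
    have e : (P.active γ c₁ c₂ s θ z 0).indicator (D 0) = fun _ => P.Delta γ s z w := by
      funext d
      rw [Set.indicator_of_mem]
      · rfl
      · intro k' h1 h2; omega
    rw [e, pathExp_const]
  | succ N ih =>
    rw [Finset.sum_range_succ, add_assoc, ← map_add]
    have e : {d | P.loopLength γ c₁ c₂ s θ z d = N + 1}.indicator (D (N + 1))
        + (P.active γ c₁ c₂ s θ z (N + 1)).indicator (D (N + 1))
        = fun d => (P.active γ c₁ c₂ s θ z N).indicator (fun _ => 1) d * D (N + 1) d := by
      funext d
      rw [Pi.add_apply]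
      have hiff := P.loopLength_eq_succ_iff γ c₁ c₂ s θ z d N
      have hsub := P.active_succ_subset γ c₁ c₂ s θ z N (a := d)
      by_cases h1 : d ∈ P.active γ c₁ c₂ s θ z N
      · by_cases h2 : d ∈ P.active γ c₁ c₂ s θ z (N + 1)
        · have h3 : ¬ P.loopLength γ c₁ c₂ s θ z d = N + 1 := fun h => (hiff.1 h).2 h2
          simp [Set.indicator, h1, h2, h3]
        · have h3 : P.loopLength γ c₁ c₂ s θ z d = N + 1 := hiff.2 ⟨h1, h2⟩
          simp [Set.indicator, h1, h2, h3]
      · have h2 : d ∉ P.active γ c₁ c₂ s θ z (N + 1) := fun h => h1 (hsub h)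
        have h3 : ¬ P.loopLength γ c₁ c₂ s θ z d = N + 1 := fun h => h1 (hiff.1 h).1
        simp [Set.indicator, h1, h2, h3]
    have hdep : DependsOn ((P.active γ c₁ c₂ s θ z N).indicator fun _ => (1 : ℝ)) (Set.Iio N) :=
      (P.dependsOn_active γ c₁ c₂ s θ z N).indicator fun _ _ _ => rfl
    rw [e, pathExp_succ]
    have h1 : P.pathExp N (P.resample N fun d =>
        (P.active γ c₁ c₂ s θ z N).indicator (fun _ => 1) d * D (N + 1) d)
        ≤ P.pathExp N ((P.active γ c₁ c₂ s θ z N).indicator (D N)) := by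
      refine P.pathExp_mono N fun d => ?_
      rw [P.resample_mul hdep, P.resample_inner γ s z N fun q => P.Delta γ s ⟨q.x, q.y⟩ w]
      by_cases hd : d ∈ P.active γ c₁ c₂ s θ z N
      · rw [Set.indicator_of_mem hd, Set.indicator_of_mem hd, one_mul]
        have h2 := P.sum_p_Delta_step H.γ_pos H.γ_lt_one H.s_pos
          (P.domX_inner H.γ_pos H.s_pos H.dom d N) H.saddle
        have h3 := P.diss_nonneg H.γ_pos H.γ_lt_one H.s_pos (P.inner γ s z d N)
        linarith
      · rw [Set.indicator_of_notMem hd, Set.indicator_of_notMem hd, zero_mul]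
    linarith

end Tail

/-! ### Measurability of the inner loop -/

section Measurability

variable {Ω : Type*} {mΩ : MeasurableSpace Ω}

lemma measurable_partialDeriv (i : Fin n) : Measurable fun x => partialDeriv P.f₂ x i :=
  measurable_fderiv_apply_const ℝ P.f₂ (Pi.single i 1)

lemma measurable_mulVec {a b : ℕ} (B : Matrix (Fin a) (Fin b) ℝ) {v : Ω → Fin b → ℝ}
    (hv : Measurable v) (j : Fin a) : Measurable fun ω => B.mulVec (v ω) j := by
  simp only [Matrix.mulVec, dotProduct]
  exact Finset.measurable_sum _ fun i _ => ((measurable_pi_apply i).comp hv).const_mul _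

variable {s : Ω → ℝ} {q : Ω → State n m}

lemma measurable_ybar (hg : ∀ j, IsClosedConvex (conj (P.g j))) (hs : Measurable s)
    (hs0 : ∀ ω, 0 < s ω) (hx : Measurable fun ω => (q ω).x) (hy : Measurable fun ω => (q ω).y)
    (j : Fin m) : Measurable fun ω => P.ybar (s ω) (q ω) j := by
  have hσ : Measurable fun ω => P.sigma (s ω) j := hs.div_const _
  exact (hg j).measurable_prox hσ
    (((measurable_pi_apply j).comp hy).add (hσ.mul (measurable_mulVec P.A hx j)))
    fun ω => P.sigma_pos (hs0 ω) j

lemma measurable_tau (γ : ℝ) (hs : Measurable s) (i : Fin n) :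
    Measurable fun ω => P.tau γ (s ω) i := by
  unfold tau
  fun_prop

lemma measurable_xbar (hg : ∀ j, IsClosedConvex (conj (P.g j))) {γ : ℝ} (hγ : 0 < γ)
    (hs : Measurable s) (hs0 : ∀ ω, 0 < s ω) (hx : Measurable fun ω => (q ω).x)
    (hy : Measurable fun ω => (q ω).y) (i : Fin n) :
    Measurable fun ω => P.xbar γ (s ω) (q ω) i := by
  have hτ := P.measurable_tau γ hs i
  have hyb : Measurable fun ω => P.ybar (s ω) (q ω) :=
    measurable_pi_lambda _ fun j => P.measurable_ybar hg hs hs0 hx hy j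
  exact (P.f_closed i).measurable_prox hτ
    (((measurable_pi_apply i).comp hx).sub (hτ.mul
      (((P.measurable_partialDeriv i).comp hx).add (measurable_mulVec _ hyb i))))
    fun ω => P.tau_pos hγ (hs0 ω) i

lemma measurable_step (hg : ∀ j, IsClosedConvex (conj (P.g j))) {γ : ℝ} (hγ : 0 < γ)
    (hs : Measurable s) (hs0 : ∀ ω, 0 < s ω) {i : Ω → Fin n} (hi : Measurable i)
    (hx : Measurable fun ω => (q ω).x) (hy : Measurable fun ω => (q ω).y)
    (hyc : Measurable fun ω => (q ω).yc) :
    (Measurable fun ω => (P.step γ (s ω) (i ω) (q ω)).x) ∧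
      (Measurable fun ω => (P.step γ (s ω) (i ω) (q ω)).y) ∧
      Measurable fun ω => (P.step γ (s ω) (i ω) (q ω)).yc := by
  have hA : ∀ j, MeasurableSet {ω | P.A j (i ω) ≠ 0} := fun j =>
    hi (Set.toFinite {k | P.A j k ≠ 0}).measurableSet
  have hx' : Measurable fun ω => Function.update (q ω).x (i ω) (P.xbar γ (s ω) (q ω) (i ω)) := by
    refine measurable_pi_lambda _ fun k => ?_
    simp only [Function.update_apply]
    have e : ∀ ω, (if k = i ω then P.xbar γ (s ω) (q ω) (i ω) else (q ω).x k)
        = if k = i ω then P.xbar γ (s ω) (q ω) k else (q ω).x k := fun ω => by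
      split_ifs with h
      · rw [h]
      · rfl
    simp only [e]
    exact Measurable.ite (hi (Set.toFinite {l | k = l}).measurableSet)
      (P.measurable_xbar hg hγ hs hs0 hx hy k) ((measurable_pi_apply k).comp hx)
  have hyb := P.measurable_ybar hg hs hs0 hx hy
  refine ⟨hx', measurable_pi_lambda _ fun j => ?_, measurable_pi_lambda _ fun j => ?_⟩
  · have hσ : Measurable fun ω => P.sigma (s ω) j := hs.div_const _
    exact Measurable.ite (hA j)
      ((hyb j).add ((hσ.mul_const _).mul (measurable_mulVec P.A (hx'.sub hx) j)))
      ((measurable_pi_apply j).comp hy)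
  · exact Measurable.ite (hA j) (hyb j) ((measurable_pi_apply j).comp hyc)

variable {z : Ω → Point n m} {d : Ω → ℕ → Fin n}

lemma measurable_inner (hg : ∀ j, IsClosedConvex (conj (P.g j))) {γ : ℝ} (hγ : 0 < γ)
    (hs : Measurable s) (hs0 : ∀ ω, 0 < s ω) (hd : Measurable d)
    (hx : Measurable fun ω => (z ω).x) (hy : Measurable fun ω => (z ω).y) (k : ℕ) :
    (Measurable fun ω => (P.inner γ (s ω) (z ω) (d ω) k).x) ∧
      (Measurable fun ω => (P.inner γ (s ω) (z ω) (d ω) k).y) ∧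
      Measurable fun ω => (P.inner γ (s ω) (z ω) (d ω) k).yc := by
  induction k with
  | zero => exact ⟨hx, hy, hy⟩
  | succ k ih =>
    exact P.measurable_step hg hγ hs hs0 ((measurable_pi_apply k).comp hd) ih.1 ih.2.1 ih.2.2

lemma measurable_average (hg : ∀ j, IsClosedConvex (conj (P.g j))) {γ : ℝ} (hγ : 0 < γ)
    (hs : Measurable s) (hs0 : ∀ ω, 0 < s ω) (hd : Measurable d)
    (hx : Measurable fun ω => (z ω).x) (hy : Measurable fun ω => (z ω).y) (k : ℕ) :
    (Measurable fun ω => (P.average γ (s ω) (z ω) (d ω) k).x) ∧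
      Measurable fun ω => (P.average γ (s ω) (z ω) (d ω) k).y := by
  have h := P.measurable_inner hg hγ hs hs0 hd hx hy
  exact ⟨measurable_pi_lambda _ fun i => (Finset.measurable_sum _ fun k' _ =>
      (measurable_pi_apply i).comp (h k').1).div_const _,
    measurable_pi_lambda _ fun j => (Finset.measurable_sum _ fun k' _ =>
      (measurable_pi_apply j).comp (h k').2.2).div_const _⟩

lemma lowerSemicontinuous_sum_coord {N : ℕ} {φ : Fin N → ℝ → EReal}
    (hφ : ∀ i, LowerSemicontinuous (φ i)) (hφ' : ∀ i u, φ i u ≠ ⊥) :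
    LowerSemicontinuous fun x : Fin N → ℝ => ∑ i, φ i (x i) := by
  suffices h : ∀ t : Finset (Fin N), LowerSemicontinuous (fun x : Fin N → ℝ => ∑ i ∈ t, φ i (x i))
      ∧ ∀ x : Fin N → ℝ, ∑ i ∈ t, φ i (x i) ≠ ⊥ from (h Finset.univ).1
  intro t
  induction t using Finset.induction_on with
  | empty => simpa using lowerSemicontinuous_const
  | insert a t ha ih =>
    simp only [Finset.sum_insert ha]
    refine ⟨LowerSemicontinuous.add' ((hφ a).comp (continuous_apply a)) ih.1 fun x => ?_,
      fun x => ?_⟩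
    · exact EReal.continuousAt_add (Or.inr (ih.2 x)) (Or.inl (hφ' a _))
    · exact EReal.add_ne_bot_iff.2 ⟨hφ' a _, ih.2 x⟩

lemma lowerSemicontinuous_primal : LowerSemicontinuous P.primal := by
  refine LowerSemicontinuous.add' (lowerSemicontinuous_sum_coord (fun i => (P.f_closed i).lsc)
    fun i u => (P.f_closed i).ne_bot u)
    (continuous_coe_real_ereal.comp P.f₂_diff.continuous).lowerSemicontinuous fun x => ?_
  exact EReal.continuousAt_add (Or.inr (EReal.coe_ne_bot _)) (Or.inr (EReal.coe_ne_top _))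

lemma lowerSemicontinuous_dual : LowerSemicontinuous P.dual :=
  lowerSemicontinuous_sum_coord (fun j => lowerSemicontinuous_conj (P.g_closed j))
    fun j v => conj_ne_bot (P.g_closed j) v

/-- The self-centered smoothed gap is lower semicontinuous in all its arguments, being a supremum of
lower semicontinuous functions. -/
lemma lowerSemicontinuous_gap : LowerSemicontinuous
    fun a : (ℝ × ℝ) × (Fin n → ℝ) × (Fin m → ℝ) =>
      P.gap a.1.1 a.1.2 ⟨a.2.1, a.2.2⟩ ⟨a.2.1, a.2.2⟩ := by
  simp only [gap]
  refine lowerSemicontinuous_iSup fun x' => lowerSemicontinuous_iSup fun y' => ?_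
  have h1 : LowerSemicontinuous fun a : (ℝ × ℝ) × (Fin n → ℝ) × (Fin m → ℝ) =>
      P.primal a.2.1 + P.dual a.2.2 :=
    LowerSemicontinuous.add'
      (P.lowerSemicontinuous_primal.comp (continuous_fst.comp continuous_snd))
      (P.lowerSemicontinuous_dual.comp (continuous_snd.comp continuous_snd)) fun a =>
      EReal.continuousAt_add (Or.inr (P.dual_ne_bot _)) (Or.inl (P.primal_ne_bot _))
  have hc : Continuous fun a : (ℝ × ℝ) × (Fin n → ℝ) × (Fin m → ℝ) =>
      P.coupling a.2.1 y' - P.coupling x' a.2.2 - a.1.1 / 2 * ∑ i, (x' i - a.2.1 i) ^ 2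
        - a.1.2 / 2 * ∑ j, (y' j - a.2.2 j) ^ 2 := by
    simp only [coupling, Matrix.mulVec, dotProduct]
    fun_prop
  have h2 := LowerSemicontinuous.add' h1
    (continuous_coe_real_ereal.comp hc).lowerSemicontinuous fun a =>
      EReal.continuousAt_add (Or.inr (EReal.coe_ne_bot _)) (Or.inr (EReal.coe_ne_top _))
  by_cases htop : P.primal x' + P.dual y' = ⊤
  · simpa only [htop, EReal.sub_top] using lowerSemicontinuous_const
  · have hbot : P.primal x' + P.dual y' ≠ ⊥ :=
      EReal.add_ne_bot_iff.2 ⟨P.primal_ne_bot _, P.dual_ne_bot _⟩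
    lift P.primal x' + P.dual y' to ℝ using ⟨htop, hbot⟩ with b hb
    refine LowerSemicontinuous.add' h2 lowerSemicontinuous_const fun a => ?_
    rw [← EReal.coe_neg]
    exact EReal.continuousAt_add (Or.inr (EReal.coe_ne_bot _)) (Or.inr (EReal.coe_ne_top _))

lemma measurable_testGap (hg : ∀ j, IsClosedConvex (conj (P.g j))) {γ : ℝ} (hγ : 0 < γ)
    (c₁ c₂ : ℝ) (hs : Measurable s) (hs0 : ∀ ω, 0 < s ω) (hd : Measurable d)
    (hx : Measurable fun ω => (z ω).x) (hy : Measurable fun ω => (z ω).y) (k : ℕ) :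
    Measurable fun ω => P.testGap γ c₁ c₂ (s ω) (z ω) (d ω) k := by
  have h := P.measurable_average hg hγ hs hs0 hd hx hy k
  have h1 : Measurable fun ω => ((c₁ * s ω / k, c₂ / (k * s ω)),
      (P.average γ (s ω) (z ω) (d ω) k).x, (P.average γ (s ω) (z ω) (d ω) k).y) :=
    (((hs.const_mul c₁).div_const (k : ℝ)).prodMk
      (measurable_const.div (hs.const_mul (k : ℝ)))).prodMk (h.1.prodMk h.2)
  have h2 := P.lowerSemicontinuous_gap.measurable.comp h1
  exact h2

lemma measurable_loopLength (hg : ∀ j, IsClosedConvex (conj (P.g j))) {γ : ℝ} (hγ : 0 < γ)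
    (c₁ c₂ : ℝ) (hs : Measurable s) (hs0 : ∀ ω, 0 < s ω) {θ : Ω → ℝ} (hθ : Measurable θ)
    (hd : Measurable d) (hx : Measurable fun ω => (z ω).x) (hy : Measurable fun ω => (z ω).y) :
    Measurable fun ω => P.loopLength γ c₁ c₂ (s ω) (θ ω) (z ω) (d ω) := by
  have hact : ∀ k, MeasurableSet {ω | d ω ∈ P.active γ c₁ c₂ (s ω) (θ ω) (z ω) k} := fun k => by
    have e : {ω | d ω ∈ P.active γ c₁ c₂ (s ω) (θ ω) (z ω) k} = ⋂ k' : ℕ, ⋂ _ : 1 ≤ k',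
        ⋂ _ : k' ≤ k, {ω | (θ ω : EReal) < P.testGap γ c₁ c₂ (s ω) (z ω) (d ω) k'} := by
      ext ω
      simp [active]
    rw [e]
    exact MeasurableSet.iInter fun k' => MeasurableSet.iInter fun _ => MeasurableSet.iInter fun _ =>
      measurableSet_lt hθ.coe_real_ereal (P.measurable_testGap hg hγ c₁ c₂ hs hs0 hd hx hy k')
  have hsucc : ∀ k, MeasurableSet
      {ω | P.loopLength γ c₁ c₂ (s ω) (θ ω) (z ω) (d ω) = k + 1} := fun k => by
    simp only [loopLength_eq_succ_iff]
    exact (hact k).inter (hact (k + 1)).compl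
  refine measurable_to_countable' fun k => ?_
  rcases k with _ | k
  · have e : (fun ω => P.loopLength γ c₁ c₂ (s ω) (θ ω) (z ω) (d ω)) ⁻¹' {0}
        = (⋃ k, {ω | P.loopLength γ c₁ c₂ (s ω) (θ ω) (z ω) (d ω) = k + 1})ᶜ := by
      ext ω
      simp only [Set.mem_preimage, Set.mem_singleton_iff, Set.mem_compl_iff, Set.mem_iUnion,
        Set.mem_ofPred_eq, not_exists]
      exact ⟨fun h k => by omega, fun h => by_contra fun h' => h (_ - 1)
        (Nat.succ_pred_eq_of_ne_zero h').symm⟩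
    rw [e]
    exact (MeasurableSet.iUnion hsucc).compl
  · exact hsucc k

/-- The state at a random measurable time. -/
lemma measurable_inner_index (hg : ∀ j, IsClosedConvex (conj (P.g j))) {γ : ℝ} (hγ : 0 < γ)
    (hs : Measurable s) (hs0 : ∀ ω, 0 < s ω) (hd : Measurable d)
    (hx : Measurable fun ω => (z ω).x) (hy : Measurable fun ω => (z ω).y) {K : Ω → ℕ}
    (hK : Measurable K) :
    (Measurable fun ω => (P.inner γ (s ω) (z ω) (d ω) (K ω)).x) ∧
      Measurable fun ω => (P.inner γ (s ω) (z ω) (d ω) (K ω)).y := by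
  have h := P.measurable_inner hg hγ hs hs0 hd hx hy
  have h1 : Measurable fun a : Ω × ℕ => (P.inner γ (s a.1) (z a.1) (d a.1) a.2).x :=
    measurable_from_prod_countable_left fun k => (h k).1
  have h2 : Measurable fun a : Ω × ℕ => (P.inner γ (s a.1) (z a.1) (d a.1) a.2).y :=
    measurable_from_prod_countable_left fun k => (h k).2.1
  exact ⟨h1.comp (measurable_id.prodMk hK), h2.comp (measurable_id.prodMk hK)⟩

lemma measurable_Delta (γ : ℝ) (w : Point n m) (hs : Measurable s)
    (hx : Measurable fun ω => (z ω).x) (hy : Measurable fun ω => (z ω).y) :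
    Measurable fun ω => P.Delta γ (s ω) (z ω) w := by
  have h1 : Measurable fun ω => (P.primal (z ω).x).toReal :=
    (P.lowerSemicontinuous_primal.measurable.comp hx).ereal_toReal
  have h2 : Measurable fun ω => P.coupling (z ω).x w.y :=
    Finset.measurable_sum _ fun j _ => (measurable_mulVec P.A hx j).mul_const _
  refine ((((h1.add h2).sub_const _).const_mul _).add ((Finset.measurable_sum _ fun i _ =>
    ?_).const_mul _)).add ((Finset.measurable_sum _ fun j _ => ?_).const_mul _)
  · exact ((((measurable_pi_apply i).comp hx).sub_const _).pow_const 2).div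
      ((P.measurable_tau γ hs i).mul_const _)
  · have hσ : Measurable fun ω => P.sigma (s ω) j := hs.div_const _
    exact ((((measurable_pi_apply j).comp hy).sub_const _).pow_const 2).div (hσ.mul_const _)

end Measurability

/-! ### The law of the draws -/

/-- The law of a sequence of independent draws of coordinates with probabilities `p i`. -/
structure IsDrawLaw (ν : Measure (ℕ → Fin n)) : Prop where
  prob : IsProbabilityMeasure ν
  indep : iIndepFun (fun k (d : ℕ → Fin n) => d k) ν
  law : ∀ k i, ν {d | d k = i} = ENNReal.ofReal (P.p i)

/-- A function of finitely many draws factors through the restriction to these draws. -/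
lemma _root_.DependsOn.exists_eq_comp_restrict [Nonempty (Fin n)] {β : Type*}
    {H : (ℕ → Fin n) → β} {k : ℕ} (h : DependsOn H (Set.Iio k)) :
    ∃ H' : (Finset.range k → Fin n) → β, ∀ d, H d = H' fun t => d t := by
  refine ⟨fun e => H fun t => if ht : t ∈ Finset.range k then e ⟨t, ht⟩
    else Classical.arbitrary _, fun d => h fun t ht => ?_⟩
  rw [dif_pos (Finset.mem_range.2 ht)]

lemma _root_.DependsOn.measurable_of_Iio [Nonempty (Fin n)] {β : Type*} [MeasurableSpace β]
    {H : (ℕ → Fin n) → β} {k : ℕ} (h : DependsOn H (Set.Iio k)) : Measurable H := by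
  obtain ⟨H', hH'⟩ := h.exists_eq_comp_restrict
  rw [funext hH']
  exact (measurable_of_countable H').comp
    (measurable_pi_lambda _ fun t => measurable_pi_apply (t : ℕ))

namespace IsDrawLaw

variable {P} {ν : Measure (ℕ → Fin n)}

/-- The integral of a function of the first `k` draws is its iterated average. -/
lemma lintegral_eq (hν : P.IsDrawLaw ν) (k : ℕ) {H : (ℕ → Fin n) → ℝ} (h0 : ∀ d, 0 ≤ H d)
    (h : DependsOn H (Set.Iio k)) :
    ∫⁻ d, ENNReal.ofReal (H d) ∂ν = ENNReal.ofReal (P.pathExp k H) := by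
  have := hν.prob
  have := P.nonempty_index
  induction k generalizing H with
  | zero =>
    have e : ∀ d, H d = H (fun _ => Classical.choice P.nonempty_index) := fun d =>
      h fun t ht => absurd ht (Nat.not_lt_zero t)
    rw [lintegral_congr fun d => by rw [e d], lintegral_const, measure_univ, mul_one]
    rfl
  | succ k ih =>
    set G : Fin n → (ℕ → Fin n) → ℝ := fun i d => H (Function.update d k i) with hG
    have hGdep : ∀ i, DependsOn (G i) (Set.Iio k) := fun i d d' hd => h fun t ht => by
      have ht : t < k + 1 := ht
      rcases eq_or_ne t k with rfl | hne
      · simp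
      · rw [Function.update_of_ne hne, Function.update_of_ne hne]
        exact hd t (show t < k by omega)
    have hGmeas : ∀ i, Measurable fun d => ENNReal.ofReal (G i d) := fun i =>
      (hGdep i).measurable_of_Iio.ennreal_ofReal
    have hset : ∀ i, MeasurableSet {d : ℕ → Fin n | d k = i} := fun i =>
      (measurable_pi_apply k : Measurable fun d : ℕ → Fin n => d k) (measurableSet_singleton i)
    have e : ∀ d, ENNReal.ofReal (H d)
        = ∑ i, {d : ℕ → Fin n | d k = i}.indicator 1 d * ENNReal.ofReal (G i d) := fun d => by
      rw [Finset.sum_eq_single (d k) (fun i _ hi => ?_) (by simp)]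
      · rw [Set.indicator_of_mem (show d ∈ {d' : ℕ → Fin n | d' k = d k} from rfl)]
        simp [hG]
      · rw [Set.indicator_of_notMem (show d ∉ {d' : ℕ → Fin n | d' k = i} from fun h => hi h.symm),
          zero_mul]
    have hind : ∀ i, ∫⁻ d, {d : ℕ → Fin n | d k = i}.indicator 1 d * ENNReal.ofReal (G i d) ∂ν
        = ENNReal.ofReal (P.p i * P.pathExp k (G i)) := fun i => by
      obtain ⟨G', hG'⟩ := (hGdep i).exists_eq_comp_restrict
      have h1 : IndepFun (fun (d : ℕ → Fin n) (t : ({k} : Finset ℕ)) => d t)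
          (fun (d : ℕ → Fin n) (t : Finset.range k) => d t) ν :=
        hν.indep.indepFun_finset {k} (Finset.range k) (by simp) fun t => measurable_pi_apply t
      have h2 : IndepFun ({d : ℕ → Fin n | d k = i}.indicator (1 : (ℕ → Fin n) → ENNReal))
          (fun d => ENNReal.ofReal (G i d)) ν := by
        simp only [hG']
        exact h1.comp (φ := fun e => ({i} : Set (Fin n)).indicator (fun _ => (1 : ENNReal))
          (e ⟨k, Finset.mem_singleton_self k⟩)) (ψ := fun e => ENNReal.ofReal (G' e))
          (measurable_of_countable _) (measurable_of_countable _)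
      have h3 := lintegral_mul_eq_lintegral_mul_lintegral_of_indepFun
        (measurable_one.indicator (hset i)) (hGmeas i) h2
      rw [ENNReal.ofReal_mul (P.p_pos i).le, ← ih (fun d => h0 _) (hGdep i), ← hν.law k i,
        ← lintegral_indicator_one (hset i)]
      exact h3
    rw [lintegral_congr e, lintegral_finsetSum
      (f := fun i d => {d : ℕ → Fin n | d k = i}.indicator 1 d * ENNReal.ofReal (G i d)) _
      fun i _ => (measurable_one.indicator (hset i)).mul (hGmeas i),
      Finset.sum_congr rfl fun i _ => hind i,
      ← ENNReal.ofReal_sum_of_nonneg fun i _ =>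
        mul_nonneg (P.p_pos i).le (P.pathExp_nonneg k fun d => h0 _)]
    congr 1
    rw [pathExp_succ]
    simp only [← pathExp_const_mul, ← pathExp_sum]
    rfl

/-- The probability that the gap tested after `k` iterations exceeds `θ`, as an iterated average. -/
lemma measure_lt_testGap (hν : P.IsDrawLaw ν) (γ c₁ c₂ s θ : ℝ) (z : Point n m) (k : ℕ) :
    ν {d | (θ : EReal) < P.testGap γ c₁ c₂ s z d k} = ENNReal.ofReal
      (P.pathExp k ({d | (θ : EReal) < P.testGap γ c₁ c₂ s z d k}.indicator fun _ => 1)) := by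
  have := P.nonempty_index
  have hdep : DependsOn (fun d => d ∈ {d | (θ : EReal) < P.testGap γ c₁ c₂ s z d k})
      (Set.Iio k) := (P.dependsOn_testGap γ c₁ c₂ s z k).comp_left fun a => (θ : EReal) < a
  have hmeas : MeasurableSet {d | (θ : EReal) < P.testGap γ c₁ c₂ s z d k} :=
    measurableSet_lt measurable_const (P.dependsOn_testGap γ c₁ c₂ s z k).measurable_of_Iio
  rw [← hν.lintegral_eq k (fun d => Set.indicator_nonneg (fun _ _ => zero_le_one) d)
    (hdep.indicator fun _ _ _ => rfl), ← lintegral_indicator_one hmeas]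
  refine lintegral_congr fun d => ?_
  by_cases hd : d ∈ {d | (θ : EReal) < P.testGap γ c₁ c₂ s z d k}
  · rw [Set.indicator_of_mem hd, Set.indicator_of_mem hd]; simp
  · rw [Set.indicator_of_notMem hd, Set.indicator_of_notMem hd]; simp

/-- The weighted distance to a saddle point does not increase in the mean between the beginning and
the end of a loop. Loops that do not terminate do not contribute. -/
lemma lintegral_Delta_stopped_le (hν : P.IsDrawLaw ν) {γ s : ℝ} {z w : Point n m}
    (H : P.Admissible γ s z w) (c₁ c₂ θ : ℝ) :
    ∫⁻ d, (if 1 ≤ P.loopLength γ c₁ c₂ s θ z d then ENNReal.ofReal (P.Delta γ s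
        ⟨(P.inner γ s z d (P.loopLength γ c₁ c₂ s θ z d)).x,
          (P.inner γ s z d (P.loopLength γ c₁ c₂ s θ z d)).y⟩ w) else 0) ∂ν
      ≤ ENNReal.ofReal (P.Delta γ s z w) := by
  have := P.nonempty_index
  set S : ℕ → (ℕ → Fin n) → ℝ := fun k =>
    {d | P.loopLength γ c₁ c₂ s θ z d = k + 1}.indicator fun d =>
      P.Delta γ s ⟨(P.inner γ s z d (k + 1)).x, (P.inner γ s z d (k + 1)).y⟩ w with hS
  have hdep : ∀ k, DependsOn (S k) (Set.Iio (k + 1)) := fun k =>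
    DependsOn.indicator (P.dependsOn_loopLength_eq γ c₁ c₂ s θ z k)
      ((P.dependsOn_inner γ s z (k + 1)).comp_left fun q => P.Delta γ s ⟨q.x, q.y⟩ w)
  have h0 : ∀ k d, 0 ≤ S k d := fun k d => Set.indicator_nonneg (fun d _ =>
    P.Delta_nonneg H.γ_pos H.s_pos H.saddle (P.domX_inner H.γ_pos H.s_pos H.dom d (k + 1))) d
  have e : ∀ d, (if 1 ≤ P.loopLength γ c₁ c₂ s θ z d then ENNReal.ofReal (P.Delta γ s
        ⟨(P.inner γ s z d (P.loopLength γ c₁ c₂ s θ z d)).x,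
          (P.inner γ s z d (P.loopLength γ c₁ c₂ s θ z d)).y⟩ w) else 0)
      ≤ ∑' k, ENNReal.ofReal (S k d) := fun d => by
    split_ifs with h
    · obtain ⟨k, hk⟩ := Nat.exists_eq_add_of_le' h
      refine le_trans (le_of_eq ?_) (ENNReal.le_tsum k)
      rw [hS]
      simp only
      rw [Set.indicator_of_mem (show d ∈ {d | P.loopLength γ c₁ c₂ s θ z d = k + 1} from hk), hk]
    · exact zero_le
  refine (lintegral_mono e).trans ?_
  rw [lintegral_tsum fun k => ((hdep k).measurable_of_Iio.ennreal_ofReal).aemeasurable,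
    ENNReal.tsum_eq_iSup_nat]
  refine iSup_le fun N => ?_
  rw [Finset.sum_congr rfl fun k _ => hν.lintegral_eq (k + 1) (h0 k) (hdep k),
    ← ENNReal.ofReal_sum_of_nonneg fun k _ => P.pathExp_nonneg _ (h0 k)]
  exact ENNReal.ofReal_le_ofReal (P.sum_pathExp_stopped_le H c₁ c₂ θ N)

end IsDrawLaw

/-- Integrating out a variable that is independent of the others. -/
lemma _root_.ProbabilityTheory.IndepFun.lintegral_prodMk {Ω E F : Type*} {mΩ : MeasurableSpace Ω}
    {mE : MeasurableSpace E} {mF : MeasurableSpace F} {μ : Measure Ω} [IsProbabilityMeasure μ]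
    {Z : Ω → E} {D : Ω → F} (h : IndepFun Z D μ) (hZ : Measurable Z) (hD : Measurable D)
    {Φ : E × F → ENNReal} (hΦ : Measurable Φ) :
    ∫⁻ ω, Φ (Z ω, D ω) ∂μ = ∫⁻ ω, ∫⁻ d, Φ (Z ω, d) ∂(μ.map D) ∂μ := by
  have := Measure.isProbabilityMeasure_map (μ := μ) hD.aemeasurable
  have := Measure.isProbabilityMeasure_map (μ := μ) hZ.aemeasurable
  rw [← lintegral_map hΦ (hZ.prodMk hD),
    h.map_prod_eq_prod_map_map hZ.aemeasurable hD.aemeasurable,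
    lintegral_prod _ hΦ.aemeasurable, lintegral_map hΦ.lintegral_prod_right' hZ]

end Problem
end PureCD

namespace PureCD

/-- The choices with the nonpositive step size parameters replaced by `1`. The parameters of the
loops that are actually reached are positive, so this changes nothing that matters, but it makes all
step sizes positive for all outcomes, as the measurability of the iterates requires. -/
def Choices.posS {n : ℕ} (X : Choices n) : Choices n where
  draw := X.draw
  s l := if 0 < X.s l then X.s l else 1
  thr := X.thr

lemma Choices.posS_s_pos {n : ℕ} (X : Choices n) (l : ℕ) : 0 < X.posS.s l := by
  simp only [posS]
  split_ifs with h
  · exact h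
  · exact one_pos

lemma Choices.posS_s_of_pos {n : ℕ} {X : Choices n} {l : ℕ} (h : 0 < X.s l) :
    X.posS.s l = X.s l := if_pos h

namespace Problem

variable {n m : ℕ} (P : Problem n m)

/-! ### The outer loop -/

section Run

variable {γ c₁ c₂ s₀ ε₀ δ r M : ℝ} {z₀ w : Point n m}

lemma reached_zero (X : Choices n) : P.Reached γ c₁ c₂ z₀ X 0 :=
  fun _ h => absurd h (Nat.not_lt_zero _)

lemma reached_succ {X : Choices n} {l : ℕ} : P.Reached γ c₁ c₂ z₀ X (l + 1) ↔
    P.Reached γ c₁ c₂ z₀ X l ∧ 1 ≤ P.len γ c₁ c₂ z₀ X l := by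
  simp only [Reached, Nat.forall_lt_succ_right]

lemma posS_agree {X : Choices n} (h : ∀ l, P.Reached γ c₁ c₂ z₀ X l → 0 < X.s l) (l : ℕ) :
    (P.Reached γ c₁ c₂ z₀ X.posS l ↔ P.Reached γ c₁ c₂ z₀ X l) ∧
      (P.Reached γ c₁ c₂ z₀ X l →
        P.start γ c₁ c₂ z₀ X.posS l = P.start γ c₁ c₂ z₀ X l) := by
  induction l with
  | zero => exact ⟨iff_of_true (P.reached_zero _) (P.reached_zero _), fun _ => rfl⟩
  | succ l ih =>
    by_cases hl : P.Reached γ c₁ c₂ z₀ X l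
    · have hs : X.posS.s l = X.s l := Choices.posS_s_of_pos (h l hl)
      have hlen : P.len γ c₁ c₂ z₀ X.posS l = P.len γ c₁ c₂ z₀ X l := by
        rw [len, len, hs, ih.2 hl]; rfl
      refine ⟨by rw [reached_succ, reached_succ, ih.1, hlen], fun _ => ?_⟩
      rw [start, start, hs, ih.2 hl]
      rfl
    · exact ⟨by rw [reached_succ, reached_succ, ih.1]; simp [hl],
        fun h' => absurd (P.reached_succ.1 h').1 hl⟩

lemma posS_len {X : Choices n} (h : ∀ l, P.Reached γ c₁ c₂ z₀ X l → 0 < X.s l) {l : ℕ}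
    (hl : P.Reached γ c₁ c₂ z₀ X l) :
    P.len γ c₁ c₂ z₀ X.posS l = P.len γ c₁ c₂ z₀ X l := by
  rw [len, len, Choices.posS_s_of_pos (h l hl), (P.posS_agree h l).2 hl]
  rfl

lemma posS_gapAt {X : Choices n} (h : ∀ l, P.Reached γ c₁ c₂ z₀ X l → 0 < X.s l) {l : ℕ}
    (hl : P.Reached γ c₁ c₂ z₀ X l) (k : ℕ) :
    P.gapAt γ c₁ c₂ z₀ X.posS l k = P.gapAt γ c₁ c₂ z₀ X l k := by
  rw [gapAt, gapAt, Choices.posS_s_of_pos (h l hl), (P.posS_agree h l).2 hl]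
  rfl

variable {Ω : Type*} {mΩ : MeasurableSpace Ω} {μ : Measure Ω} {𝓖 : Filtration ℕ mΩ}
  {X : Ω → Choices n}

namespace IsRun

variable {P}

lemma ae_s_pos (hX : P.IsRun γ c₁ c₂ z₀ s₀ ε₀ δ r μ 𝓖 X) (hs₀ : 0 < s₀) :
    ∀ᵐ ω ∂μ, ∀ l, P.Reached γ c₁ c₂ z₀ (X ω) l → 0 < (X ω).s l := by
  filter_upwards [hX.s_next] with ω h l hl
  rcases l with _ | l
  · rw [hX.s_zero]; exact hs₀
  · exact (h l hl).1

lemma posS (hX : P.IsRun γ c₁ c₂ z₀ s₀ ε₀ δ r μ 𝓖 X) (hs₀ : 0 < s₀) :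
    P.IsRun γ c₁ c₂ z₀ s₀ ε₀ δ r μ 𝓖 fun ω => (X ω).posS where
  draw_past := hX.draw_past
  draw_law := hX.draw_law
  draw_iid := hX.draw_iid
  draw_fresh := hX.draw_fresh
  s_past l := Measurable.ite (measurableSet_lt measurable_const (hX.s_past l)) (hX.s_past l)
    measurable_const
  thr_past := hX.thr_past
  s_zero ω := by rw [Choices.posS_s_of_pos (by rw [hX.s_zero]; exact hs₀), hX.s_zero]
  thr_zero := hX.thr_zero
  s_next := by
    filter_upwards [hX.s_next, hX.ae_s_pos hs₀] with ω h h' l hl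
    have hl1 := (P.posS_agree h' (l + 1)).1.1 hl
    rw [Choices.posS_s_of_pos (h' _ hl1), Choices.posS_s_of_pos (h' l (P.reached_succ.1 hl1).1)]
    exact h l hl1
  thr_next := by
    filter_upwards [hX.thr_next, hX.ae_s_pos hs₀] with ω h h' l hl
    have hl1 := (P.posS_agree h' (l + 1)).1.1 hl
    have hl0 := (P.reached_succ.1 hl1).1
    rw [P.posS_len h' hl0, P.posS_gapAt h' hl0]
    exact h l hl1

lemma isDrawLaw_map [IsProbabilityMeasure μ] (hX : P.IsRun γ c₁ c₂ z₀ s₀ ε₀ δ r μ 𝓖 X) (l : ℕ) :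
    P.IsDrawLaw (μ.map fun ω => (X ω).draw l) := by
  have hk : ∀ k, Measurable fun ω => (X ω).draw l k := fun k =>
    (hX.draw_past l k).mono (𝓖.le _) le_rfl
  have hd : Measurable fun ω => (X ω).draw l := measurable_pi_lambda _ hk
  have hp := Measure.isProbabilityMeasure_map (μ := μ) hd.aemeasurable
  refine ⟨hp, ?_, fun k i => ?_⟩
  · rw [iIndepFun_iff_map_fun_eq_infinitePi_map fun k => measurable_pi_apply k]
    have h := (hX.draw_iid l).map_fun_eq_infinitePi_map hk
    have e : ∀ k, (μ.map fun ω => (X ω).draw l).map (fun d => d k)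
        = μ.map fun ω => (X ω).draw l k := fun k =>
      Measure.map_map (measurable_pi_apply k) hd
    simp only [e, ← h]
    exact Measure.map_id
  · have hset : MeasurableSet {d : ℕ → Fin n | d k = i} :=
      (measurable_pi_apply k : Measurable fun d : ℕ → Fin n => d k) (measurableSet_singleton i)
    rw [Measure.map_apply hd hset]
    exact hX.draw_law l k i

end IsRun

lemma _root_.PureCD.Problem.IsBoundedRun.posS {P : Problem n m}
    (hX : P.IsRun γ c₁ c₂ z₀ s₀ ε₀ δ r μ 𝓖 X) (hs₀ : 0 < s₀)
    (hB : P.IsBoundedRun γ c₁ c₂ z₀ M μ X) :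
    P.IsBoundedRun γ c₁ c₂ z₀ M μ fun ω => (X ω).posS := by
  filter_upwards [hB, hX.ae_s_pos hs₀] with ω h h' l hl
  have hl' := (P.posS_agree h' l).1.1 hl
  rw [(P.posS_agree h' l).2 hl']
  exact h l hl'

namespace IsRun

variable {P}

lemma measurable_draw (hX : P.IsRun γ c₁ c₂ z₀ s₀ ε₀ δ r μ 𝓖 X) (l : ℕ) :
    Measurable[𝓖 (l + 1)] fun ω => (X ω).draw l :=
  @measurable_pi_lambda _ _ _ (𝓖 (l + 1)) _ _ (hX.draw_past l)

/-- The starting point of a loop is known when the loop starts. -/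
lemma measurable_start (hX : P.IsRun γ c₁ c₂ z₀ s₀ ε₀ δ r μ 𝓖 X)
    (hg : ∀ j, IsClosedConvex (conj (P.g j))) (hγ : 0 < γ) (hpos : ∀ ω l, 0 < (X ω).s l) (l : ℕ) :
    (Measurable[𝓖 l] fun ω => (P.start γ c₁ c₂ z₀ (X ω) l).x) ∧
      Measurable[𝓖 l] fun ω => (P.start γ c₁ c₂ z₀ (X ω) l).y := by
  induction l with
  | zero => exact ⟨measurable_const (a := z₀.x), measurable_const (a := z₀.y)⟩
  | succ l ih =>
    have hle := 𝓖.mono l.le_succ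
    have hs := (hX.s_past l).mono hle le_rfl
    have hθ := (hX.thr_past l).mono hle le_rfl
    have hx := ih.1.mono hle le_rfl
    have hy := ih.2.mono hle le_rfl
    have hd := hX.measurable_draw l
    exact P.measurable_inner_index hg hγ hs (fun ω => hpos ω l) hd hx hy
      (P.measurable_loopLength hg hγ c₁ c₂ hs (fun ω => hpos ω l) hθ hd hx hy)

lemma measurable_len (hX : P.IsRun γ c₁ c₂ z₀ s₀ ε₀ δ r μ 𝓖 X)
    (hg : ∀ j, IsClosedConvex (conj (P.g j))) (hγ : 0 < γ) (hpos : ∀ ω l, 0 < (X ω).s l) (l : ℕ) :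
    Measurable[𝓖 (l + 1)] fun ω => P.len γ c₁ c₂ z₀ (X ω) l := by
  have hle := 𝓖.mono l.le_succ
  have h := hX.measurable_start hg hγ hpos l
  exact P.measurable_loopLength hg hγ c₁ c₂ ((hX.s_past l).mono hle le_rfl) (fun ω => hpos ω l)
    ((hX.thr_past l).mono hle le_rfl) (hX.measurable_draw l) (h.1.mono hle le_rfl)
    (h.2.mono hle le_rfl)

lemma measurableSet_reached (hX : P.IsRun γ c₁ c₂ z₀ s₀ ε₀ δ r μ 𝓖 X)
    (hg : ∀ j, IsClosedConvex (conj (P.g j))) (hγ : 0 < γ) (hpos : ∀ ω l, 0 < (X ω).s l) (l : ℕ) :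
    MeasurableSet[𝓖 l] {ω | P.Reached γ c₁ c₂ z₀ (X ω) l} := by
  have e : {ω | P.Reached γ c₁ c₂ z₀ (X ω) l}
      = ⋂ l', ⋂ (_ : l' < l), {ω | 1 ≤ P.len γ c₁ c₂ z₀ (X ω) l'} := by
    ext ω; simp [Reached]
  rw [e]
  refine MeasurableSet.iInter fun l' => MeasurableSet.iInter fun hl' => ?_
  have h := (hX.measurable_len hg hγ hpos l').mono (𝓖.mono (show l' + 1 ≤ l from hl')) le_rfl
  exact h (measurableSet_Ici (a := 1))

/-- The draws of a loop can be integrated out, given the past. -/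
lemma lintegral_draw [IsProbabilityMeasure μ] (hX : P.IsRun γ c₁ c₂ z₀ s₀ ε₀ δ r μ 𝓖 X) (l : ℕ)
    {Φ : Ω × (ℕ → Fin n) → ENNReal} (hΦ : Measurable[(𝓖 l).prod MeasurableSpace.pi] Φ) :
    ∫⁻ ω, Φ (ω, (X ω).draw l) ∂μ
      = ∫⁻ ω, ∫⁻ d, Φ (ω, d) ∂(μ.map fun ω => (X ω).draw l) ∂μ := by
  have h : @IndepFun Ω Ω (ℕ → Fin n) mΩ (𝓖 l) MeasurableSpace.pi id
      (fun ω => (X ω).draw l) μ := by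
    refine (@IndepFun_iff_Indep Ω _ _ mΩ (𝓖 l) MeasurableSpace.pi id _ μ).2 ?_
    rw [MeasurableSpace.comap_id]
    exact (hX.draw_fresh l).symm
  exact h.lintegral_prodMk (measurable_id'' (𝓖.le l))
    ((hX.measurable_draw l).mono (𝓖.le _) le_rfl) hΦ

end IsRun

end Run

/-! ### Growth of the weighted distance under changes of the step sizes -/

section StepSizes

variable {γ s s' r : ℝ}

lemma sigma_div_sigma (hs : 0 < s) (j : Fin m) : P.sigma s' j / P.sigma s j = s' / s := by
  have h1 := P.theta_pos j
  have h2 := P.maxCol_pos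
  rw [sigma, sigma]
  field_simp

lemma Delta_le_of_ratio (hγ : 0 < γ) (hs : 0 < s) (hs' : 0 < s') (hr : 1 ≤ r)
    (hτ : ∀ i, r⁻¹ ≤ P.tau γ s' i / P.tau γ s i)
    (hσ : ∀ j, r⁻¹ ≤ P.sigma s' j / P.sigma s j) {z w : Point n m} (hw : P.IsSaddle w)
    (hz : P.DomX z.x) : P.Delta γ s' z w ≤ r * P.Delta γ s z w := by
  have hr0 : 0 < r := by linarith
  have hpm := P.pmin_pos
  have key : ∀ {a b c q : ℝ}, 0 < a → 0 < b → 0 < q → 0 ≤ c → r⁻¹ ≤ b / a →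
      c / (b * q) ≤ r * (c / (a * q)) := fun {a b c q} ha hb hq hc h => by
    rw [le_div_iff₀ ha, inv_mul_le_iff₀ hr0] at h
    rw [mul_div_assoc', div_le_div_iff₀ (by positivity) (by positivity)]
    nlinarith [mul_le_mul_of_nonneg_left h (mul_nonneg hc hq.le)]
  have h1 := hw.excess_nonneg hz
  have h2 : (1 - P.pmin) * P.excess z.x w ≤ r * ((1 - P.pmin) * P.excess z.x w) :=
    le_mul_of_one_le_left (mul_nonneg (by linarith [P.pmin_le_one]) h1) hr
  have h3 : ∑ i, (z.x i - w.x i) ^ 2 / (P.tau γ s' i * P.p i)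
      ≤ r * ∑ i, (z.x i - w.x i) ^ 2 / (P.tau γ s i * P.p i) := by
    rw [Finset.mul_sum]
    exact Finset.sum_le_sum fun i _ => key (P.tau_pos hγ hs i) (P.tau_pos hγ hs' i) (P.p_pos i)
      (sq_nonneg _) (hτ i)
  have h4 : ∑ j, (z.y j - w.y j) ^ 2 / (P.sigma s' j * P.prob j)
      ≤ r * ∑ j, (z.y j - w.y j) ^ 2 / (P.sigma s j * P.prob j) := by
    rw [Finset.mul_sum]
    exact Finset.sum_le_sum fun j _ => key (P.sigma_pos hs j) (P.sigma_pos hs' j) (P.prob_pos j)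
      (sq_nonneg _) (hσ j)
  have h5 := mul_le_mul_of_nonneg_left h3 (show 0 ≤ P.pmin / 2 by positivity)
  have h6 := mul_le_mul_of_nonneg_left h4 (show 0 ≤ P.pmin / 2 by positivity)
  rw [Delta_eq, Delta_eq, quad, quad]
  linarith

/-- The factor `1 + s + 1 / s` of the tail bound grows at most by the factor `r`. -/
lemma one_add_add_inv_le_of_ratio (hs : 0 < s) (hs' : 0 < s') (hr : 1 ≤ r)
    (h1 : r⁻¹ ≤ s' / s) (h2 : s' / s ≤ r) : 1 + s' + 1 / s' ≤ r * (1 + s + 1 / s) := by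
  have hr0 : 0 < r := by linarith
  rw [div_le_iff₀ hs] at h2
  rw [le_div_iff₀ hs, inv_mul_le_iff₀ hr0] at h1
  have h3 : 1 / s' ≤ r * (1 / s) := by
    rw [mul_one_div, div_le_div_iff₀ hs' hs]
    linarith
  linarith

end StepSizes

section Run

variable {γ c₁ c₂ s₀ ε₀ δ r M : ℝ} {z₀ w : Point n m} {Ω : Type*} {mΩ : MeasurableSpace Ω}
  {μ : Measure Ω} {𝓖 : Filtration ℕ mΩ} {X : Ω → Choices n}

/-- What the boundedness assumption says about the finiteness of the functions at a point. -/
lemma dom_of_bounded {z : Point n m} (hx : P.primal z.x ≤ (M : EReal))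
    (hy : ∑ j, (((P.prob j)⁻¹ - 1 : ℝ) : EReal) * conj (P.g j) (z.y j) ≤ (M : EReal)) :
    P.DomX z.x ∧ (∀ j, P.prob j < 1 → conj (P.g j) (z.y j) ≠ ⊤) ∧
      ∑ j, ((P.prob j)⁻¹ - 1) * (conj (P.g j) (z.y j)).toReal ≤ M := by
  have hw : ∀ j, P.prob j < 1 → 0 < (P.prob j)⁻¹ - 1 := fun j hj =>
    sub_pos.2 ((one_lt_inv₀ (P.prob_pos j)).2 hj)
  have hw' : ∀ j, ¬ P.prob j < 1 → (P.prob j)⁻¹ - 1 = 0 := fun j hj => by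
    rw [le_antisymm (P.prob_le_one j) (not_lt.1 hj)]; norm_num
  have hbot : ∀ j ∈ Finset.univ,
      (((P.prob j)⁻¹ - 1 : ℝ) : EReal) * conj (P.g j) (z.y j) ≠ ⊥ := fun j _ => by
    by_cases hj : P.prob j < 1
    · rcases eq_or_ne (conj (P.g j) (z.y j)) ⊤ with h | h
      · rw [h, EReal.coe_mul_top_of_pos (hw j hj)]
        exact top_ne_bot
      · rw [← P.coe_toReal_conj h, ← EReal.coe_mul]
        exact EReal.coe_ne_bot _
    · rw [hw' j hj, EReal.coe_zero, zero_mul]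
      exact EReal.zero_ne_bot
  have hfin : ∀ j, P.prob j < 1 → conj (P.g j) (z.y j) ≠ ⊤ := fun j hj h => by
    have h1 := sum_eq_top _ hbot (Finset.mem_univ j)
      (by rw [h, EReal.coe_mul_top_of_pos (hw j hj)])
    rw [h1, top_le_iff] at hy
    exact EReal.coe_ne_top _ hy
  refine ⟨P.domX_of_primal_ne_top (hx.trans_lt (EReal.coe_lt_top M)).ne, hfin, ?_⟩
  rw [← EReal.coe_le_coe_iff, coe_sum]
  refine le_trans (le_of_eq (Finset.sum_congr rfl fun j _ => ?_)) hy
  by_cases hj : P.prob j < 1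
  · rw [EReal.coe_mul, P.coe_toReal_conj (hfin j hj)]
  · rw [hw' j hj, zero_mul, EReal.coe_zero, zero_mul]

namespace IsRun

variable {P}

lemma s_bound (hX : P.IsRun γ c₁ c₂ z₀ s₀ ε₀ δ r μ 𝓖 X) (hr : 1 ≤ r)
    (hpos : ∀ ω l, 0 < (X ω).s l) :
    ∀ᵐ ω ∂μ, ∀ l, P.Reached γ c₁ c₂ z₀ (X ω) l →
      1 + (X ω).s l + 1 / (X ω).s l ≤ r ^ l * (1 + s₀ + 1 / s₀) := by
  filter_upwards [hX.s_next] with ω h l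
  induction l with
  | zero => intro _; rw [hX.s_zero, pow_zero, one_mul]
  | succ l ih =>
    intro hl
    have h1 := (h l hl).2.2 ⟨0, P.m_pos⟩
    rw [P.sigma_div_sigma (hpos ω l)] at h1
    calc _ ≤ r * (1 + (X ω).s l + 1 / (X ω).s l) :=
          one_add_add_inv_le_of_ratio (hpos ω l) (hpos ω (l + 1)) hr h1.1 h1.2
      _ ≤ r * (r ^ l * (1 + s₀ + 1 / s₀)) :=
          mul_le_mul_of_nonneg_left (ih (P.reached_succ.1 hl).1) (by linarith)
      _ = _ := by ring

/-- The mean of the weighted distance to a saddle point at the beginning of a loop. -/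
lemma lintegral_Delta_start_le [IsProbabilityMeasure μ]
    (hX : P.IsRun γ c₁ c₂ z₀ s₀ ε₀ δ r μ 𝓖 X)
    (hB : P.IsBoundedRun γ c₁ c₂ z₀ M μ X) (hg : ∀ j, IsClosedConvex (conj (P.g j)))
    (hγ : 0 < γ) (hγ' : γ < 1) (hr : 1 ≤ r) (hpos : ∀ ω l, 0 < (X ω).s l)
    (hw : P.IsSaddle w) (l : ℕ) :
    ∫⁻ ω, {ω | P.Reached γ c₁ c₂ z₀ (X ω) l}.indicator
        (fun ω => ENNReal.ofReal (P.Delta γ ((X ω).s l) (P.start γ c₁ c₂ z₀ (X ω) l) w)) ω ∂μ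
      ≤ ENNReal.ofReal (r ^ l * P.Delta γ s₀ z₀ w) := by
  have hr0 : 0 ≤ r := by linarith
  induction l with
  | zero =>
    calc _ ≤ ∫⁻ ω, ENNReal.ofReal (P.Delta γ s₀ z₀ w) ∂μ := lintegral_mono fun ω => by
          refine (Set.indicator_le_self _ _ _).trans ?_
          rw [hX.s_zero]
          rfl
      _ = _ := by rw [lintegral_const, measure_univ, mul_one, pow_zero, one_mul]
  | succ l ih =>
    set Φ : Ω × (ℕ → Fin n) → ENNReal := fun a =>
      {a : Ω × (ℕ → Fin n) | P.Reached γ c₁ c₂ z₀ (X a.1) l}.indicator (fun a =>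
        if 1 ≤ P.loopLength γ c₁ c₂ ((X a.1).s l) ((X a.1).thr l)
            (P.start γ c₁ c₂ z₀ (X a.1) l) a.2 then
          ENNReal.ofReal (P.Delta γ ((X a.1).s l)
            ⟨(P.inner γ ((X a.1).s l) (P.start γ c₁ c₂ z₀ (X a.1) l) a.2
              (P.loopLength γ c₁ c₂ ((X a.1).s l) ((X a.1).thr l)
                (P.start γ c₁ c₂ z₀ (X a.1) l) a.2)).x,
            (P.inner γ ((X a.1).s l) (P.start γ c₁ c₂ z₀ (X a.1) l) a.2
              (P.loopLength γ c₁ c₂ ((X a.1).s l) ((X a.1).thr l)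
                (P.start γ c₁ c₂ z₀ (X a.1) l) a.2)).y⟩ w) else 0) a
    have hΦm : Measurable[(𝓖 l).prod MeasurableSpace.pi] Φ := by
      have hfst : @Measurable (Ω × (ℕ → Fin n)) Ω ((𝓖 l).prod MeasurableSpace.pi) (𝓖 l) Prod.fst :=
        @measurable_fst _ _ (𝓖 l) _
      have hsnd : @Measurable (Ω × (ℕ → Fin n)) (ℕ → Fin n) ((𝓖 l).prod MeasurableSpace.pi) _
        Prod.snd := @measurable_snd _ _ (𝓖 l) _
      have hs := (hX.s_past l).comp hfst
      have hθ := (hX.thr_past l).comp hfst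
      have hst := hX.measurable_start hg hγ hpos l
      have hx := hst.1.comp hfst
      have hy := hst.2.comp hfst
      have hp : ∀ a : Ω × (ℕ → Fin n), 0 < (X a.1).s l := fun a => hpos a.1 l
      have hlen := P.measurable_loopLength hg hγ c₁ c₂ hs hp hθ hsnd hx hy
      have hin := P.measurable_inner_index hg hγ hs hp hsnd hx hy hlen
      refine Measurable.indicator (Measurable.ite (hlen (measurableSet_Ici (a := 1)))
        (P.measurable_Delta γ w hs hin.1 hin.2).ennreal_ofReal measurable_const)
        (hfst (hX.measurableSet_reached hg hγ hpos l))
    have h1 : ∀ᵐ ω ∂μ, {ω | P.Reached γ c₁ c₂ z₀ (X ω) (l + 1)}.indicator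
        (fun ω => ENNReal.ofReal (P.Delta γ ((X ω).s (l + 1))
          (P.start γ c₁ c₂ z₀ (X ω) (l + 1)) w)) ω ≤ ENNReal.ofReal r * Φ (ω, (X ω).draw l) := by
      filter_upwards [hX.s_next, hB] with ω h hb
      by_cases hl : P.Reached γ c₁ c₂ z₀ (X ω) (l + 1)
      · have hl' := P.reached_succ.1 hl
        have e : Φ (ω, (X ω).draw l) = ENNReal.ofReal
            (P.Delta γ ((X ω).s l) (P.start γ c₁ c₂ z₀ (X ω) (l + 1)) w) :=
          (Set.indicator_of_mem (show (ω, (X ω).draw l) ∈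
            {a : Ω × (ℕ → Fin n) | P.Reached γ c₁ c₂ z₀ (X a.1) l} from hl'.1) _).trans
            (if_pos hl'.2)
        rw [Set.indicator_of_mem (show ω ∈ {ω | P.Reached γ c₁ c₂ z₀ (X ω) (l + 1)} from hl), e,
          ← ENNReal.ofReal_mul hr0]
        refine ENNReal.ofReal_le_ofReal ?_
        have hd := P.dom_of_bounded (hb (l + 1) hl).1.2 (hb (l + 1) hl).2.2
        exact P.Delta_le_of_ratio hγ (hpos ω l) (hpos ω (l + 1)) hr (fun i => ((h l hl).2.1 i).1)
          (fun j => ((h l hl).2.2 j).1) hw hd.1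
      · rw [Set.indicator_of_notMem (show ω ∉ {ω | P.Reached γ c₁ c₂ z₀ (X ω) (l + 1)} from hl)]
        exact zero_le
    have h2 : ∀ᵐ ω ∂μ, ∫⁻ d, Φ (ω, d) ∂(μ.map fun ω => (X ω).draw l)
        ≤ {ω | P.Reached γ c₁ c₂ z₀ (X ω) l}.indicator (fun ω => ENNReal.ofReal
          (P.Delta γ ((X ω).s l) (P.start γ c₁ c₂ z₀ (X ω) l) w)) ω := by
      filter_upwards [hB] with ω hb
      by_cases hl : P.Reached γ c₁ c₂ z₀ (X ω) l
      · have hd := P.dom_of_bounded (hb l hl).1.2 (hb l hl).2.2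
        rw [Set.indicator_of_mem (show ω ∈ {ω | P.Reached γ c₁ c₂ z₀ (X ω) l} from hl)]
        refine le_trans (lintegral_mono fun d => ?_)
          ((hX.isDrawLaw_map l).lintegral_Delta_stopped_le
            ⟨hγ, hγ', hpos ω l, hd.1, hw⟩ c₁ c₂ ((X ω).thr l))
        exact Set.indicator_le_self _ _ _
      · have e : ∀ d, Φ (ω, d) = 0 := fun d => Set.indicator_of_notMem
          (show (ω, d) ∉ {a : Ω × (ℕ → Fin n) | P.Reached γ c₁ c₂ z₀ (X a.1) l} from hl) _
        simp [e]
    calc _ ≤ ∫⁻ ω, ENNReal.ofReal r * Φ (ω, (X ω).draw l) ∂μ := lintegral_mono_ae h1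
      _ = ENNReal.ofReal r * ∫⁻ ω, Φ (ω, (X ω).draw l) ∂μ :=
          lintegral_const_mul' _ _ ENNReal.ofReal_ne_top
      _ = ENNReal.ofReal r * ∫⁻ ω, ∫⁻ d, Φ (ω, d) ∂(μ.map fun ω => (X ω).draw l) ∂μ := by
          rw [hX.lintegral_draw l hΦm]
      _ ≤ ENNReal.ofReal r * ENNReal.ofReal (r ^ l * P.Delta γ s₀ z₀ w) :=
          mul_le_mul_right ((lintegral_mono_ae h2).trans ih) _
      _ = _ := by rw [← ENNReal.ofReal_mul hr0, pow_succ', mul_assoc]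

end IsRun

end Run

/-! ### Exceptional events -/

section Run

variable {γ c₁ c₂ s₀ ε₀ δ r M C B : ℝ} {z₀ w : Point n m} {Ω : Type*} {mΩ : MeasurableSpace Ω}
  {μ : Measure Ω} {𝓖 : Filtration ℕ mΩ} {X : Ω → Choices n}

/-- The tail bound for the tested gap of an inner loop, with the constants `B` and `C`, for loops
whose starting point satisfies the boundedness assumption. -/
def TailBound (γ c₁ c₂ M B C : ℝ) (w : Point n m) : Prop :=
  ∀ (s : ℝ) (z : Point n m), P.Admissible γ s z w →
    (∀ j, P.prob j < 1 → conj (P.g j) (z.y j) ≠ ⊤) →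
    ∑ j, ((P.prob j)⁻¹ - 1) * (conj (P.g j) (z.y j)).toReal ≤ M → ∀ k, 1 ≤ k → ∀ θ : ℝ, 0 < θ →
    P.pathExp k ({d | (θ : EReal) < P.testGap γ c₁ c₂ s z d k}.indicator fun _ => 1)
      ≤ (B + C * (1 + s + 1 / s) * P.Delta γ s z w) / (k * θ)

variable {P}

/-- The probability that a loop is reached and that its tested gap after `⌈b / θ⌉` iterations
exceeds `θ`, where `θ` may depend on the past of the loop. -/
lemma IsRun.measure_lt_gapAt_le [IsProbabilityMeasure μ]
    (hX : P.IsRun γ c₁ c₂ z₀ s₀ ε₀ δ r μ 𝓖 X)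
    (hB : P.IsBoundedRun γ c₁ c₂ z₀ M μ X) (hg : ∀ j, IsClosedConvex (conj (P.g j)))
    (hγ : 0 < γ) (hγ' : γ < 1) (hr : 1 ≤ r) (hs₀ : 0 < s₀) (hpos : ∀ ω l, 0 < (X ω).s l)
    (hw : P.IsSaddle w) (hz₀ : P.DomX z₀.x) (hB0 : 0 < B) (hC : 0 < C)
    (htail : P.TailBound γ c₁ c₂ M B C w) {l : ℕ}
    {θ : Ω → ℝ} (hθ : Measurable[𝓖 l] θ) (hθ0 : ∀ ω, 0 < θ ω) {b : ℝ} (hb : 0 < b) :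
    μ {ω | P.Reached γ c₁ c₂ z₀ (X ω) l ∧
        (θ ω : EReal) < P.gapAt γ c₁ c₂ z₀ (X ω) l ⌈b / θ ω⌉₊}
      ≤ ENNReal.ofReal
        ((B + C * (1 + s₀ + 1 / s₀) * r ^ (2 * l) * P.Delta γ s₀ z₀ w) / b) := by
  have hr0 : 0 < r := by linarith
  set S : Set (Ω × (ℕ → Fin n)) := {a | P.Reached γ c₁ c₂ z₀ (X a.1) l ∧ (θ a.1 : EReal)
    < P.testGap γ c₁ c₂ ((X a.1).s l) (P.start γ c₁ c₂ z₀ (X a.1) l) a.2 ⌈b / θ a.1⌉₊} with hS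
  have hSm : MeasurableSet[(𝓖 l).prod MeasurableSpace.pi] S := by
    have hfst : @Measurable (Ω × (ℕ → Fin n)) Ω ((𝓖 l).prod MeasurableSpace.pi) (𝓖 l) Prod.fst :=
      @measurable_fst _ _ (𝓖 l) _
    have hsnd : @Measurable (Ω × (ℕ → Fin n)) (ℕ → Fin n) ((𝓖 l).prod MeasurableSpace.pi) _
      Prod.snd := @measurable_snd _ _ (𝓖 l) _
    have hst := hX.measurable_start hg hγ hpos l
    have hgap := P.measurable_testGap hg hγ c₁ c₂ ((hX.s_past l).comp hfst)
      (fun a : Ω × (ℕ → Fin n) => hpos a.1 l) hsnd (hst.1.comp hfst) (hst.2.comp hfst)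
    have hθ' := hθ.comp hfst
    have e : S = ⋃ k : ℕ, (Prod.fst ⁻¹' {ω | P.Reached γ c₁ c₂ z₀ (X ω) l}) ∩
        ({a | ⌈b / θ a.1⌉₊ = k} ∩ {a | (θ a.1 : EReal) < P.testGap γ c₁ c₂ ((X a.1).s l)
          (P.start γ c₁ c₂ z₀ (X a.1) l) a.2 k}) := by
      ext a
      simp [hS]
    rw [e]
    refine MeasurableSet.iUnion fun k => (hfst (hX.measurableSet_reached hg hγ hpos l)).inter
      (MeasurableSet.inter ?_ (measurableSet_lt hθ'.coe_real_ereal (hgap k)))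
    exact (Nat.measurable_ceil.comp (hθ'.const_div b)) (measurableSet_singleton k)
  have hmap : @Measurable Ω (Ω × (ℕ → Fin n)) mΩ ((𝓖 l).prod MeasurableSpace.pi)
      fun ω => (ω, (X ω).draw l) :=
    (measurable_id'' (𝓖.le l)).prodMk ((hX.measurable_draw l).mono (𝓖.le _) le_rfl)
  have h1 : μ {ω | P.Reached γ c₁ c₂ z₀ (X ω) l ∧
      (θ ω : EReal) < P.gapAt γ c₁ c₂ z₀ (X ω) l ⌈b / θ ω⌉₊}
      = ∫⁻ ω, S.indicator 1 (ω, (X ω).draw l) ∂μ :=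
    (lintegral_indicator_one (hmap hSm)).symm
  have hΦ : Measurable[(𝓖 l).prod MeasurableSpace.pi]
      (S.indicator (1 : Ω × (ℕ → Fin n) → ENNReal)) :=
    (@measurable_const _ _ _ ((𝓖 l).prod MeasurableSpace.pi) (1 : ENNReal)).indicator hSm
  rw [h1, hX.lintegral_draw l hΦ]
  set c : ℝ := C * (r ^ l * (1 + s₀ + 1 / s₀)) / b with hc
  have hc0 : 0 ≤ c := by positivity
  have h2 : ∀ᵐ ω ∂μ, ∫⁻ d, S.indicator 1 (ω, d) ∂(μ.map fun ω => (X ω).draw l)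
      ≤ ENNReal.ofReal (B / b) + ENNReal.ofReal c *
        {ω | P.Reached γ c₁ c₂ z₀ (X ω) l}.indicator (fun ω => ENNReal.ofReal
          (P.Delta γ ((X ω).s l) (P.start γ c₁ c₂ z₀ (X ω) l) w)) ω := by
    filter_upwards [hB, hX.s_bound hr hpos] with ω hbd hsb
    by_cases hl : P.Reached γ c₁ c₂ z₀ (X ω) l
    · have hd := P.dom_of_bounded (hbd l hl).1.2 (hbd l hl).2.2
      have hadm : P.Admissible γ ((X ω).s l) (P.start γ c₁ c₂ z₀ (X ω) l) w :=
        ⟨hγ, hγ', hpos ω l, hd.1, hw⟩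
      have hΔ := P.Delta_nonneg hγ (hpos ω l) hw hd.1
      have hs := hpos ω l
      set K := ⌈b / θ ω⌉₊ with hK
      have hKθ : b ≤ K * θ ω := by
        rw [← div_le_iff₀ (hθ0 ω)]
        exact Nat.le_ceil _
      have hK1 : 1 ≤ K := Nat.ceil_pos.2 (div_pos hb (hθ0 ω))
      rw [Set.indicator_of_mem (show ω ∈ {ω | P.Reached γ c₁ c₂ z₀ (X ω) l} from hl)]
      calc _ ≤ ∫⁻ d, {d | (θ ω : EReal) < P.testGap γ c₁ c₂ ((X ω).s l)
              (P.start γ c₁ c₂ z₀ (X ω) l) d K}.indicator 1 d ∂(μ.map fun ω => (X ω).draw l) := by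
            refine lintegral_mono fun d => ?_
            by_cases hd : (ω, d) ∈ S
            · rw [Set.indicator_of_mem hd, Set.indicator_of_mem (show d ∈ {d | (θ ω : EReal)
                < P.testGap γ c₁ c₂ ((X ω).s l) (P.start γ c₁ c₂ z₀ (X ω) l) d K} from hd.2)]
              exact le_rfl
            · rw [Set.indicator_of_notMem hd]
              exact zero_le
        _ ≤ _ := lintegral_indicator_one_le _
        _ = _ := (hX.isDrawLaw_map l).measure_lt_testGap γ c₁ c₂ _ _ _ _
        _ ≤ ENNReal.ofReal (B / b + c * P.Delta γ ((X ω).s l) (P.start γ c₁ c₂ z₀ (X ω) l) w) := by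
            refine ENNReal.ofReal_le_ofReal
              ((htail _ _ hadm hd.2.1 hd.2.2 K hK1 _ (hθ0 ω)).trans ?_)
            have h3 : C * (1 + (X ω).s l + 1 / (X ω).s l)
                * P.Delta γ ((X ω).s l) (P.start γ c₁ c₂ z₀ (X ω) l) w
                ≤ C * (r ^ l * (1 + s₀ + 1 / s₀))
                * P.Delta γ ((X ω).s l) (P.start γ c₁ c₂ z₀ (X ω) l) w := by
              have := hsb l hl
              gcongr
            rw [hc, div_mul_eq_mul_div, ← add_div]
            gcongr
        _ = _ := by rw [ENNReal.ofReal_add (by positivity) (by positivity),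
              ENNReal.ofReal_mul hc0]
    · have e : ∀ d, S.indicator (1 : Ω × (ℕ → Fin n) → ENNReal) (ω, d) = 0 := fun d =>
        Set.indicator_of_notMem (fun h => hl h.1) _
      simp [e]
  have h3 := hX.lintegral_Delta_start_le hB hg hγ hγ' hr hpos hw l
  have hΔ0 := P.Delta_nonneg hγ hs₀ hw hz₀
  calc _ ≤ ∫⁻ ω, (ENNReal.ofReal (B / b) + ENNReal.ofReal c *
        {ω | P.Reached γ c₁ c₂ z₀ (X ω) l}.indicator (fun ω => ENNReal.ofReal
          (P.Delta γ ((X ω).s l) (P.start γ c₁ c₂ z₀ (X ω) l) w)) ω) ∂μ := lintegral_mono_ae h2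
    _ = ENNReal.ofReal (B / b) + ENNReal.ofReal c * ∫⁻ ω,
        {ω | P.Reached γ c₁ c₂ z₀ (X ω) l}.indicator (fun ω => ENNReal.ofReal
          (P.Delta γ ((X ω).s l) (P.start γ c₁ c₂ z₀ (X ω) l) w)) ω ∂μ := by
        rw [lintegral_add_left measurable_const, lintegral_const, measure_univ, mul_one,
          lintegral_const_mul' _ _ ENNReal.ofReal_ne_top]
    _ ≤ ENNReal.ofReal (B / b)
        + ENNReal.ofReal c * ENNReal.ofReal (r ^ l * P.Delta γ s₀ z₀ w) :=
        add_le_add le_rfl (mul_le_mul_right h3 _)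
    _ = _ := by
        rw [← ENNReal.ofReal_mul hc0, ← ENNReal.ofReal_add (by positivity) (by positivity), hc]
        congr 1
        rw [two_mul, pow_add]
        ring

/-- The union bound over the loops. If the loop `l` is given a share `q l` of the admissible
probability of failure `ρ`, then with probability at least `1 - ρ` the tested gap after a number of
iterations inversely proportional to `ρ * q l * θ l` is at most `θ l` in each of the first `N` loops
that is reached. -/
lemma IsRun.le_measure_of_forall_gapAt_le [IsProbabilityMeasure μ]
    (hX : P.IsRun γ c₁ c₂ z₀ s₀ ε₀ δ r μ 𝓖 X)
    (hB : P.IsBoundedRun γ c₁ c₂ z₀ M μ X)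
    (hγ : 0 < γ) (hγ' : γ < 1) (hr : 1 ≤ r) (hs₀ : 0 < s₀)
    (hw : P.IsSaddle w) (hz₀ : P.DomX z₀.x) (hB0 : 0 < B) (hC : 0 < C)
    (htail : P.TailBound γ c₁ c₂ M B C w) {θ : ℕ → Ω → ℝ} (hθ : ∀ l, Measurable[𝓖 l] (θ l))
    (hθ0 : ∀ l ω, 0 < θ l ω) {N : ℕ} {q : ℕ → ℝ} (hq : ∀ l < N, 0 < q l)
    (hq1 : ∑ l ∈ Finset.range N, q l ≤ 1) {ρ : ℝ} (hρ : 0 < ρ) {E : Choices n → Prop}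
    (hE : ∀ᵐ ω ∂μ, (∀ l < N, P.Reached γ c₁ c₂ z₀ (X ω) l →
      P.gapAt γ c₁ c₂ z₀ (X ω) l ⌈(B + C * (1 + s₀ + 1 / s₀) * r ^ (2 * l) * P.Delta γ s₀ z₀ w)
        / (ρ * q l) / θ l ω⌉₊ ≤ (θ l ω : EReal)) → E (X ω)) :
    ENNReal.ofReal (1 - ρ) ≤ μ {ω | E (X ω)} := by
  have hg : ∀ j, IsClosedConvex (conj (P.g j)) := fun j =>
    isClosedConvex_conj (P.g_closed j) ⟨w.y j, hw.domY j⟩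
  have hr0 : 0 < r := by linarith
  have hΔ0 := P.Delta_nonneg hγ hs₀ hw hz₀
  set a : ℕ → ℝ := fun l => B + C * (1 + s₀ + 1 / s₀) * r ^ (2 * l) * P.Delta γ s₀ z₀ w with ha
  have ha0 : ∀ l, 0 < a l := fun l => by
    have : 0 ≤ C * (1 + s₀ + 1 / s₀) * r ^ (2 * l) * P.Delta γ s₀ z₀ w := by positivity
    simp only [ha]
    linarith
  set bad : ℕ → Set Ω := fun l => {ω | P.Reached γ c₁ c₂ z₀ (X ω).posS l ∧
    (θ l ω : EReal) < P.gapAt γ c₁ c₂ z₀ (X ω).posS l ⌈a l / (ρ * q l) / θ l ω⌉₊} with hbad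
  have hbadle : ∀ l ∈ Finset.range N, μ (bad l) ≤ ENNReal.ofReal (ρ * q l) := fun l hl => by
    have hql := hq l (Finset.mem_range.1 hl)
    refine ((hX.posS hs₀).measure_lt_gapAt_le (hB.posS hX hs₀) hg hγ hγ' hr hs₀
      (fun ω l => (X ω).posS_s_pos l) hw hz₀ hB0 hC htail (hθ l) (hθ0 l)
      (div_pos (ha0 l) (mul_pos hρ hql))).trans (le_of_eq ?_)
    congr 1
    have := (ha0 l).ne'
    change a l / (a l / (ρ * q l)) = ρ * q l
    field_simp
  have hcover : ∀ᵐ ω ∂μ, ω ∈ {ω | E (X ω)} ∪ ⋃ l ∈ Finset.range N, bad l := by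
    filter_upwards [hE, hX.ae_s_pos hs₀] with ω h hs
    by_cases hall : ∀ l < N, P.Reached γ c₁ c₂ z₀ (X ω) l →
        P.gapAt γ c₁ c₂ z₀ (X ω) l ⌈a l / (ρ * q l) / θ l ω⌉₊ ≤ (θ l ω : EReal)
    · exact Or.inl (h hall)
    · push Not at hall
      obtain ⟨l, hl, hre, hlt⟩ := hall
      refine Or.inr (Set.mem_biUnion (Finset.mem_coe.2 (Finset.mem_range.2 hl)) ?_)
      refine ⟨(P.posS_agree hs l).1.2 hre, ?_⟩
      rw [P.posS_gapAt hs hre]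
      exact hlt
  have h1 : 1 ≤ μ {ω | E (X ω)} + ENNReal.ofReal ρ := by
    calc (1 : ENNReal) = μ Set.univ := measure_univ.symm
      _ ≤ μ ({ω | E (X ω)} ∪ ⋃ l ∈ Finset.range N, bad l) :=
          measure_mono_ae (hcover.mono fun ω h _ => h)
      _ ≤ μ {ω | E (X ω)} + ∑ l ∈ Finset.range N, μ (bad l) :=
          (measure_union_le _ _).trans (add_le_add le_rfl (measure_biUnion_finset_le _ _))
      _ ≤ μ {ω | E (X ω)} + ∑ l ∈ Finset.range N, ENNReal.ofReal (ρ * q l) :=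
          add_le_add le_rfl (Finset.sum_le_sum hbadle)
      _ ≤ _ := by
          rw [← ENNReal.ofReal_sum_of_nonneg fun l hl =>
            (mul_pos hρ (hq l (Finset.mem_range.1 hl))).le, ← Finset.mul_sum]
          exact add_le_add le_rfl (ENNReal.ofReal_le_ofReal (by nlinarith))
  rw [ENNReal.ofReal_sub _ hρ.le, ENNReal.ofReal_one]
  exact tsub_le_iff_right.2 h1

end Run

/-! ### Counting the iterations of a good run -/

section Counting

variable {γ c₁ c₂ s₀ ε₀ δ r M C B : ℝ} {z₀ w : Point n m} {X : Choices n}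

lemma len_le_of_gapAt_le {l k : ℕ} (hk : 1 ≤ k)
    (h : P.gapAt γ c₁ c₂ z₀ X l k ≤ (X.thr l : EReal)) :
    1 ≤ P.len γ c₁ c₂ z₀ X l ∧ P.len γ c₁ c₂ z₀ X l ≤ k := by
  have hmem : k ∈ {k : ℕ | 1 ≤ k ∧ P.testGap γ c₁ c₂ (X.s l) (P.start γ c₁ c₂ z₀ X l) (X.draw l) k
      ≤ (X.thr l : EReal)} := ⟨hk, h⟩
  exact ⟨(Nat.sInf_mem ⟨k, hmem⟩).1, Nat.sInf_le hmem⟩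

lemma gapAt_len_le {l : ℕ} (h : 1 ≤ P.len γ c₁ c₂ z₀ X l) :
    P.gapAt γ c₁ c₂ z₀ X l (P.len γ c₁ c₂ z₀ X l) ≤ (X.thr l : EReal) :=
  (Nat.sInf_mem (Nat.nonempty_of_pos_sInf h)).2

variable {P} in
lemma GapWithin.mono {η η' N N' : ℝ} (h : P.GapWithin γ c₁ c₂ z₀ X η N) (hη : η ≤ η')
    (hN : N ≤ N') : P.GapWithin γ c₁ c₂ z₀ X η' N' := by
  obtain ⟨l, k, h1, h2, h3⟩ := h
  exact ⟨l, k, h1, h2.trans (EReal.coe_le_coe_iff.2 hη), h3.trans hN⟩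

/-- If the threshold of the loop `L` is at most `η` and if the tested gap after `K l` iterations is
at most the larger of the threshold and `η`, then the tested gap reaches `η` during some loop
`l' ≤ L`, the first one whose threshold is at most `η`, and the previous thresholds increase
geometrically from `η` when read backwards. -/
lemma exists_gapWithin {η : ℝ} {L : ℕ} (hδ : 0 < δ)
    (hthr : ∀ l, P.Reached γ c₁ c₂ z₀ X (l + 1) → X.thr (l + 1) ≤ δ * X.thr l)
    (hL : P.Reached γ c₁ c₂ z₀ X L → X.thr L ≤ η) {K : ℕ → ℕ} (hK : ∀ l ≤ L, 1 ≤ K l)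
    (hgood : ∀ l ≤ L, P.Reached γ c₁ c₂ z₀ X l →
      P.gapAt γ c₁ c₂ z₀ X l (K l) ≤ ((max (X.thr l) η : ℝ) : EReal)) :
    ∃ l' ≤ L, (∀ l < l', η ≤ δ ^ (l' - 1 - l) * X.thr l) ∧
      ∀ N : ℝ, ((∑ l ∈ Finset.range (l' + 1), K l : ℕ) : ℝ) ≤ N →
        P.GapWithin γ c₁ c₂ z₀ X η N := by
  classical
  -- unreached loops satisfy the condition, so minimality shows that all loops before `l'` are reached
  have hex : ∃ l, P.Reached γ c₁ c₂ z₀ X l → X.thr l ≤ η := ⟨L, hL⟩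
  set l' := Nat.find hex with hl'
  have hl'L : l' ≤ L := Nat.find_min' hex hL
  have hlt : ∀ l < l', P.Reached γ c₁ c₂ z₀ X l ∧ η < X.thr l := fun l hl => by
    have := Nat.find_min hex hl
    push Not at this
    exact this
  have hlen : ∀ l < l', 1 ≤ P.len γ c₁ c₂ z₀ X l ∧ P.len γ c₁ c₂ z₀ X l ≤ K l := fun l hl => by
    have h1 := hgood l (hl.le.trans hl'L) (hlt l hl).1
    rw [max_eq_left (hlt l hl).2.le] at h1
    exact P.len_le_of_gapAt_le (hK l (hl.le.trans hl'L)) h1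
  have hre : P.Reached γ c₁ c₂ z₀ X l' := fun l hl => (hlen l hl).1
  have hthr' := Nat.find_spec hex hre
  refine ⟨l', hl'L, fun l hl => ?_, fun N hN => ?_⟩
  · have key : ∀ t, l + t < l' → X.thr (l + t) ≤ δ ^ t * X.thr l := fun t => by
      induction t with
      | zero => intro _; simp
      | succ t ih =>
        intro ht
        calc X.thr (l + t + 1) ≤ δ * X.thr (l + t) := hthr _ (hlt _ ht).1
          _ ≤ δ * (δ ^ t * X.thr l) := mul_le_mul_of_nonneg_left (ih (by omega)) hδ.le
          _ = _ := by ring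
    have h1 := key (l' - 1 - l) (by omega)
    exact ((hlt _ (show l + (l' - 1 - l) < l' by omega)).2.trans_le h1).le
  · have h1 := hgood l' hl'L hre
    rw [max_eq_right hthr'] at h1
    have hex' : ∃ k, 1 ≤ k ∧ P.gapAt γ c₁ c₂ z₀ X l' k ≤ (η : EReal) := ⟨K l', hK l' hl'L, h1⟩
    refine ⟨l', Nat.find hex', ⟨hre, (Nat.find_spec hex').1, fun k' hk' hk'' => ?_⟩,
      (Nat.find_spec hex').2, le_trans ?_ hN⟩
    · have h2 := Nat.find_min hex' hk''
      push Not at h2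
      exact (EReal.coe_le_coe_iff.2 hthr').trans_lt (h2 hk')
    · rw [Finset.sum_range_succ]
      have h2 : Nat.find hex' ≤ K l' := Nat.find_min' hex' ⟨hK l' hl'L, h1⟩
      have h3 := Finset.sum_le_sum fun l hl => (hlen l (Finset.mem_range.1 hl)).2
      exact_mod_cast add_le_add h3 h2

variable {P}

variable (P) in
/-- The standing assumptions on the parameters, together with the tail bound. -/
structure Setting (γ c₁ c₂ s₀ ε₀ δ r M B C : ℝ) (z₀ w : Point n m) : Prop where
  γ_pos : 0 < γ
  γ_lt_one : γ < 1
  δ_pos : 0 < δ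
  δ_lt_one : δ < 1
  one_le_r : 1 ≤ r
  s₀_pos : 0 < s₀
  ε₀_pos : 0 < ε₀
  saddle : P.IsSaddle w
  dom : P.DomX z₀.x
  B_pos : 0 < B
  C_pos : 0 < C
  tail : P.TailBound γ c₁ c₂ M B C w

lemma Setting.Delta_nonneg (S : P.Setting γ c₁ c₂ s₀ ε₀ δ r M B C z₀ w) :
    0 ≤ P.Delta γ s₀ z₀ w :=
  P.Delta_nonneg S.γ_pos S.s₀_pos S.saddle S.dom

/-- The tested gap reaches `δ ^ L * ε₀` within the number of iterations allotted to the loops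
`0, …, L`, when the loop `l` gets the share `q l` of the admissible probability of failure. -/
lemma Setting.withProb_gapWithin (S : P.Setting γ c₁ c₂ s₀ ε₀ δ r M B C z₀ w) {L : ℕ}
    {q : ℕ → ℝ} (hq : ∀ l < L + 1, 0 < q l)
    (hq1 : ∑ l ∈ Finset.range (L + 1), q l ≤ 1) {ρ N : ℝ} (hρ : 0 < ρ)
    {a : ℕ → ℝ} (ha : ∀ l, a l = B + C * (1 + s₀ + 1 / s₀) * r ^ (2 * l) * P.Delta γ s₀ z₀ w)
    (hN : ∀ l' ≤ L, ∑ l ∈ Finset.range l', a l / (ρ * q l) * (δ ^ (l' - 1 - l) / (δ ^ L * ε₀))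
      + a l' / (ρ * q l') / (δ ^ L * ε₀) + (l' + 1) ≤ N) :
    P.WithProb.{u} γ c₁ c₂ z₀ s₀ ε₀ δ r M ρ fun X =>
      P.GapWithin γ c₁ c₂ z₀ X (δ ^ L * ε₀) N := by
  intro Ω _ μ _ 𝓖 X hX hB
  obtain ⟨hγ, hγ', hδ, -, hr, hs₀, hε₀, hw, hz₀, hB0, hC, htail⟩ := S
  have hη : 0 < δ ^ L * ε₀ := by positivity
  have hΔ0 := P.Delta_nonneg hγ hs₀ hw hz₀
  have hr0 : 0 < r := by linarith
  have ha0 : ∀ l, 0 < a l := fun l => by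
    have : 0 ≤ C * (1 + s₀ + 1 / s₀) * r ^ (2 * l) * P.Delta γ s₀ z₀ w := by positivity
    rw [ha]
    linarith
  refine hX.le_measure_of_forall_gapAt_le hB hγ hγ' hr hs₀ hw hz₀ hB0 hC htail
    (E := fun X => P.GapWithin γ c₁ c₂ z₀ X (δ ^ L * ε₀) N)
    (θ := fun l ω => max ((X ω).thr l) (δ ^ L * ε₀))
    (fun l => (hX.thr_past l).max measurable_const) (fun l ω => lt_max_of_lt_right hη) hq hq1 hρ ?_
  filter_upwards [hX.thr_next] with ω hthr hgood
  have hthr' : ∀ l, P.Reached γ c₁ c₂ z₀ (X ω) l → (X ω).thr l ≤ δ ^ l * ε₀ := fun l => by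
    induction l with
    | zero => intro _; rw [hX.thr_zero, pow_zero, one_mul]
    | succ l ih =>
      intro hl
      calc _ ≤ δ * (X ω).thr l := (hthr l hl).2
        _ ≤ δ * (δ ^ l * ε₀) := mul_le_mul_of_nonneg_left (ih (P.reached_succ.1 hl).1) hδ.le
        _ = _ := by ring
  have hpos : ∀ l ≤ L, 0 < a l / (ρ * q l) := fun l hl =>
    div_pos (ha0 l) (mul_pos hρ (hq l (by omega)))
  obtain ⟨l', hl'L, hback, hgap⟩ := P.exists_gapWithin hδ (fun l hl => (hthr l hl).2) (hthr' L)
    (K := fun l => ⌈a l / (ρ * q l) / max ((X ω).thr l) (δ ^ L * ε₀)⌉₊)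
    (fun l hl => Nat.ceil_pos.2 (div_pos (hpos l hl) (lt_max_of_lt_right hη))) (fun l hl hre => by
      rw [ha l]
      exact hgood l (by omega) hre)
  refine hgap N (le_trans ?_ (hN l' hl'L))
  have hceil : ∀ l ≤ L, ∀ t : ℝ, 0 < t → t ≤ max ((X ω).thr l) (δ ^ L * ε₀) →
      ((⌈a l / (ρ * q l) / max ((X ω).thr l) (δ ^ L * ε₀)⌉₊ : ℕ) : ℝ)
        ≤ a l / (ρ * q l) / t + 1 := fun l hl t ht htle => by
    have h := hpos l hl
    have hmax : 0 < max ((X ω).thr l) (δ ^ L * ε₀) := ht.trans_le htle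
    refine (Nat.ceil_lt_add_one (div_pos h hmax).le).le.trans ?_
    gcongr
  rw [Finset.sum_range_succ, Nat.cast_add, Nat.cast_sum]
  have h1 := hceil l' hl'L (δ ^ L * ε₀) hη (le_max_right _ _)
  have h2 : ∑ l ∈ Finset.range l',
        ((⌈a l / (ρ * q l) / max ((X ω).thr l) (δ ^ L * ε₀)⌉₊ : ℕ) : ℝ)
      ≤ ∑ l ∈ Finset.range l', (a l / (ρ * q l) * (δ ^ (l' - 1 - l) / (δ ^ L * ε₀)) + 1) := by
    refine Finset.sum_le_sum fun l hl => ?_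
    have hl := Finset.mem_range.1 hl
    have hp : 0 < δ ^ (l' - 1 - l) := by positivity
    have h3 := hceil l (hl.le.trans hl'L) (δ ^ L * ε₀ / δ ^ (l' - 1 - l)) (by positivity)
      (le_max_of_le_left (by rw [div_le_iff₀' hp]; exact hback l hl))
    rwa [div_div_eq_mul_div, mul_div_assoc] at h3
  rw [Finset.sum_add_distrib, Finset.sum_const, Finset.card_range, nsmul_eq_mul, mul_one] at h2
  linarith

end Counting

end Problem
end PureCD

namespace PureCD

/-! ### Comparison with the bounds of the theorem -/

lemma iterBound_eq {C₃ C₅ D ε₀ δ r ρ : ℝ} (hδ : 0 < δ) (hδ' : δ < 1) (hr : 1 ≤ r) (L : ℕ) :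
    iterBound C₃ C₅ D ε₀ δ r ρ L = L / (ρ * ε₀) * (C₃ * ∑ e ∈ Finset.range L, δ⁻¹ ^ e
      + C₅ * D * ∑ e ∈ Finset.range L, (r ^ 2 / δ) ^ e) + L := by
  have h1 : δ⁻¹ ≠ 1 := ((one_lt_inv₀ hδ).2 hδ').ne'
  have h2 : r ^ 2 / δ ≠ 1 := ne_of_gt ((one_lt_div hδ).2 (by nlinarith))
  rw [iterBound, ← geom_sum_eq h1, ← geom_sum_eq h2]
  ring

lemma geom_tail_le {x : ℝ} (hx : 0 ≤ x) {L l' : ℕ} (hl' : l' ≤ L) :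
    ∑ l ∈ Finset.range l', x ^ (L + 1 - l' + l) + x ^ L
      ≤ 2 * ∑ e ∈ Finset.range (L + 1), x ^ e := by
  have h1 : ∑ e ∈ Finset.range (L + 1), x ^ e = ∑ e ∈ Finset.range (L + 1 - l'), x ^ e
      + ∑ l ∈ Finset.range l', x ^ (L + 1 - l' + l) := by
    rw [← Finset.sum_range_add]
    congr 2
    omega
  have h2 : x ^ L ≤ ∑ e ∈ Finset.range (L + 1), x ^ e :=
    Finset.single_le_sum (f := fun e => x ^ e) (fun e _ => pow_nonneg hx e)
      (Finset.mem_range.2 L.lt_succ_self)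
  have h3 : 0 ≤ ∑ e ∈ Finset.range (L + 1 - l'), x ^ e :=
    Finset.sum_nonneg fun e _ => pow_nonneg hx e
  linarith

namespace Problem

variable {n m : ℕ} {P : Problem n m} {γ c₁ c₂ s₀ ε₀ δ r M B C : ℝ} {z₀ w : Point n m}

lemma WithProb.mono {ρ : ℝ} {E E' : Choices n → Prop}
    (h : P.WithProb.{u} γ c₁ c₂ z₀ s₀ ε₀ δ r M ρ E) (hE : ∀ X, E X → E' X) :
    P.WithProb.{u} γ c₁ c₂ z₀ s₀ ε₀ δ r M ρ E' :=
  fun Ω _ μ _ 𝓖 X hX hB => (h Ω μ 𝓖 X hX hB).trans (measure_mono fun ω hω => hE (X ω) hω)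

namespace Setting

/-- Equal shares of the probability of failure. -/
lemma withProb_gapWithin_iterBound (S : P.Setting γ c₁ c₂ s₀ ε₀ δ r M B C z₀ w) {ρ : ℝ}
    (hρ : 0 < ρ) (L : ℕ) :
    P.WithProb.{u} γ c₁ c₂ z₀ s₀ ε₀ δ r M ρ fun X =>
      P.GapWithin γ c₁ c₂ z₀ X (δ ^ L * ε₀) (iterBound (2 * B) (2 * (C * (1 + s₀ + 1 / s₀)))
        (P.Delta γ s₀ z₀ w) ε₀ δ r ρ (L + 1)) := by
  have hD := S.Delta_nonneg
  have hδ := S.δ_pos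
  have hε₀ := S.ε₀_pos
  have hs₀ := S.s₀_pos
  have hB := S.B_pos
  have hC := S.C_pos
  have hr0 : 0 < r := by linarith [S.one_le_r]
  set D := P.Delta γ s₀ z₀ w
  set T := C * (1 + s₀ + 1 / s₀) with hT
  have hT0 : 0 < T := by positivity
  refine S.withProb_gapWithin (q := fun _ => 1 / (L + 1)) (fun _ _ => by positivity)
    (by rw [Finset.sum_const, Finset.card_range, nsmul_eq_mul]; push_cast; field_simp; exact le_rfl)
    hρ (a := fun l => B + T * r ^ (2 * l) * D) (fun l => rfl) fun l' hl' => ?_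
  rw [iterBound_eq hδ S.δ_lt_one S.one_le_r]
  -- the factor of `B` and `T * D` in the contribution of a loop, in terms of `e ≥ l`
  have hterm : ∀ l e : ℕ, l ≤ e → (B + T * r ^ (2 * l) * D) * δ⁻¹ ^ e
      ≤ B * δ⁻¹ ^ e + T * D * (r ^ 2 / δ) ^ e := fun l e hle => by
    have h1 : r ^ (2 * l) ≤ (r ^ 2) ^ e := by
      rw [← pow_mul]
      exact pow_le_pow_right₀ S.one_le_r (by omega)
    calc (B + T * r ^ (2 * l) * D) * δ⁻¹ ^ e
        = B * δ⁻¹ ^ e + T * D * (r ^ (2 * l) * δ⁻¹ ^ e) := by ring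
      _ ≤ B * δ⁻¹ ^ e + T * D * ((r ^ 2) ^ e * δ⁻¹ ^ e) := by gcongr
      _ = _ := by rw [← mul_pow, ← div_eq_mul_inv]
  have h1 : ∀ l ∈ Finset.range l', (B + T * r ^ (2 * l) * D) / (ρ * (1 / (L + 1)))
      * (δ ^ (l' - 1 - l) / (δ ^ L * ε₀)) ≤ (L + 1) / (ρ * ε₀)
        * (B * δ⁻¹ ^ (L + 1 - l' + l) + T * D * (r ^ 2 / δ) ^ (L + 1 - l' + l)) := fun l hl => by
    have hl := Finset.mem_range.1 hl
    have h2 : δ ^ (l' - 1 - l) / δ ^ L = δ⁻¹ ^ (L + 1 - l' + l) := by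
      rw [inv_pow, div_eq_iff (by positivity), inv_mul_eq_div, eq_div_iff (by positivity),
        ← pow_add]
      congr 1
      omega
    calc _ = (L + 1) / (ρ * ε₀) * ((B + T * r ^ (2 * l) * D)
          * (δ ^ (l' - 1 - l) / δ ^ L)) := by field_simp
      _ ≤ _ := by
        rw [h2]
        exact mul_le_mul_of_nonneg_left (hterm _ _ (by omega)) (by positivity)
  have h2 : (B + T * r ^ (2 * l') * D) / (ρ * (1 / (L + 1))) / (δ ^ L * ε₀)
      ≤ (L + 1) / (ρ * ε₀) * (B * δ⁻¹ ^ L + T * D * (r ^ 2 / δ) ^ L) := by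
    calc _ = (L + 1) / (ρ * ε₀) * ((B + T * r ^ (2 * l') * D) * δ⁻¹ ^ L) := by
          rw [inv_pow]; field_simp
      _ ≤ _ := mul_le_mul_of_nonneg_left (hterm _ _ hl') (by positivity)
  have h3 := Finset.sum_le_sum h1
  have h4 := geom_tail_le (x := δ⁻¹) (by positivity) hl'
  have h5 := geom_tail_le (x := r ^ 2 / δ) (by positivity) hl'
  rw [← Finset.mul_sum, Finset.sum_add_distrib, ← Finset.mul_sum, ← Finset.mul_sum] at h3
  have h6 : (L + 1) / (ρ * ε₀) * (B * (∑ l ∈ Finset.range l', δ⁻¹ ^ (L + 1 - l' + l) + δ⁻¹ ^ L)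
      + T * D * (∑ l ∈ Finset.range l', (r ^ 2 / δ) ^ (L + 1 - l' + l) + (r ^ 2 / δ) ^ L))
      ≤ (L + 1) / (ρ * ε₀) * (B * (2 * ∑ e ∈ Finset.range (L + 1), δ⁻¹ ^ e)
        + T * D * (2 * ∑ e ∈ Finset.range (L + 1), (r ^ 2 / δ) ^ e)) := by gcongr
  have h7 : (l' : ℝ) ≤ L := by exact_mod_cast hl'
  push_cast
  linarith

/-- With prescribed thresholds the number of iterations allotted to each loop is deterministic. -/
lemma withProb_sum_len_le (S : P.Setting γ c₁ c₂ s₀ ε₀ δ r M B C z₀ w) {ρ : ℝ}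
    (hρ : 0 < ρ) (L : ℕ) :
    P.WithProb.{u} γ c₁ c₂ z₀ s₀ ε₀ δ r M ρ fun X =>
      (∀ l < L, P.Reached γ c₁ c₂ z₀ X l → X.thr l = δ ^ l * ε₀) →
      P.Reached γ c₁ c₂ z₀ X L ∧
      (∀ l < L, P.gapAt γ c₁ c₂ z₀ X l (P.len γ c₁ c₂ z₀ X l) ≤ ((δ ^ l * ε₀ : ℝ) : EReal)) ∧
      ((∑ l ∈ Finset.range L, P.len γ c₁ c₂ z₀ X l : ℕ) : ℝ)
        ≤ iterBound (2 * B) (2 * (C * (1 + s₀ + 1 / s₀))) (P.Delta γ s₀ z₀ w) ε₀ δ r ρ L := by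
  intro Ω _ μ _ 𝓖 X hX hBd
  have hD := S.Delta_nonneg
  have hδ := S.δ_pos
  have hε₀ := S.ε₀_pos
  have hs₀ := S.s₀_pos
  have hB := S.B_pos
  have hC := S.C_pos
  have hr0 : 0 < r := by linarith [S.one_le_r]
  refine hX.le_measure_of_forall_gapAt_le hBd S.γ_pos S.γ_lt_one S.one_le_r S.s₀_pos S.saddle S.dom
    S.B_pos S.C_pos S.tail (N := L) (q := fun _ => 1 / L)
    (E := fun X => (∀ l < L, P.Reached γ c₁ c₂ z₀ X l → X.thr l = δ ^ l * ε₀) →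
      P.Reached γ c₁ c₂ z₀ X L ∧
      (∀ l < L, P.gapAt γ c₁ c₂ z₀ X l (P.len γ c₁ c₂ z₀ X l) ≤ ((δ ^ l * ε₀ : ℝ) : EReal)) ∧
      ((∑ l ∈ Finset.range L, P.len γ c₁ c₂ z₀ X l : ℕ) : ℝ)
        ≤ iterBound (2 * B) (2 * (C * (1 + s₀ + 1 / s₀))) (P.Delta γ s₀ z₀ w) ε₀ δ r ρ L)
    (θ := fun l _ => δ ^ l * ε₀) (fun l => measurable_const) (fun l _ => by positivity)
    (fun l hl => ?_) ?_ hρ (Filter.Eventually.of_forall fun ω hgood hthr => ?_)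
  · have : (0 : ℝ) < L := by exact_mod_cast (Nat.zero_le l).trans_lt hl
    positivity
  · rw [Finset.sum_const, Finset.card_range, nsmul_eq_mul]
    rw [mul_one_div]
    exact div_self_le_one _
  set D := P.Delta γ s₀ z₀ w
  set T := C * (1 + s₀ + 1 / s₀) with hT
  have hT0 : 0 < T := by positivity
  have hpos : ∀ l < L, 0 < (B + T * r ^ (2 * l) * D) / (ρ * (1 / L)) / (δ ^ l * ε₀) :=
      fun l hl => by
    have : (0 : ℝ) < L := by exact_mod_cast (Nat.zero_le l).trans_lt hl
    positivity
  have hlen : ∀ l < L, P.Reached γ c₁ c₂ z₀ (X ω) l → 1 ≤ P.len γ c₁ c₂ z₀ (X ω) l ∧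
      P.len γ c₁ c₂ z₀ (X ω) l ≤ ⌈(B + T * r ^ (2 * l) * D) / (ρ * (1 / L)) / (δ ^ l * ε₀)⌉₊ :=
    fun l hl hre => P.len_le_of_gapAt_le (Nat.ceil_pos.2 (hpos l hl))
      (by rw [hthr l hl hre]; exact hgood l hl hre)
  have hre : ∀ l ≤ L, P.Reached γ c₁ c₂ z₀ (X ω) l := fun l => by
    induction l with
    | zero => exact fun _ => P.reached_zero _
    | succ l ih => exact fun hl => P.reached_succ.2 ⟨ih (by omega), (hlen l hl (ih (by omega))).1⟩
  refine ⟨hre L le_rfl, fun l hl => ?_, ?_⟩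
  · rw [← hthr l hl (hre l hl.le)]
    exact P.gapAt_len_le (hlen l hl (hre l hl.le)).1
  · rw [iterBound_eq hδ S.δ_lt_one S.one_le_r, Nat.cast_sum]
    have h1 : ∀ l ∈ Finset.range L, (P.len γ c₁ c₂ z₀ (X ω) l : ℝ)
        ≤ L / (ρ * ε₀) * (B * δ⁻¹ ^ l + T * D * (r ^ 2 / δ) ^ l) + 1 := fun l hl => by
      have hl := Finset.mem_range.1 hl
      have hL : (0 : ℝ) < L := by exact_mod_cast (Nat.zero_le l).trans_lt hl
      have h2 : (P.len γ c₁ c₂ z₀ (X ω) l : ℝ) ≤ _ :=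
        Nat.cast_le.2 (hlen l hl (hre l hl.le)).2
      refine h2.trans ((Nat.ceil_lt_add_one (hpos l hl).le).le.trans (le_of_eq ?_))
      rw [div_pow, inv_pow, ← pow_mul]
      field_simp
    refine (Finset.sum_le_sum h1).trans ?_
    rw [Finset.sum_add_distrib, ← Finset.mul_sum, Finset.sum_add_distrib, ← Finset.mul_sum,
      ← Finset.mul_sum, Finset.sum_const, Finset.card_range, nsmul_eq_mul, mul_one]
    have h3 : 0 ≤ B * ∑ l ∈ Finset.range L, δ⁻¹ ^ l := by positivity
    have h4 : 0 ≤ T * D * ∑ l ∈ Finset.range L, (r ^ 2 / δ) ^ l := by positivity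
    have h5 : L / (ρ * ε₀) * (B * ∑ l ∈ Finset.range L, δ⁻¹ ^ l
        + T * D * ∑ l ∈ Finset.range L, (r ^ 2 / δ) ^ l)
        ≤ L / (ρ * ε₀) * (2 * B * ∑ l ∈ Finset.range L, δ⁻¹ ^ l
        + 2 * T * D * ∑ l ∈ Finset.range L, (r ^ 2 / δ) ^ l) :=
      mul_le_mul_of_nonneg_left (by linarith) (by positivity)
    linarith

end Setting

/-- The bound for `L + 1` loops is a bound for `L` loops with larger constants. -/
lemma _root_.PureCD.iterBound_succ_le {C₃ C₅ D ε₀ δ r ρ : ℝ} (hδ : 0 < δ) (hδ' : δ < 1)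
    (hr : 1 ≤ r) (hC₃ : 0 ≤ C₃) (hC₅ : 0 ≤ C₅) (hD : 0 ≤ D) (hε₀ : 0 < ε₀) (hρ : 0 < ρ)
    (hρ' : ρ < 1) {L : ℕ} (hL : 1 ≤ L) :
    iterBound C₃ C₅ D ε₀ δ r ρ (L + 1)
      ≤ iterBound (2 * (1 + δ⁻¹) * C₃ + ε₀) (2 * (1 + r ^ 2 / δ) * C₅) D ε₀ δ r ρ L := by
  have hgeom : ∀ {x : ℝ}, 0 ≤ x → ∑ e ∈ Finset.range (L + 1), x ^ e
      ≤ (1 + x) * ∑ e ∈ Finset.range L, x ^ e := fun {x} hx => by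
    obtain ⟨k, rfl⟩ := Nat.exists_eq_add_of_le' hL
    have h := Finset.single_le_sum (f := fun e => x ^ e) (fun e _ => pow_nonneg hx e)
      (Finset.mem_range.2 k.lt_succ_self)
    rw [Finset.sum_range_succ, pow_succ]
    nlinarith
  have hr0 : 0 < r := by linarith
  have hL' : (1 : ℝ) ≤ L := by exact_mod_cast hL
  rw [iterBound_eq hδ hδ' hr, iterBound_eq hδ hδ' hr]
  set G := ∑ e ∈ Finset.range L, δ⁻¹ ^ e
  set G' := ∑ e ∈ Finset.range L, (r ^ 2 / δ) ^ e
  have h1 : (1 : ℝ) ≤ G := by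
    obtain ⟨k, rfl⟩ := Nat.exists_eq_add_of_le' hL
    have := Finset.single_le_sum (f := fun e => δ⁻¹ ^ e) (fun e _ => by positivity)
      (Finset.mem_range.2 k.succ_pos)
    simp only [pow_zero] at this
    exact this
  have h2 : (1 : ℝ) ≤ L / (ρ * ε₀) * (ε₀ * G) := by
    rw [div_mul_eq_mul_div, le_div_iff₀ (by positivity)]
    have : ρ * ε₀ ≤ ε₀ := by nlinarith
    have : ε₀ ≤ L * (ε₀ * G) := by nlinarith [mul_le_mul hL' h1 zero_le_one (by positivity)]
    linarith
  have hx : 0 ≤ δ⁻¹ := by positivity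
  have hy : 0 ≤ r ^ 2 / δ := by positivity
  calc _ ≤ (2 * L) / (ρ * ε₀) * (C₃ * ((1 + δ⁻¹) * G) + C₅ * D * ((1 + r ^ 2 / δ) * G'))
        + (L + 1) := by
        push_cast
        gcongr
        · linarith
        · exact hgeom hx
        · exact hgeom hy
    _ ≤ (2 * L) / (ρ * ε₀) * (C₃ * ((1 + δ⁻¹) * G) + C₅ * D * ((1 + r ^ 2 / δ) * G'))
        + (L + L / (ρ * ε₀) * (ε₀ * G)) := by linarith
    _ = _ := by ring

/-- Shares of the probability of failure that decrease geometrically from the last loop to the first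
one. The ratio `r⁻¹` balances the growth of the step sizes. -/
lemma Setting.exists_withProb_gapWithin_rpow (S : P.Setting γ c₁ c₂ s₀ ε₀ δ r M B C z₀ w) {α : ℝ}
    (hα : 0 < α) (hr : r = δ ^ (-α / 2)) :
    ∃ C' : ℝ, ∀ ρ ε : ℝ, 0 < ρ → 0 < ε → ε ≤ ε₀ →
      P.WithProb.{u} γ c₁ c₂ z₀ s₀ ε₀ δ r M ρ fun X =>
        P.GapWithin γ c₁ c₂ z₀ X ε (C' / ρ * ε ^ (-α - 1)) := by
  have hD := S.Delta_nonneg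
  have hδ := S.δ_pos
  have hδ' := S.δ_lt_one
  have hε₀ := S.ε₀_pos
  have hs₀ := S.s₀_pos
  have hB := S.B_pos
  have hC := S.C_pos
  set D := P.Delta γ s₀ z₀ w
  set T := C * (1 + s₀ + 1 / s₀) with hT
  have hT0 : 0 < T := by positivity
  have hr1 : 1 < r := by
    rw [hr]
    exact Real.one_lt_rpow_of_pos_of_lt_one_of_neg hδ hδ' (by linarith)
  have hr0 : 0 < r := by linarith
  have hrinv : r⁻¹ < 1 := inv_lt_one_of_one_lt₀ hr1
  set c : ℝ := 1 - r⁻¹ with hc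
  have hc0 : 0 < c := sub_pos.2 hrinv
  -- `r ^ 2 / δ` is the factor by which the bound grows from one loop to the next
  set y : ℝ := r ^ 2 / δ with hy
  have hy1 : 1 < y := (one_lt_div hδ).2 (by nlinarith)
  have hy0 : 0 < y := by linarith
  have hyδ : y = δ ^ (-α - 1) := by
    rw [hy, hr, ← Real.rpow_natCast, ← Real.rpow_mul hδ.le, div_eq_mul_inv,
      ← Real.rpow_neg_one, ← Real.rpow_add hδ]
    congr 1
    push_cast
    ring
  refine ⟨((B + T * D) / (c ^ 2 * ε₀) + (1 + 1 / (y - 1))) * (δ / ε₀) ^ (-α - 1),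
    fun ρ ε hρ hε hεε₀ => ?_⟩
  rcases le_or_gt 1 ρ with hρ1 | hρ1
  · intro Ω _ μ _ 𝓖 X hX hBd
    rw [ENNReal.ofReal_of_nonpos (by linarith)]
    exact zero_le
  -- the first power of `δ` that brings the threshold down to `ε`
  have hex : ∃ L : ℕ, δ ^ L * ε₀ ≤ ε := by
    obtain ⟨L, hL⟩ := exists_pow_lt_of_lt_one (div_pos hε hε₀) hδ'
    exact ⟨L, ((lt_div_iff₀ hε₀).1 hL).le⟩
  classical
  set L := Nat.find hex with hLdef
  have hL1 : δ ^ L * ε₀ ≤ ε := Nat.find_spec hex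
  have hL2 : δ / ε₀ * ε ≤ δ ^ L := by
    rw [div_mul_eq_mul_div, div_le_iff₀ hε₀]
    rcases Nat.eq_zero_or_pos L with h0 | h0
    · rw [h0, pow_zero, one_mul]
      nlinarith
    · have h1 := Nat.find_min hex (show L - 1 < Nat.find hex by omega)
      push Not at h1
      calc δ * ε ≤ δ * (δ ^ (L - 1) * ε₀) := by gcongr
        _ = δ ^ L * ε₀ := by rw [← mul_assoc, mul_pow_sub_one (by omega)]
  have hyL : y ^ L ≤ (δ / ε₀) ^ (-α - 1) * ε ^ (-α - 1) := by
    rw [← Real.mul_rpow (by positivity) hε.le, hyδ, ← Real.rpow_natCast, ← Real.rpow_mul hδ.le,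
      mul_comm, Real.rpow_mul hδ.le, Real.rpow_natCast]
    exact Real.rpow_le_rpow_of_nonpos (by positivity) hL2 (by linarith)
  have hsum : ∀ N, ∑ e ∈ Finset.range N, r⁻¹ ^ e ≤ c⁻¹ := fun N => by
    have h := geom_sum_eq hrinv.ne N
    rw [h, ← neg_div_neg_eq, neg_sub, neg_sub, ← hc, div_eq_mul_inv]
    refine mul_le_of_le_one_left (inv_nonneg.2 hc0.le) ?_
    have : 0 ≤ r⁻¹ ^ N := by positivity
    linarith
  have hrefl : ∑ l ∈ Finset.range (L + 1), r⁻¹ ^ (L - l) ≤ c⁻¹ := by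
    have h := Finset.sum_range_reflect (fun e => r⁻¹ ^ e) (L + 1)
    simp only [Nat.add_sub_cancel] at h
    rw [h]
    exact hsum _
  refine (S.withProb_gapWithin (L := L) (q := fun l => c * r⁻¹ ^ (L - l))
    (fun l _ => by positivity) ?_ hρ (a := fun l => B + T * r ^ (2 * l) * D) (fun _ => rfl)
    (N := ((B + T * D) / (c ^ 2 * ε₀) + (1 + 1 / (y - 1))) / ρ * y ^ L) fun l' hl' => ?_).mono
    fun X h => h.mono hL1 ?_
  · rw [← Finset.mul_sum]
    calc _ ≤ c * c⁻¹ := by gcongr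
      _ = 1 := mul_inv_cancel₀ hc0.ne'
  · have hterm : ∀ l ≤ L, (B + T * r ^ (2 * l) * D) / (ρ * (c * r⁻¹ ^ (L - l))) / (δ ^ L * ε₀)
        ≤ (B + T * D) / (ρ * c * ε₀) * y ^ L * r⁻¹ ^ (L - l) := fun l hl => by
      have h1 : B + T * r ^ (2 * l) * D ≤ r ^ (2 * l) * (B + T * D) := by
        have : 1 ≤ r ^ (2 * l) := one_le_pow₀ hr1.le
        nlinarith
      have h2 : r ^ (2 * l) / r⁻¹ ^ (L - l) / δ ^ L = y ^ L * r⁻¹ ^ (L - l) := by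
        have h3 : r ^ (2 * L) = r ^ (2 * l) * (r ^ (L - l)) ^ 2 := by
          rw [← pow_mul, ← pow_add]; congr 1; omega
        rw [hy, div_pow, ← pow_mul, h3, inv_pow]
        field_simp
      calc _ ≤ (r ^ (2 * l) * (B + T * D)) / (ρ * (c * r⁻¹ ^ (L - l))) / (δ ^ L * ε₀) := by
            gcongr
        _ = (B + T * D) / (ρ * c * ε₀) * (r ^ (2 * l) / r⁻¹ ^ (L - l) / δ ^ L) := by
            field_simp
        _ = _ := by rw [h2]; ring
    have h1 : ∑ l ∈ Finset.range l', (B + T * r ^ (2 * l) * D) / (ρ * (c * r⁻¹ ^ (L - l)))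
          * (δ ^ (l' - 1 - l) / (δ ^ L * ε₀))
        + (B + T * r ^ (2 * l') * D) / (ρ * (c * r⁻¹ ^ (L - l'))) / (δ ^ L * ε₀)
        ≤ ∑ l ∈ Finset.range (l' + 1),
          (B + T * D) / (ρ * c * ε₀) * y ^ L * r⁻¹ ^ (L - l) := by
      rw [Finset.sum_range_succ]
      refine add_le_add (Finset.sum_le_sum fun l hl => ?_) (hterm l' hl')
      refine le_trans ?_ (hterm l ((Finset.mem_range.1 hl).le.trans hl'))
      have h2 : δ ^ (l' - 1 - l) ≤ 1 := pow_le_one₀ hδ.le hδ'.le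
      have h3 : 0 ≤ (B + T * r ^ (2 * l) * D) / (ρ * (c * r⁻¹ ^ (L - l))) := by positivity
      have h4 : 0 ≤ δ ^ L * ε₀ := by positivity
      exact (mul_le_mul_of_nonneg_left (div_le_div_of_nonneg_right h2 h4) h3).trans_eq
        (mul_one_div _ _)
    have h2 : ∑ l ∈ Finset.range (l' + 1), (B + T * D) / (ρ * c * ε₀) * y ^ L * r⁻¹ ^ (L - l)
        ≤ (B + T * D) / (ρ * c * ε₀) * y ^ L * c⁻¹ := by
      rw [← Finset.mul_sum]
      refine mul_le_mul_of_nonneg_left (le_trans ?_ hrefl) (by positivity)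
      exact Finset.sum_le_sum_of_subset_of_nonneg
        (Finset.range_mono (by omega)) fun l _ _ => by positivity
    have h3 : (l' + 1 : ℝ) ≤ (1 + 1 / (y - 1)) / ρ * y ^ L := by
      have h4 : (l' : ℝ) ≤ L := by exact_mod_cast hl'
      have h5 := one_add_mul_le_pow (show -2 ≤ y - 1 by linarith) L
      rw [add_sub_cancel] at h5
      have hy2 : 0 < y - 1 := by linarith
      have h6 : (L : ℝ) ≤ 1 / (y - 1) * y ^ L := by
        rw [div_mul_eq_mul_div, one_mul, le_div_iff₀ hy2]
        linarith
      have h7 : 1 ≤ y ^ L := one_le_pow₀ hy1.le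
      calc (l' + 1 : ℝ) ≤ (1 + 1 / (y - 1)) * y ^ L := by linarith
        _ ≤ (1 + 1 / (y - 1)) / ρ * y ^ L := by
          gcongr
          exact le_div_self (by positivity) hρ hρ1.le
    have h4 : (B + T * D) / (ρ * c * ε₀) * y ^ L * c⁻¹
        = (B + T * D) / (c ^ 2 * ε₀) / ρ * y ^ L := by field_simp
    calc _ ≤ (B + T * D) / (c ^ 2 * ε₀) / ρ * y ^ L + (1 + 1 / (y - 1)) / ρ * y ^ L := by
          linarith
      _ = _ := by ring
  · have hy2 : 0 < y - 1 := by linarith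
    calc _ ≤ ((B + T * D) / (c ^ 2 * ε₀) + (1 + 1 / (y - 1))) / ρ
          * ((δ / ε₀) ^ (-α - 1) * ε ^ (-α - 1)) :=
          mul_le_mul_of_nonneg_left hyL (by positivity)
      _ = _ := by ring

/-- A finite smoothed gap at a point means that `f` is finite there. -/
lemma domX_of_gap_eq_coe {βx βy ε : ℝ} {z : Point n m} (hw : P.IsSaddle w)
    (h : P.gap βx βy z z = (ε : EReal)) : P.DomX z.x := by
  refine P.domX_of_primal_ne_top fun htop => ?_
  have h1 : (P.primal z.x + P.dual z.y) + ((P.coupling z.x w.y - P.coupling w.x z.y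
      - βx / 2 * ∑ i, (w.x i - z.x i) ^ 2 - βy / 2 * ∑ j, (w.y j - z.y j) ^ 2 : ℝ) : EReal)
      - (P.primal w.x + P.dual w.y) ≤ P.gap βx βy z z :=
    le_iSup₂ (f := fun (x' : Fin n → ℝ) (y' : Fin m → ℝ) =>
      (P.primal z.x + P.dual z.y) + ((P.coupling z.x y' - P.coupling x' z.y
        - βx / 2 * ∑ i, (x' i - z.x i) ^ 2 - βy / 2 * ∑ j, (y' j - z.y j) ^ 2 : ℝ) : EReal)
        - (P.primal x' + P.dual y')) w.x w.y
  rw [h, htop, EReal.top_add_of_ne_bot (P.dual_ne_bot _), EReal.top_add_coe, P.primal_eq hw.domX,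
    P.dual_eq hw.domY, ← EReal.coe_add, EReal.top_sub_coe, top_le_iff] at h1
  exact EReal.coe_ne_top _ h1

end Problem
end PureCD

end

theorem theorem2 {n m : ℕ} (P : PureCD.Problem n m)
    (γ c₁ c₂ s₀ : ℝ) (hγ : 0 < γ) (hγ' : γ < 1) (hc₁ : 0 < c₁) (hc₂ : 0 < c₂) (hs₀ : 0 < s₀) :
    ∃ C₅ : ℝ, 0 < C₅ ∧
    ∀ (z₀ zs : PureCD.Point n m) (ε₀ M : ℝ), P.IsSaddle zs →
      P.gap (c₁ * s₀) (c₂ / s₀) z₀ z₀ = (ε₀ : EReal) → 0 < ε₀ →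
    ∃ C₃ : ℝ, 0 < C₃ ∧
    ∀ δ r : ℝ, 0 < δ → δ < 1 → 1 ≤ r →
      -- the gap is at most `δ ^ L * ε₀` within the number of iterations needed by the loops `0, …, L`
      (∀ (ρ : ℝ) (L : ℕ), 0 < ρ →
        P.WithProb.{u} γ c₁ c₂ z₀ s₀ ε₀ δ r M ρ fun X =>
          P.GapWithin γ c₁ c₂ z₀ X (δ ^ L * ε₀)
            (PureCD.iterBound C₃ C₅ (P.Delta γ s₀ z₀ zs) ε₀ δ r ρ (L + 1))) ∧
      -- if moreover the thresholds are `δ ^ l * ε₀`, the total length of the first `L` loops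
      (∀ (ρ : ℝ) (L : ℕ), 0 < ρ →
        P.WithProb.{u} γ c₁ c₂ z₀ s₀ ε₀ δ r M ρ fun X =>
          (∀ l < L, P.Reached γ c₁ c₂ z₀ X l → X.thr l = δ ^ l * ε₀) →
          P.Reached γ c₁ c₂ z₀ X L ∧
          (∀ l < L, P.gapAt γ c₁ c₂ z₀ X l (P.len γ c₁ c₂ z₀ X l)
            ≤ ((δ ^ l * ε₀ : ℝ) : EReal)) ∧
          ((∑ l ∈ Finset.range L, P.len γ c₁ c₂ z₀ X l : ℕ) : ℝ)
            ≤ PureCD.iterBound C₃ C₅ (P.Delta γ s₀ z₀ zs) ε₀ δ r ρ L) ∧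
      -- with constants that may depend on `δ` and `r`, the bound with `L` instead of `L + 1`
      (∃ C₃' C₅' : ℝ, ∀ (ρ : ℝ) (L : ℕ), 0 < ρ → ρ < 1 → 1 ≤ L →
        P.WithProb.{u} γ c₁ c₂ z₀ s₀ ε₀ δ r M ρ fun X =>
          P.GapWithin γ c₁ c₂ z₀ X (δ ^ L * ε₀)
            (PureCD.iterBound C₃' C₅' (P.Delta γ s₀ z₀ zs) ε₀ δ r ρ L)) ∧
      -- complexity
      (∀ α : ℝ, 0 < α → r = δ ^ (-α / 2) →
        ∃ C : ℝ, ∀ ρ ε : ℝ, 0 < ρ → 0 < ε → ε ≤ ε₀ →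
          P.WithProb.{u} γ c₁ c₂ z₀ s₀ ε₀ δ r M ρ fun X =>
            P.GapWithin γ c₁ c₂ z₀ X ε (C / ρ * ε ^ (-α - 1))) := by
  obtain ⟨C, hC, htail⟩ := P.exists_tail_bound hγ hγ' hc₁ hc₂
  have hT : 0 < C * (1 + s₀ + 1 / s₀) := by positivity
  refine ⟨2 * (C * (1 + s₀ + 1 / s₀)), by positivity, fun z₀ zs ε₀ M hzs hgap hε₀ => ?_⟩
  obtain ⟨B, hB, htail⟩ := htail zs M
  refine ⟨2 * B, by positivity, fun δ r hδ hδ' hr => ?_⟩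
  have S : P.Setting γ c₁ c₂ s₀ ε₀ δ r M B C z₀ zs :=
    ⟨hγ, hγ', hδ, hδ', hr, hs₀, hε₀, hzs, PureCD.Problem.domX_of_gap_eq_coe hzs hgap, hB, hC, htail⟩
  have hD := S.Delta_nonneg
  refine ⟨fun ρ L hρ => S.withProb_gapWithin_iterBound hρ L,
    fun ρ L hρ => S.withProb_sum_len_le hρ L,
    ⟨2 * (1 + δ⁻¹) * (2 * B) + ε₀, 2 * (1 + r ^ 2 / δ) * (2 * (C * (1 + s₀ + 1 / s₀))),
      fun ρ L hρ hρ' hL => (S.withProb_gapWithin_iterBound hρ L).mono fun X h => h.mono le_rfl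
        (PureCD.iterBound_succ_le hδ hδ' hr (by positivity) (by positivity) hD hε₀ hρ hρ' hL)⟩,
    fun α hα hr' => S.exists_withProb_gapWithin_rpow hα hr'⟩
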